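/- **Setting.** A configuration is a set of pairwise non-overlapping axis-parallel $1\times1$ squares in the plane (touching is allowed). A move slides one square along an arbitrary continuous curve, without rotation, so that it never overlaps another square; in the bounded scenario the squares also stay, at all times, inside a given rectilinear polygonal domain with integer coordinates (possibly with holes), not crossing its boundary. An instance consists of the scenario (unbounded, or a bounded domain given as a finite union of axis-parallel rectangles with integer corners) and of start and target configurations $S,T$ of unit squares at integer positions with $|S|=|T|$. Intermediate positions may be arbitrary real points. The squares are unlabeled: a schedule (finite sequence of valid moves) solves the instance if it starts in $S$ and the set of final positions is $T$. A solution is monotone if every square moves at most once. The size of an instance is the number of bits needed to write down all its integers. Let $G$ be the grid graph on the unit grid cells inside the domain (bounded case) or inside the axis-aligned bounding box of $S\cup T$ (unbounded case), where cells sharing a side are adjacent. A connected component $K$ of $G$ is balanced if it contains as many cells of $S$ as of $T$. Its flow network has an edge of capacity $1$ from a source to each cell of $S\cap K$, an edge of capacity $1$ from each cell of $T\cap K$ to a sink, and edges of capacity $|S\cap K|$ in both directions between adjacent cells of $K$. **Theorem.** 1. There is a polynomial-time algorithm which, given any instance, bounded or unbounded, outputs a monotone solution (each move given as a polyline with integer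 vertices) if the instance is solvable with any number of moves, and otherwise reports that no solution exists. 2. For every $k\ge1$, an instance has a solution in which every square moves at most $k$ times if and only if it has any solution. In particular, every solvable instance has a monotone solution. 3. An instance is solvable if and only if every connected component of $G$ is balanced. 4. For every balanced component $K$ the following procedure can be carried out and terminates, whatever choices are made. Take an integral maximum flow; as long as there is a directed cycle of cells with positive flow, reduce the flow by $1$ on its edges; let $w$ be the resulting acyclic flow on the cells and $R$ the set of squares that start in $K$. As long as $w$ has a sink, that is, a cell with positive inflow and no outflow, choose a sink $t$ (any sink will do) and a path of positive weight to $t$ from the start of a square in $R$ that visits no other start of a square in $R$ (such a path always exists), move that square along the path to $t$, reduce $w$ by $1$ on the edges of the path, and remove the square from $R$. 5. If the instance is solvable, then concatenating, in any order of the components, one schedule produced by this procedure for each component gives a monotone solution of the instance. -/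

import Mathlib

namespace SquareReconfig

/-! ### Squares, domains, moves and motion schedules in the plane -/

/-- Points of the plane. A unit square is named by its lower left corner. -/
abbrev Pt := ℝ × ℝ

/-- Integer points; also the unit grid cell with that lower left corner. -/
abbrev Cell := ℤ × ℤ

/-- The (open) unit square with lower left corner `p`. Two squares overlap when these open squares
intersect; touching along the boundary is allowed. -/
def square (p : Pt) : Set Pt := Set.Ioo p.1 (p.1 + 1) ×ˢ Set.Ioo p.2 (p.2 + 1)

def Cell.toPt (z : Cell) : Pt := ((z.1 : ℝ), (z.2 : ℝ))

/-- A nondegenerate axis-parallel rectangle with integer corners. -/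
structure Rect where
  left : ℤ
  right : ℤ
  bottom : ℤ
  top : ℤ
  left_lt_right : left < right
  bottom_lt_top : bottom < top

def Rect.toSet (r : Rect) : Set Pt :=
  Set.Icc (r.left : ℝ) (r.right : ℝ) ×ˢ Set.Icc (r.bottom : ℝ) (r.top : ℝ)

/-- `none` is the unbounded scenario. `some rs` is the rectilinear polygonal domain (holes allowed)
that is the union of the closed rectangles in `rs`. -/
abbrev Domain := Option (List Rect)

/-- The open set that squares have to stay inside: the plane in the unbounded scenario, the interior
of the polygonal domain in the bounded one. An open square is contained in it exactly when it lies in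
the domain and does not meet the boundary. -/
def Domain.free : Domain → Set Pt
  | none => Set.univ
  | some rs => interior {p | ∃ r ∈ rs, p ∈ r.toSet}

/-- Positions `c` of `n` squares form a configuration: inside the domain and non-overlapping. -/
def IsConfig (D : Domain) {n : ℕ} (c : Fin n → Pt) : Prop :=
  (∀ i, square (c i) ⊆ D.free) ∧ ∀ i j, i ≠ j → Disjoint (square (c i)) (square (c j))

/-- A move: one square slides along a continuous curve. -/
structure Move (n : ℕ) where
  robot : Fin n
  curve : C(unitInterval, Pt)

/-- The configuration after a move. -/
def applyMove {n : ℕ} (c : Fin n → Pt) (m : Move n) : Fin n → Pt :=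
  Function.update c m.robot (m.curve 1)

/-- The move starts where the square is, and at all times the moving square stays in the domain and
overlaps no other square. -/
def Move.IsValid (D : Domain) {n : ℕ} (c : Fin n → Pt) (m : Move n) : Prop :=
  m.curve 0 = c m.robot ∧
  ∀ t, square (m.curve t) ⊆ D.free ∧
    ∀ j, j ≠ m.robot → Disjoint (square (m.curve t)) (square (c j))

/-- All moves of the schedule are valid when executed one after the other from `c`. -/
def ValidSchedule (D : Domain) {n : ℕ} : (Fin n → Pt) → List (Move n) → Prop
  | _, [] => True
  | c, m :: ms => m.IsValid D c ∧ ValidSchedule D (applyMove c m) ms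

/-- The configuration reached at the end of a schedule. -/
def finalConfig {n : ℕ} (c : Fin n → Pt) (ms : List (Move n)) : Fin n → Pt :=
  ms.foldl applyMove c

/-- Every square moves at most `k` times. -/
def AtMostMoves {n : ℕ} (k : ℕ) (ms : List (Move n)) : Prop :=
  ∀ i, ms.countP (fun m => m.robot = i) ≤ k

/-- An instance of square reconfiguration for `1 × 1` squares: equally many start and target
positions at integer coordinates, each a configuration in the domain. -/
structure Instance where
  domain : Domain
  n : ℕ
  start : Fin n → Cell
  target : Fin n → Cell
  start_config : IsConfig domain (fun i => (start i).toPt)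
  target_config : IsConfig domain (fun i => (target i).toPt)

namespace Instance

def startPt (I : Instance) : Fin I.n → Pt := fun i => (I.start i).toPt

/-- The schedule is valid and reconfigures the start into the target configuration. The squares are
unlabeled: only the set of final positions matters. -/
def IsSolution (I : Instance) (ms : List (Move I.n)) : Prop :=
  ValidSchedule I.domain I.startPt ms ∧
  Set.range (finalConfig I.startPt ms) = Set.range (fun i => (I.target i).toPt)

/-- Solvable with any number of moves. -/
def Solvable (I : Instance) : Prop := ∃ ms, I.IsSolution ms

/-- Solvable with at most `k` moves per square; `k = 1` is the monotone problem. -/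
def SolvableWithin (I : Instance) (k : ℕ) : Prop := ∃ ms, I.IsSolution ms ∧ AtMostMoves k ms

end Instance

/-! ### Finitely described schedules: moves along polylines with integer vertices -/

/-- Square `robot` moves from its current position along straight segments through `waypoints`. -/
structure GridMove (n : ℕ) where
  robot : Fin n
  waypoints : List Cell

/-- The last vertex of the polyline that starts at `p` and goes through `l`. -/
def polyEnd : Pt → List Pt → Pt
  | p, [] => p
  | _, q :: l => polyEnd q l

/-- The polyline that starts at `p` and goes through `l`. -/
noncomputable def polyline : (p : Pt) → (l : List Pt) → Path p (polyEnd p l)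
  | p, [] => Path.refl p
  | p, q :: l => (Path.segment p q).trans (polyline q l)

noncomputable def GridMove.toMove {n : ℕ} (c : Fin n → Pt) (m : GridMove n) : Move n where
  robot := m.robot
  curve := (polyline (c m.robot) (m.waypoints.map Cell.toPt)).toContinuousMap

/-- The motion schedule in the plane described by a list of grid moves, executed from `c`. -/
noncomputable def realize {n : ℕ} : (Fin n → Pt) → List (GridMove n) → List (Move n)
  | _, [] => []
  | c, m :: ms => m.toMove c :: realize (applyMove c (m.toMove c)) ms

/-- The grid moves describe a solution in which every square moves at most once. -/
def Instance.IsMonotoneSolution (I : Instance) (ms : List (GridMove I.n)) : Prop :=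
  I.IsSolution (realize I.startPt ms) ∧ AtMostMoves 1 (realize I.startPt ms)

/-! ### A machine model with a step count

Structured programs for a random access machine: finitely many registers and arrays holding integers,
with addition, subtraction and comparison (no multiplication) at unit cost. Expressions in a program
have constant size, and one step increases the bit length of the stored numbers by at most a constant,
so polynomially many steps mean polynomial time on a Turing machine, and conversely. -/

inductive Expr where
  | const (z : ℤ)
  | reg (x : ℕ)
  | get (a : ℕ) (i : Expr)
  | add (e f : Expr)
  | sub (e f : Expr)

inductive Test where
  | le (e f : Expr)
  | not (b : Test)
  | and (b c : Test)

inductive Program where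
  | skip
  | assign (x : ℕ) (e : Expr)
  | store (a : ℕ) (i e : Expr)
  | seq (P Q : Program)
  | ite (b : Test) (P Q : Program)
  | while (b : Test) (P : Program)

structure State where
  reg : ℕ → ℤ
  arr : ℕ → ℤ → ℤ

def Expr.eval (s : State) : Expr → ℤ
  | .const z => z
  | .reg x => s.reg x
  | .get a i => s.arr a (i.eval s)
  | .add e f => e.eval s + f.eval s
  | .sub e f => e.eval s - f.eval s

def Test.eval (s : State) : Test → Bool
  | .le e f => decide (e.eval s ≤ f.eval s)
  | .not b => !b.eval s
  | .and b c => b.eval s && c.eval s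

def State.setReg (s : State) (x : ℕ) (z : ℤ) : State where
  reg := Function.update s.reg x z
  arr := s.arr

def State.setArr (s : State) (a : ℕ) (i z : ℤ) : State where
  reg := s.reg
  arr := Function.update s.arr a (Function.update (s.arr a) i z)

/-- `Exec P s t s'`: started in state `s`, the program `P` halts in state `s'` after `t` steps. Each
assignment, store and evaluation of a test is one step. -/
inductive Exec : Program → State → ℕ → State → Prop where
  | skip (s : State) : Exec .skip s 1 s
  | assign (x : ℕ) (e : Expr) (s : State) : Exec (.assign x e) s 1 (s.setReg x (e.eval s))
  | store (a : ℕ) (i e : Expr) (s : State) :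
      Exec (.store a i e) s 1 (s.setArr a (i.eval s) (e.eval s))
  | seq {P Q : Program} {s s' s'' : State} {t t' : ℕ} :
      Exec P s t s' → Exec Q s' t' s'' → Exec (.seq P Q) s (t + t') s''
  | ite_true {b : Test} {P Q : Program} {s s' : State} {t : ℕ} :
      b.eval s = true → Exec P s t s' → Exec (.ite b P Q) s (t + 1) s'
  | ite_false {b : Test} {P Q : Program} {s s' : State} {t : ℕ} :
      b.eval s = false → Exec Q s t s' → Exec (.ite b P Q) s (t + 1) s'
  | while_false {b : Test} {P : Program} {s : State} :
      b.eval s = false → Exec (.while b P) s 1 s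
  | while_true {b : Test} {P : Program} {s s' s'' : State} {t t' : ℕ} :
      b.eval s = true → Exec P s t s' → Exec (.while b P) s' t' s'' →
      Exec (.while b P) s (t + t' + 1) s''

/-- Initial state on input `l`: the length in register 0, the entries in array 0, all else zero. -/
def State.init (l : List ℤ) : State where
  reg := fun x => if x = 0 then (l.length : ℤ) else 0
  arr := fun a i => if a = 0 ∧ 0 ≤ i then l.getD i.toNat 0 else 0

/-- Output of a final state: its length is read from register 0, its entries from array 1. -/
def State.output (s : State) : List ℤ :=
  (List.range (s.reg 0).toNat).map (fun k => s.arr 1 (k : ℤ))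

/-- Total length of the binary representations (with one additional symbol per number). -/
def bitLength (l : List ℤ) : ℕ := (l.map (fun z => Nat.size z.natAbs + 1)).sum

def encodeCells (l : List Cell) : List ℤ := l.flatMap (fun z => [z.1, z.2])

def Domain.encode : Domain → List ℤ
  | none => [0]
  | some rs => 1 :: (rs.length : ℤ) :: rs.flatMap (fun r => [r.left, r.right, r.bottom, r.top])

/-- The input: the domain, the number of squares, the start positions, the target positions. -/
def Instance.encode (I : Instance) : List ℤ :=
  I.domain.encode ++ (I.n : ℤ) ::
    (encodeCells (List.ofFn I.start) ++ encodeCells (List.ofFn I.target))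

/-- The output: `0` for "no solution", or `1` followed by the moves of a schedule. -/
def encodeAnswer {n : ℕ} : Option (List (GridMove n)) → List ℤ
  | none => [0]
  | some ms => 1 :: (ms.length : ℤ) :: ms.flatMap (fun m =>
      ((m.robot : ℕ) : ℤ) :: (m.waypoints.length : ℤ) :: encodeCells m.waypoints)

/-- A correct answer: a monotone solution, or "no" if there is no solution at all, with however many
moves per square. -/
def Instance.IsCorrectAnswer (I : Instance) : Option (List (GridMove I.n)) → Prop
  | none => ¬ I.Solvable
  | some ms => I.IsMonotoneSolution ms

/-! ### The grid graph, the flow network and the extraction of a schedule -/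

/-- The four horizontal and vertical neighbours of a cell. -/
def nbrs (v : Cell) : Finset Cell :=
  {(v.1 + 1, v.2), (v.1 - 1, v.2), (v.1, v.2 + 1), (v.1, v.2 - 1)}

namespace Instance

/-- `p` is one of the start or target positions. -/
def IsStartOrTarget (I : Instance) (p : Cell) : Prop :=
  (∃ i, I.start i = p) ∨ ∃ i, I.target i = p

/-- The vertices of the grid graph: the unit cells inside the domain if bounded, and in the
axis-aligned bounding box of the start and target positions if unbounded. -/
def gridCells (I : Instance) : Set Cell :=
  match I.domain with
  | some rs => {z | square z.toPt ⊆ Domain.free (some rs)}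
  | none => {z | (∃ p, I.IsStartOrTarget p ∧ p.1 ≤ z.1) ∧ (∃ p, I.IsStartOrTarget p ∧ z.1 ≤ p.1) ∧
      (∃ p, I.IsStartOrTarget p ∧ p.2 ≤ z.2) ∧ (∃ p, I.IsStartOrTarget p ∧ z.2 ≤ p.2)}

/-- Grid cells are adjacent when they are horizontal or vertical neighbours. -/
def gridGraph (I : Instance) : SimpleGraph I.gridCells where
  Adj u v := v.1 ∈ nbrs u.1
  symm := ⟨by
    rintro ⟨⟨a, b⟩, _⟩ ⟨⟨c, d⟩, _⟩ h
    simp only [nbrs, Finset.mem_insert, Finset.mem_singleton, Prod.mk.injEq] at h ⊢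
    omega⟩
  loopless := ⟨by
    rintro ⟨⟨a, b⟩, _⟩ h
    simp only [nbrs, Finset.mem_insert, Finset.mem_singleton, Prod.mk.injEq] at h
    omega⟩

abbrev Component (I : Instance) := I.gridGraph.ConnectedComponent

/-- The set of cells of a connected component. -/
def Component.cells {I : Instance} (K : I.Component) : Set Cell := Subtype.val '' K.supp

/-- The component holds as many starts as targets. -/
def Balanced (I : Instance) (K : I.Component) : Prop :=
  Nat.card {i // I.start i ∈ K.cells} = Nat.card {i // I.target i ∈ K.cells}

/-- An integral flow in the network of a component `K`: an edge of capacity 1 from the source to each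
start and from each target to the sink, and edges in both directions between adjacent cells, with
capacity the number of squares of the component. -/
structure Flow (I : Instance) (K : I.Component) where
  source : Fin I.n → ℕ
  sink : Fin I.n → ℕ
  edge : Cell → Cell → ℕ
  source_le : ∀ i, source i ≤ 1
  sink_le : ∀ i, sink i ≤ 1
  source_mem : ∀ i, source i ≠ 0 → I.start i ∈ K.cells
  sink_mem : ∀ i, sink i ≠ 0 → I.target i ∈ K.cells
  edge_le : ∀ u v, edge u v ≤ Nat.card {i // I.start i ∈ K.cells}
  edge_mem : ∀ u v, edge u v ≠ 0 → u ∈ K.cells ∧ v ∈ K.cells ∧ v ∈ nbrs u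
  conservation : ∀ v,
    ∑ i with I.start i = v, source i + ∑ u ∈ nbrs v, edge u v =
      ∑ i with I.target i = v, sink i + ∑ u ∈ nbrs v, edge v u

end Instance

/-- The edges of the closed walk through the vertices in `l`. -/
def cycleEdges (l : List Cell) : List (Cell × Cell) := l.zip (l.rotate 1)

/-- A directed cycle all of whose edges have positive weight. -/
def IsPosCycle (w : Cell → Cell → ℕ) (l : List Cell) : Prop :=
  l ≠ [] ∧ l.Nodup ∧ ∀ e ∈ cycleEdges l, 0 < w e.1 e.2

namespace Instance.Flow

variable {I : Instance} {K : I.Component}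

def value (F : I.Flow K) : ℕ := ∑ i, F.source i

/-- A maximum flow. -/
def IsMax (F : I.Flow K) : Prop := ∀ G : I.Flow K, G.value ≤ F.value

/-- `G` arises from `F` by reducing the flow by 1 along one positive directed cycle. -/
def CancelsTo (F G : I.Flow K) : Prop :=
  G.source = F.source ∧ G.sink = F.sink ∧
  ∃ l, IsPosCycle F.edge l ∧
    ∀ u v, G.edge u v = F.edge u v - (if (u, v) ∈ cycleEdges l then 1 else 0)

/-- There is no positive directed cycle: the edges of positive weight form a DAG. -/
def IsAcyclic (F : I.Flow K) : Prop := ∀ l, ¬ IsPosCycle F.edge l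

end Instance.Flow

/-- A sink of the weighted DAG `w`: a vertex on an edge of positive weight, with out-degree zero. -/
def IsSink (w : Cell → Cell → ℕ) (t : Cell) : Prop := (∃ u, 0 < w u t) ∧ ∀ v, w t v = 0

namespace Instance

/-- One extraction step, for remaining weights `w` and the set `R` of squares that have not moved yet:
choose a sink `t` and a path of positive weight from the start of a square in `R` to `t` that visits
no other start of a square in `R`; move the square along it and reduce the weights on it by one. -/
structure ExtractStep (I : Instance) (w : Cell → Cell → ℕ) (R : Finset (Fin I.n))
    (m : GridMove I.n) (t : Cell) (w' : Cell → Cell → ℕ) : Prop where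
  mem : m.robot ∈ R
  sink : IsSink w t
  ends : m.waypoints.getLast? = some t
  path : List.IsChain (fun u v => 0 < w u v) (I.start m.robot :: m.waypoints)
  avoids : ∀ v ∈ m.waypoints, ∀ j ∈ R, I.start j ≠ v
  weight : ∀ u v, w' u v =
    w u v - ((I.start m.robot :: m.waypoints).zip m.waypoints).count (u, v)

/-- `ms` is the list of moves of a (partial) run of extraction steps that leads from weights `w` and
remaining squares `R` to weights `w'` and remaining squares `R'`. -/
inductive ExtractRun (I : Instance) : (Cell → Cell → ℕ) → Finset (Fin I.n) → List (GridMove I.n) →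
    (Cell → Cell → ℕ) → Finset (Fin I.n) → Prop where
  | nil (w : Cell → Cell → ℕ) (R : Finset (Fin I.n)) : ExtractRun I w R [] w R
  | cons {w w' w'' : Cell → Cell → ℕ} {R R' : Finset (Fin I.n)} {m : GridMove I.n}
      {ms : List (GridMove I.n)} {t : Cell} :
      I.ExtractStep w R m t w' → ExtractRun I w' (R.erase m.robot) ms w'' R' →
      ExtractRun I w R (m :: ms) w'' R'

open Classical in
/-- The squares that start in the component. -/
noncomputable def squaresIn (I : Instance) (K : I.Component) : Finset (Fin I.n) :=
  Finset.univ.filter (fun i => I.start i ∈ K.cells)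

/-- `F` is an acyclic flow obtained by cancelling cycles in a maximum flow of the component. -/
def IsReducedMaxFlow (I : Instance) (K : I.Component) (F : I.Flow K) : Prop :=
  F.IsAcyclic ∧ ∃ G : I.Flow K, G.IsMax ∧ Relation.ReflTransGen Instance.Flow.CancelsTo G F

/-- `ms` is a possible result of the whole procedure on one component: maximum flow, cancellation of
all cycles, extraction until no sink remains. -/
def IsFlowSchedule (I : Instance) (K : I.Component) (ms : List (GridMove I.n)) : Prop :=
  ∃ F, I.IsReducedMaxFlow K F ∧
    ∃ w R, I.ExtractRun F.edge (I.squaresIn K) ms w R ∧ ∀ t, ¬ IsSink w t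

end Instance

end SquareReconfig

/-! Necessity of balance is topological. A unit square in the domain overlaps at most a 2 × 2 block
of grid cells, all in the domain, so it always belongs to exactly one component of cells. Belonging
to a given component is an open and closed condition along a continuous motion, hence invariant
(`near_curve`). Matching initial with final positions therefore gives as many starts as targets in
every component (`Solvable.card_eq`, `Solvable.balanced`), however many moves are made and through
whatever real positions.

Sufficiency comes from flows. In a balanced component, unit flows along simple paths from starts to
matched targets show that a maximum flow saturates every start and target (`exists_value_eq`,
`IsMax.saturated`). Cancelling cycles keeps this and ends in an acyclic flow. The invariant of the
extraction (`Extraction`) says that conservation holds for the unmoved squares and unreached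
targets, and that no remaining flow touches the cell of a square outside `R`. By conservation a sink
is an unreached target with inflow exactly 1, and walking backwards from it along positive edges
must meet the start of an unmoved square; stopping at the first one gives the required path. Its
cells are free, because settled squares stand on cells without flow, and afterwards the sink carries
no flow either. When no sink is left the flow is zero, so the remaining starts and targets coincide.
Components do not interfere, whence `isMonotoneSolution_flatMap`, and with it the equivalences on
solvability.

The grid graph may be exponentially large in the bit length, so the algorithm works on a compressed
grid: the points of the domain whose coordinates occur among the input numbers. Rounding down is a
retraction onto this grid and preserves components (`gridConn_iff`). Non-cut vertices are eliminated
one by one (`Elimination`). A vertex that is only a target is filled at once by the first square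
found from it and then blocks nobody. A vertex that is only a start is emptied at the end, dually,
towards the first target found from it. A vertex that is both keeps its square. The moves made at
once followed by the postponed moves, the latter in reverse order of elimination, form a monotone
schedule; if a search finds no partner, balance fails and the instance is unsolvable.

The algorithm is written in a language with `for` loops only (`Code`), whose total semantics
supports loop invariants (`loop_inv`) and whose running time is bounded by a polynomial read off the
syntax (`Code.exec`). `solver_spec` combines correctness and time. -/

namespace SquareReconfig
open Relation

/-! ### Integer cells and real positions -/

/-- The unit grid cells inside the domain. -/
def Domain.cells (D : Domain) : Set Cell := {z | square (Cell.toPt z) ⊆ D.free}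

/-- The square at `p` overlaps the unit grid cell `z`. -/
def Touch (p : Pt) (z : Cell) : Prop :=
  (z.1 : ℝ) < p.1 + 1 ∧ p.1 < z.1 + 1 ∧ (z.2 : ℝ) < p.2 + 1 ∧ p.2 < z.2 + 1

theorem toPt_injective : Function.Injective Cell.toPt := by
  rintro ⟨a, b⟩ ⟨c, d⟩ h
  simpa [Cell.toPt] using h

theorem touch_toPt {z w : Cell} : Touch (Cell.toPt w) z ↔ w = z := by
  constructor
  · rintro ⟨h1, h2, h3, h4⟩
    simp only [Cell.toPt] at h1 h2 h3 h4
    norm_cast at h1 h2 h3 h4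
    ext <;> omega
  · rintro rfl
    simp [Touch, Cell.toPt]

theorem square_nonempty (p : Pt) : (square p).Nonempty :=
  ⟨(p.1 + 1 / 2, p.2 + 1 / 2), by constructor <;> constructor <;> norm_num⟩

theorem disjoint_square_of_not_touch {p : Pt} {z : Cell} (h : ¬ Touch p z) :
    Disjoint (square p) (square (Cell.toPt z)) := by
  rw [Set.disjoint_left]
  rintro q ⟨⟨h1, h2⟩, h3, h4⟩ ⟨⟨h5, h6⟩, h7, h8⟩
  simp only [Cell.toPt] at h5 h6 h7 h8
  exact h ⟨by linarith, by linarith, by linarith, by linarith⟩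

/-- Corners are integers, so a rectangle that contains a point of an open unit cell contains the
whole cell. -/
theorem exists_rect_of_mem_free {rs : List Rect} {q : Pt} {z : Cell}
    (hq : q ∈ Domain.free (some rs)) (hz : q ∈ square (Cell.toPt z)) :
    ∃ r ∈ rs, r.left ≤ z.1 ∧ z.1 < r.right ∧ r.bottom ≤ z.2 ∧ z.2 < r.top := by
  obtain ⟨r, hr, ⟨h1, h2⟩, h3, h4⟩ := interior_subset hq
  obtain ⟨⟨h5, h6⟩, h7, h8⟩ := hz
  simp only [Cell.toPt] at h5 h6 h7 h8
  refine ⟨r, hr, ?_, ?_, ?_, ?_⟩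
  · have : (r.left : ℝ) < z.1 + 1 := by linarith
    norm_cast at this; omega
  · have : (z.1 : ℝ) < r.right := by linarith
    exact_mod_cast this
  · have : (r.bottom : ℝ) < z.2 + 1 := by linarith
    norm_cast at this; omega
  · have : (z.2 : ℝ) < r.top := by linarith
    exact_mod_cast this

theorem mem_cells_some {rs : List Rect} {z : Cell} :
    z ∈ Domain.cells (some rs) ↔
      ∃ r ∈ rs, r.left ≤ z.1 ∧ z.1 < r.right ∧ r.bottom ≤ z.2 ∧ z.2 < r.top := by
  constructor
  · intro h
    obtain ⟨q, hq⟩ := square_nonempty (Cell.toPt z)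
    exact exists_rect_of_mem_free (h hq) hq
  · rintro ⟨r, hr, h1, h2, h3, h4⟩
    refine interior_maximal ?_ (isOpen_Ioo.prod isOpen_Ioo)
    rintro q ⟨⟨h5, h6⟩, h7, h8⟩
    simp only [Cell.toPt] at h5 h6 h7 h8
    have e1 : (r.left : ℝ) ≤ z.1 := by exact_mod_cast h1
    have e2 : (z.1 : ℝ) + 1 ≤ r.right := by exact_mod_cast h2
    have e3 : (r.bottom : ℝ) ≤ z.2 := by exact_mod_cast h3
    have e4 : (z.2 : ℝ) + 1 ≤ r.top := by exact_mod_cast h4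
    exact ⟨r, hr, ⟨by linarith, by linarith⟩, by linarith, by linarith⟩

theorem cells_none : Domain.cells none = Set.univ := by
  ext z; simp [Domain.cells, Domain.free]

/-- Two overlapping open squares share a point, and this point already determines a rectangle around
the cell. With the converse `square_subset_free`, containment of a real position becomes a condition
on the few cells that it overlaps. -/
theorem mem_cells_of_touch {D : Domain} {p : Pt} {z : Cell} (hp : square p ⊆ D.free)
    (h : Touch p z) : z ∈ D.cells := by
  cases D with
  | none => simp [cells_none]
  | some rs =>
    obtain ⟨h1, h2, h3, h4⟩ := h
    obtain ⟨x, hx1, hx2⟩ := exists_between (max_lt (lt_min (by linarith) h2)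
      (lt_min h1 (by linarith)) : max p.1 z.1 < min (p.1 + 1) (z.1 + 1))
    obtain ⟨y, hy1, hy2⟩ := exists_between (max_lt (lt_min (by linarith) h4)
      (lt_min h3 (by linarith)) : max p.2 z.2 < min (p.2 + 1) (z.2 + 1))
    rw [max_lt_iff] at hx1 hy1
    rw [lt_min_iff] at hx2 hy2
    rw [mem_cells_some]
    exact exists_rect_of_mem_free (q := (x, y))
      (hp ⟨⟨hx1.1, hx2.1⟩, hy1.1, hy2.1⟩) ⟨⟨hx1.2, hx2.2⟩, hy1.2, hy2.2⟩

theorem square_subset_free {D : Domain} {p : Pt} (h : ∀ z, Touch p z → z ∈ D.cells) :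
    square p ⊆ D.free := by
  cases D with
  | none => simp [Domain.free]
  | some rs =>
    -- The square is open, so it suffices to cover it by the closed rectangles; each point is
    -- covered through the cell obtained by rounding down its coordinates.
    refine interior_maximal ?_ (isOpen_Ioo.prod isOpen_Ioo)
    rintro q ⟨⟨h5, h6⟩, h7, h8⟩
    have f1 := Int.floor_le q.1
    have f2 := Int.lt_floor_add_one q.1
    have f3 := Int.floor_le q.2
    have f4 := Int.lt_floor_add_one q.2
    obtain ⟨r, hr, h1, h2, h3, h4⟩ := mem_cells_some.1 (h (⌊q.1⌋, ⌊q.2⌋)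
      ⟨by dsimp; linarith, by dsimp; linarith, by dsimp; linarith, by dsimp; linarith⟩)
    have e1 : (r.left : ℝ) ≤ ⌊q.1⌋ := by exact_mod_cast h1
    have e2 : (⌊q.1⌋ : ℝ) + 1 ≤ r.right := by exact_mod_cast h2
    have e3 : (r.bottom : ℝ) ≤ ⌊q.2⌋ := by exact_mod_cast h3
    have e4 : (⌊q.2⌋ : ℝ) + 1 ≤ r.top := by exact_mod_cast h4
    exact ⟨r, hr, ⟨by linarith, by linarith⟩, by linarith, by linarith⟩

/-! ### Connectivity of cells is an invariant of motions -/

theorem mem_nbrs {u v : Cell} : v ∈ nbrs u ↔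
    (v.1 = u.1 + 1 ∧ v.2 = u.2) ∨ (v.1 = u.1 - 1 ∧ v.2 = u.2) ∨
    (v.1 = u.1 ∧ v.2 = u.2 + 1) ∨ (v.1 = u.1 ∧ v.2 = u.2 - 1) := by
  simp [nbrs, Prod.ext_iff]

theorem nbrs_comm {u v : Cell} : v ∈ nbrs u ↔ u ∈ nbrs v := by
  simp only [mem_nbrs]; omega

/-- Neighbouring cells of a set. -/
def CellAdj (A : Set Cell) (u v : Cell) : Prop := u ∈ A ∧ v ∈ A ∧ v ∈ nbrs u

/-- Cells joined by a path of neighbouring cells of a set. -/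
def Conn (A : Set Cell) : Cell → Cell → Prop := ReflTransGen (CellAdj A)

theorem Conn.symm {A : Set Cell} {u v : Cell} (h : Conn A u v) : Conn A v u := by
  induction h with
  | refl => exact ReflTransGen.refl
  | tail _ h ih => exact ReflTransGen.head ⟨h.2.1, h.1, nbrs_comm.1 h.2.2⟩ ih

theorem Conn.trans {A : Set Cell} {u v w : Cell} (h : Conn A u v) (h' : Conn A v w) :
    Conn A u w := ReflTransGen.trans h h'

/-- The overlapped cells form a block of at most 2 × 2, all inside the domain, and `(z.1, w.2)` is
the corner of the block through which the two cells are joined. This is why a square cannot slip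
between cells that share only a corner. -/
theorem conn_of_touch {D : Domain} {p : Pt} {z w : Cell} (hp : square p ⊆ D.free)
    (hz : Touch p z) (hw : Touch p w) : Conn D.cells z w := by
  have hu : Touch p (z.1, w.2) := ⟨hz.1, hz.2.1, hw.2.2.1, hw.2.2.2⟩
  have cz := mem_cells_of_touch hp hz
  have cw := mem_cells_of_touch hp hw
  have cu := mem_cells_of_touch hp hu
  obtain ⟨a1, a2, a3, a4⟩ := hz
  obtain ⟨b1, b2, b3, b4⟩ := hw
  have k1 : (z.1 : ℝ) < w.1 + 2 := by linarith
  have k2 : (w.1 : ℝ) < z.1 + 2 := by linarith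
  have k3 : (z.2 : ℝ) < w.2 + 2 := by linarith
  have k4 : (w.2 : ℝ) < z.2 + 2 := by linarith
  norm_cast at k1 k2 k3 k4
  have s1 : Conn D.cells z (z.1, w.2) := by
    by_cases h : z.2 = w.2
    · rw [← h]; exact ReflTransGen.refl
    · exact ReflTransGen.single ⟨cz, cu, by rw [mem_nbrs]; dsimp; omega⟩
  refine s1.trans ?_
  by_cases h : z.1 = w.1
  · rw [h]; exact ReflTransGen.refl
  · exact ReflTransGen.single ⟨cu, cw, by rw [mem_nbrs]; dsimp; omega⟩

/-- The square at `p` overlaps a cell of the component of `z`. -/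
def Near (D : Domain) (z : Cell) (p : Pt) : Prop := ∃ w, Conn D.cells z w ∧ Touch p w

theorem near_toPt {D : Domain} {z w : Cell} : Near D z (Cell.toPt w) ↔ Conn D.cells z w := by
  simp [Near, touch_toPt]

theorem exists_touch (p : Pt) : ∃ z, Touch p z := by
  have f1 := Int.floor_le p.1
  have f2 := Int.lt_floor_add_one p.1
  have f3 := Int.floor_le p.2
  have f4 := Int.lt_floor_add_one p.2
  exact ⟨(⌊p.1⌋, ⌊p.2⌋),
    by dsimp; linarith, by dsimp; linarith, by dsimp; linarith, by dsimp; linarith⟩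

theorem isOpen_touch (z : Cell) : IsOpen {p | Touch p z} := by
  have e : {p | Touch p z} = {p : Pt | (z.1 : ℝ) < p.1 + 1} ∩ ({p : Pt | p.1 < z.1 + 1} ∩
      ({p : Pt | (z.2 : ℝ) < p.2 + 1} ∩ {p : Pt | p.2 < z.2 + 1})) := rfl
  rw [e]
  refine IsOpen.inter ?_ (IsOpen.inter ?_ (IsOpen.inter ?_ ?_)) <;>
    exact isOpen_lt (by fun_prop) (by fun_prop)

/-- Overlapping a cell is an open condition. By `conn_of_touch` the complement of being near a
component is being near some other one, hence open too, and the unit interval is connected. -/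
theorem near_curve {D : Domain} {γ : C(unitInterval, Pt)} (h : ∀ t, square (γ t) ⊆ D.free)
    (z : Cell) : Near D z (γ 0) ↔ Near D z (γ 1) := by
  have ho : IsOpen {t | Near D z (γ t)} := by
    have e : {t | Near D z (γ t)} = ⋃ w ∈ {w | Conn D.cells z w}, γ ⁻¹' {p | Touch p w} := by
      ext t; simp [Near]
    rw [e]
    exact isOpen_biUnion fun w _ => (isOpen_touch w).preimage γ.continuous
  have hc : IsClosed {t | Near D z (γ t)} := by
    rw [← isOpen_compl_iff]
    have e : {t | Near D z (γ t)}ᶜ = ⋃ w ∈ {w | ¬ Conn D.cells z w}, γ ⁻¹' {p | Touch p w} := by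
      ext t
      simp only [Set.mem_compl_iff, Set.mem_ofPred_eq, Set.mem_iUnion, Set.mem_preimage, exists_prop]
      constructor
      · intro hn
        obtain ⟨w, hw⟩ := exists_touch (γ t)
        exact ⟨w, fun hc => hn ⟨w, hc, hw⟩, hw⟩
      · rintro ⟨w, hw, hwt⟩ ⟨w', hw', hwt'⟩
        exact hw (hw'.trans (conn_of_touch (h t) hwt' hwt))
    rw [e]
    exact isOpen_biUnion fun w _ => (isOpen_touch w).preimage γ.continuous
  rcases isClopen_iff.1 ⟨hc, ho⟩ with e | e
  · have h0 : (0 : unitInterval) ∉ {t | Near D z (γ t)} := by rw [e]; exact fun h => h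
    have h1 : (1 : unitInterval) ∉ {t | Near D z (γ t)} := by rw [e]; exact fun h => h
    exact iff_of_false h0 h1
  · have h0 : (0 : unitInterval) ∈ {t | Near D z (γ t)} := by rw [e]; trivial
    have h1 : (1 : unitInterval) ∈ {t | Near D z (γ t)} := by rw [e]; trivial
    exact iff_of_true h0 h1

theorem near_finalConfig {D : Domain} {n : ℕ} (z : Cell) (i : Fin n) (ms : List (Move n)) :
    ∀ c : Fin n → Pt, ValidSchedule D c ms → (Near D z (c i) ↔ Near D z (finalConfig c ms i)) := by
  induction ms with
  | nil => intro c _; rfl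
  | cons m ms ih =>
    rintro c ⟨⟨h0, h1⟩, h2⟩
    refine Iff.trans ?_ (ih _ h2)
    by_cases hi : i = m.robot
    · subst hi
      rw [← h0, near_curve (fun t => (h1 t).1) z]
      simp [applyMove]
    · simp [applyMove, hi]

namespace Instance

theorem start_injective (I : Instance) : Function.Injective I.start := by
  intro i j h
  by_contra hij
  have := I.start_config.2 i j hij
  simp only [h, disjoint_self] at this
  exact (square_nonempty _).ne_empty this

theorem target_injective (I : Instance) : Function.Injective I.target := by
  intro i j h
  by_contra hij
  have := I.target_config.2 i j hij
  simp only [h, disjoint_self] at this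
  exact (square_nonempty _).ne_empty this

theorem start_mem (I : Instance) (i : Fin I.n) : I.start i ∈ I.domain.cells := I.start_config.1 i

theorem target_mem (I : Instance) (i : Fin I.n) : I.target i ∈ I.domain.cells :=
  I.target_config.1 i

/-- Equality of the two ranges makes the assignment `σ` of squares to reached targets a bijection,
and `σ` respects components by `near_finalConfig`. -/
theorem Solvable.card_eq {I : Instance} (h : I.Solvable) (z : Cell) :
    Nat.card {i // Conn I.domain.cells z (I.start i)} =
      Nat.card {i // Conn I.domain.cells z (I.target i)} := by
  obtain ⟨ms, hv, hr⟩ := h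
  have hσ : ∀ i, ∃ j, Cell.toPt (I.target j) = finalConfig I.startPt ms i := fun i => by
    have : finalConfig I.startPt ms i ∈ Set.range (fun i => Cell.toPt (I.target i)) := by
      rw [← hr]; exact ⟨i, rfl⟩
    exact this
  choose σ hσ using hσ
  have hs : Function.Surjective σ := fun j => by
    have : Cell.toPt (I.target j) ∈ Set.range (finalConfig I.startPt ms) := by
      rw [hr]; exact ⟨j, rfl⟩
    obtain ⟨i, hi⟩ := this
    exact ⟨i, I.target_injective (toPt_injective ((hσ i).trans hi))⟩
  have hb : Function.Bijective σ := ⟨Finite.injective_iff_surjective.2 hs, hs⟩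
  refine Nat.card_congr ((Equiv.ofBijective σ hb).subtypeEquiv fun i => ?_)
  rw [← near_toPt, ← near_toPt, Equiv.ofBijective_apply, hσ]
  exact near_finalConfig z i ms I.startPt hv

end Instance

/-! ### Schedules on the level of cells -/

/-- A straight segment between integer positions that sweeps over cells of the domain only and over
no occupied cell. -/
def ClearSegment (D : Domain) (occ : Set Cell) (u v : Cell) : Prop :=
  (u.1 = v.1 ∨ u.2 = v.2) ∧ ∀ w : Cell, min u.1 v.1 ≤ w.1 → w.1 ≤ max u.1 v.1 →
    min u.2 v.2 ≤ w.2 → w.2 ≤ max u.2 v.2 → w ∈ D.cells ∧ w ∉ occ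

theorem ClearSegment.of_mem_nbrs {D : Domain} {occ : Set Cell} {u v : Cell} (h : v ∈ nbrs u)
    (hu : u ∈ D.cells) (hv : v ∈ D.cells) (hu' : u ∉ occ) (hv' : v ∉ occ) :
    ClearSegment D occ u v := by
  rw [mem_nbrs] at h
  refine ⟨by omega, fun w h1 h2 h3 h4 => ?_⟩
  have : w = u ∨ w = v := by simp only [Prod.ext_iff]; omega
  rcases this with rfl | rfl <;> exact ⟨‹_›, ‹_›⟩

/-- An integer at distance less than 1 from a real number between two integers lies between these
integers as well. -/
theorem mem_segment_touch {u v w : Cell} {p : Pt}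
    (hp : p ∈ segment ℝ (Cell.toPt u) (Cell.toPt v)) (hw : Touch p w) :
    min u.1 v.1 ≤ w.1 ∧ w.1 ≤ max u.1 v.1 ∧ min u.2 v.2 ≤ w.2 ∧ w.2 ≤ max u.2 v.2 := by
  obtain ⟨a, b, ha, hb, hab, rfl⟩ := hp
  obtain ⟨h1, h2, h3, h4⟩ := hw
  simp only [Cell.toPt, Prod.smul_mk, smul_eq_mul, Prod.mk_add_mk] at h1 h2 h3 h4
  have key : ∀ x y k : ℤ, (k : ℝ) < a * x + b * y + 1 → a * x + b * y < (k : ℝ) + 1 →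
      min x y ≤ k ∧ k ≤ max x y := by
    intro x y k k1 k2
    have m1 : ((min x y : ℤ) : ℝ) ≤ x := by exact_mod_cast min_le_left x y
    have m2 : ((min x y : ℤ) : ℝ) ≤ y := by exact_mod_cast min_le_right x y
    have m3 : (x : ℝ) ≤ (max x y : ℤ) := by exact_mod_cast le_max_left x y
    have m4 : (y : ℝ) ≤ (max x y : ℤ) := by exact_mod_cast le_max_right x y
    have b1 : a = 1 - b := by linarith
    have l1 : ((min x y : ℤ) : ℝ) < k + 1 := by
      have := mul_le_mul_of_nonneg_left m1 ha
      have := mul_le_mul_of_nonneg_left m2 hb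
      subst b1; linarith
    have l2 : (k : ℝ) < (max x y : ℤ) + 1 := by
      have := mul_le_mul_of_nonneg_left m3 ha
      have := mul_le_mul_of_nonneg_left m4 hb
      subst b1; linarith
    norm_cast at l1 l2
    omega
  exact ⟨(key _ _ _ h1 h2).1, (key _ _ _ h1 h2).2, (key _ _ _ h3 h4).1, (key _ _ _ h3 h4).2⟩

theorem ClearSegment.free {D : Domain} {occ : Set Cell} {u v : Cell} (h : ClearSegment D occ u v)
    {p : Pt} (hp : p ∈ segment ℝ (Cell.toPt u) (Cell.toPt v)) :
    square p ⊆ D.free ∧ ∀ w ∈ occ, Disjoint (square p) (square (Cell.toPt w)) := by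
  have key : ∀ w, Touch p w → w ∈ D.cells ∧ w ∉ occ := fun w hw => by
    obtain ⟨h1, h2, h3, h4⟩ := mem_segment_touch hp hw
    exact h.2 w h1 h2 h3 h4
  exact ⟨square_subset_free fun w hw => (key w hw).1,
    fun w hw => disjoint_square_of_not_touch fun ht => (key w ht).2 hw⟩

theorem polyEnd_map (l : List Cell) (p : Cell) :
    polyEnd (Cell.toPt p) (l.map Cell.toPt) = Cell.toPt (l.getLastD p) := by
  induction l generalizing p with
  | nil => rfl
  | cons q l ih => simp only [List.map_cons, polyEnd, ih, List.getLastD_cons]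

/-- Only the image of the curve matters, and the image of a concatenation is the union of the
images; so the clear segments can be treated one at a time. -/
theorem polyline_forall {D : Domain} {occ : Set Cell} (l : List Cell) (p : Cell)
    (hp : p ∈ D.cells ∧ p ∉ occ) (h : List.IsChain (ClearSegment D occ) (p :: l)) :
    ∀ q ∈ Set.range (polyline (Cell.toPt p) (l.map Cell.toPt)),
      square q ⊆ D.free ∧ ∀ w ∈ occ, Disjoint (square q) (square (Cell.toPt w)) := by
  induction l generalizing p with
  | nil =>
    rintro q ⟨t, rfl⟩
    refine ⟨hp.1, fun w hw => disjoint_square_of_not_touch fun ht => hp.2 ?_⟩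
    have e : Touch (Cell.toPt p) w := ht
    rwa [touch_toPt.1 e]
  | cons r l ih =>
    rw [List.isChain_cons_cons] at h
    intro q hq
    have hmem : q ∈ Set.range ((Path.segment (Cell.toPt p) (Cell.toPt r)).trans
      (polyline (Cell.toPt r) (l.map Cell.toPt))) := hq
    rw [Path.trans_range, Path.range_segment] at hmem
    rcases hmem with hmem | hmem
    · exact h.1.free hmem
    · exact ih r (h.1.2 r (min_le_right _ _) (le_max_right _ _) (min_le_right _ _)
        (le_max_right _ _)) h.2 q hmem

/-- The cells occupied by the squares other than `i`. -/
def others {n : ℕ} (c : Fin n → Cell) (i : Fin n) : Set Cell := {w | ∃ j, j ≠ i ∧ c j = w}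

/-- A valid grid move, on the level of cells. -/
def GridMove.IsClear (D : Domain) {n : ℕ} (c : Fin n → Cell) (m : GridMove n) : Prop :=
  c m.robot ∈ D.cells ∧ c m.robot ∉ others c m.robot ∧
    List.IsChain (ClearSegment D (others c m.robot)) (c m.robot :: m.waypoints)

/-- The default value of `getLastD` covers a move without waypoints, which leaves the square in
place. -/
def cellApply {n : ℕ} (c : Fin n → Cell) (m : GridMove n) : Fin n → Cell :=
  Function.update c m.robot (m.waypoints.getLastD (c m.robot))

def ClearSchedule (D : Domain) {n : ℕ} : (Fin n → Cell) → List (GridMove n) → Prop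
  | _, [] => True
  | c, m :: ms => m.IsClear D c ∧ ClearSchedule D (cellApply c m) ms

def cellFinal {n : ℕ} (c : Fin n → Cell) (ms : List (GridMove n)) : Fin n → Cell :=
  ms.foldl cellApply c

theorem clearSchedule_append {D : Domain} {n : ℕ} (A B : List (GridMove n)) (c : Fin n → Cell) :
    ClearSchedule D c (A ++ B) ↔ ClearSchedule D c A ∧ ClearSchedule D (cellFinal c A) B := by
  induction A generalizing c with
  | nil => simp [ClearSchedule, cellFinal]
  | cons m A ih => simp [ClearSchedule, ih, cellFinal, and_assoc]

theorem cellFinal_append {n : ℕ} (A B : List (GridMove n)) (c : Fin n → Cell) :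
    cellFinal c (A ++ B) = cellFinal (cellFinal c A) B := by
  simp [cellFinal]

theorem GridMove.IsClear.isValid {D : Domain} {n : ℕ} {c : Fin n → Cell} {m : GridMove n}
    (h : m.IsClear D c) : (m.toMove fun i => Cell.toPt (c i)).IsValid D fun i => Cell.toPt (c i) := by
  refine ⟨Path.source _, fun t => ?_⟩
  have := polyline_forall m.waypoints (c m.robot) ⟨h.1, h.2.1⟩ h.2.2 _ ⟨t, rfl⟩
  exact ⟨this.1, fun j hj => this.2 (c j) ⟨j, hj, rfl⟩⟩

theorem applyMove_toMove {n : ℕ} (c : Fin n → Cell) (m : GridMove n) :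
    applyMove (fun i => Cell.toPt (c i)) (m.toMove fun i => Cell.toPt (c i)) =
      fun i => Cell.toPt (cellApply c m i) := by
  funext i
  have e : (m.toMove fun i => Cell.toPt (c i)).curve 1 =
      Cell.toPt (m.waypoints.getLastD (c m.robot)) := by
    rw [← polyEnd_map]; exact Path.target _
  by_cases hi : i = m.robot
  · subst hi
    unfold applyMove
    rw [e]
    simp [GridMove.toMove, cellApply]
  · simp [applyMove, GridMove.toMove, cellApply, hi]

theorem ClearSchedule.realize {D : Domain} {n : ℕ} {ms : List (GridMove n)} {c : Fin n → Cell}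
    (h : ClearSchedule D c ms) :
    ValidSchedule D (fun i => Cell.toPt (c i)) (realize (fun i => Cell.toPt (c i)) ms) ∧
    finalConfig (fun i => Cell.toPt (c i)) (SquareReconfig.realize (fun i => Cell.toPt (c i)) ms) =
      fun i => Cell.toPt (cellFinal c ms i) := by
  induction ms generalizing c with
  | nil => exact ⟨trivial, rfl⟩
  | cons m ms ih =>
    obtain ⟨h1, h2⟩ := h
    have := ih h2
    simp only [SquareReconfig.realize, ValidSchedule, finalConfig, List.foldl_cons,
      applyMove_toMove, cellFinal] at this ⊢
    exact ⟨⟨h1.isValid, this.1⟩, this.2⟩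

theorem map_robot_realize {n : ℕ} (ms : List (GridMove n)) (c : Fin n → Pt) :
    (realize c ms).map Move.robot = ms.map GridMove.robot := by
  induction ms generalizing c with
  | nil => rfl
  | cons m ms ih => simp [realize, ih, GridMove.toMove]

theorem atMostMoves_one {n : ℕ} {ms : List (GridMove n)} (c : Fin n → Pt)
    (h : (ms.map GridMove.robot).Nodup) : AtMostMoves 1 (realize c ms) := by
  intro i
  rw [← map_robot_realize ms c, List.nodup_iff_count_le_one] at h
  have := h i
  rw [List.count, List.countP_map] at this
  refine le_trans (le_of_eq ?_) this
  congr 1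

/-- The interface between cells and the plane: both the elimination algorithm and the flow procedure
only establish these three combinatorial conditions. -/
theorem Instance.isMonotoneSolution_of_clear {I : Instance} {ms : List (GridMove I.n)}
    (h : ClearSchedule I.domain I.start ms)
    (hr : Set.range (cellFinal I.start ms) = Set.range I.target)
    (hn : (ms.map GridMove.robot).Nodup) : I.IsMonotoneSolution ms := by
  refine ⟨⟨h.realize.1, ?_⟩, atMostMoves_one _ hn⟩
  have e : finalConfig I.startPt (realize I.startPt ms) = Cell.toPt ∘ cellFinal I.start ms :=
    h.realize.2
  rw [e, Set.range_comp, hr, ← Set.range_comp]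
  rfl

end SquareReconfig

namespace SquareReconfig

/-! ### Loop programs: a sublanguage with a total semantics and an automatic time bound -/

/-- Programs whose only loops are `for` loops: `loop c b P` runs `P` for the values
`0, 1, …, reg b - 1` of the counter `reg c`. -/
inductive Code where
  | skip
  | assign (x : ℕ) (e : Expr)
  | store (a : ℕ) (i e : Expr)
  | seq (P Q : Code)
  | ite (b : Test) (P Q : Code)
  | loop (c b : ℕ) (P : Code)

infixr:60 ";;" => Code.seq

/-- The state after `k` rounds of a loop with counter `c` and body `f`. -/
def loopState (f : State → State) (c : ℕ) (s : State) : ℕ → State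
  | 0 => s.setReg c 0
  | k + 1 => (f (loopState f c s k)).setReg c (k + 1)

namespace Code

def run : Code → State → State
  | skip, s => s
  | assign x e, s => s.setReg x (e.eval s)
  | store a i e, s => s.setArr a (i.eval s) (e.eval s)
  | seq P Q, s => Q.run (P.run s)
  | ite b P Q, s => if b.eval s then P.run s else Q.run s
  | loop c b P, s => loopState P.run c s (s.reg b).toNat

def toProgram : Code → Program
  | skip => .skip
  | assign x e => .assign x e
  | store a i e => .store a i e
  | seq P Q => .seq P.toProgram Q.toProgram
  | ite b P Q => .ite b P.toProgram Q.toProgram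
  | loop c b P => .seq (.assign c (.const 0)) (.while (.not (.le (.reg b) (.reg c)))
      (.seq P.toProgram (.assign c (.add (.reg c) (.const 1)))))

/-- The registers that a program writes. -/
def regs : Code → List ℕ
  | skip => []
  | assign x _ => [x]
  | store _ _ _ => []
  | seq P Q => P.regs ++ Q.regs
  | ite _ P Q => P.regs ++ Q.regs
  | loop c _ P => c :: P.regs

/-- The arrays that a program writes. -/
def arrs : Code → List ℕ
  | skip => []
  | assign _ _ => []
  | store a _ _ => [a]
  | seq P Q => P.arrs ++ Q.arrs
  | ite _ P Q => P.arrs ++ Q.arrs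
  | loop _ _ P => P.arrs

/-- All loop bounds are registers in `B`, which are not written, and counters are not written by
loop bodies. -/
def Ok (B : List ℕ) : Code → Bool
  | skip => true
  | assign x _ => x ∉ B
  | store _ _ _ => true
  | seq P Q => P.Ok B && Q.Ok B
  | ite _ P Q => P.Ok B && Q.Ok B
  | loop c b P => b ∈ B && c ∉ B && c ∉ P.regs && P.Ok B

/-- A bound on the running time in terms of a bound on the registers that bound the loops. -/
noncomputable def cost : Code → Polynomial ℕ
  | skip => 1
  | assign _ _ => 1
  | store _ _ _ => 1
  | seq P Q => P.cost + Q.cost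
  | ite _ P Q => P.cost + Q.cost + 1
  | loop _ _ P => Polynomial.X * (P.cost + 2) + 2

end Code

namespace State

@[simp] theorem reg_setReg (s : State) (x y : ℕ) (v : ℤ) :
    (s.setReg x v).reg y = if y = x then v else s.reg y := by
  simp [State.setReg, Function.update_apply]

@[simp] theorem arr_setReg (s : State) (x : ℕ) (v : ℤ) : (s.setReg x v).arr = s.arr := rfl

@[simp] theorem reg_setArr (s : State) (a : ℕ) (i v : ℤ) : (s.setArr a i v).reg = s.reg := rfl

theorem arr_setArr (s : State) (a b : ℕ) (i v : ℤ) :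
    (s.setArr a i v).arr b = if b = a then Function.update (s.arr a) i v else s.arr b := by
  simp [State.setArr, Function.update_apply]

@[simp] theorem arr_setArr_self (s : State) (a : ℕ) (i v : ℤ) :
    (s.setArr a i v).arr a = Function.update (s.arr a) i v := by
  simp [arr_setArr]

theorem arr_setArr_of_ne (s : State) {a b : ℕ} (i v : ℤ) (h : b ≠ a) :
    (s.setArr a i v).arr b = s.arr b := by
  simp [arr_setArr, h]

end State

namespace Code

@[simp] theorem run_skip (s : State) : skip.run s = s := rfl
@[simp] theorem run_assign (x : ℕ) (e : Expr) (s : State) :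
    (assign x e).run s = s.setReg x (e.eval s) := rfl
@[simp] theorem run_store (a : ℕ) (i e : Expr) (s : State) :
    (store a i e).run s = s.setArr a (i.eval s) (e.eval s) := rfl
@[simp] theorem run_seq (P Q : Code) (s : State) : (P ;; Q).run s = Q.run (P.run s) := rfl
theorem run_ite (b : Test) (P Q : Code) (s : State) :
    (ite b P Q).run s = if b.eval s then P.run s else Q.run s := rfl
theorem run_loop (c b : ℕ) (P : Code) (s : State) :
    (loop c b P).run s = loopState P.run c s (s.reg b).toNat := rfl

theorem run_reg {P : Code} {x : ℕ} (s : State) (h : x ∉ P.regs) :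
    (P.run s).reg x = s.reg x := by
  induction P generalizing s with
  | skip => rfl
  | assign y e => simp [regs] at h; simp [h]
  | store a i e => rfl
  | seq P Q ihP ihQ => simp [regs] at h; simp [ihP _ h.1, ihQ _ h.2]
  | ite b P Q ihP ihQ =>
    simp [regs] at h
    rw [run_ite]; split
    · exact ihP _ h.1
    · exact ihQ _ h.2
  | loop c b P ih =>
    simp [regs] at h
    rw [run_loop]
    generalize (s.reg b).toNat = k
    induction k with
    | zero => simp [loopState, h.1]
    | succ k ihk => simp [loopState, h.1, ih _ h.2, ihk]

theorem run_arr {P : Code} {a : ℕ} (s : State) (h : a ∉ P.arrs) :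
    (P.run s).arr a = s.arr a := by
  induction P generalizing s with
  | skip => rfl
  | assign y e => rfl
  | store b i e => simp [arrs] at h; simp [State.arr_setArr, h]
  | seq P Q ihP ihQ => simp [arrs] at h; simp [ihP _ h.1, ihQ _ h.2]
  | ite b P Q ihP ihQ =>
    simp [arrs] at h
    rw [run_ite]; split
    · exact ihP _ h.1
    · exact ihQ _ h.2
  | loop c b P ih =>
    simp [arrs] at h
    rw [run_loop]
    generalize (s.reg b).toNat = k
    induction k with
    | zero => simp [loopState]
    | succ k ihk => simp [loopState, ih _ h, ihk]

/-- The states agree outside the registers and arrays written by `P`. -/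
def Frame (P : Code) (s t : State) : Prop :=
  (∀ x, x ∉ P.regs → t.reg x = s.reg x) ∧ ∀ a, a ∉ P.arrs → t.arr a = s.arr a

theorem frame_run (P : Code) (s : State) : P.Frame s (P.run s) :=
  ⟨fun _ h => run_reg s h, fun _ h => run_arr s h⟩

/-- The invariant rule for loops. The frame relation to the state before the loop is supplied in
every round, so an invariant only has to describe the memory that the body changes. -/
theorem loop_inv {c b : ℕ} {P : Code} {s : State} {K : ℕ} (hK : s.reg b = K)
    (Inv : ℕ → State → Prop) (h0 : Inv 0 (s.setReg c 0))
    (hs : ∀ k < K, ∀ t : State, t.reg c = k → (loop c b P).Frame s t → Inv k t →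
      Inv (k + 1) ((P.run t).setReg c (k + 1))) :
    Inv K ((loop c b P).run s) := by
  rw [run_loop, hK, Int.toNat_natCast]
  have key : ∀ k ≤ K, (loopState P.run c s k).reg c = k ∧
      (loop c b P).Frame s (loopState P.run c s k) ∧ Inv k (loopState P.run c s k) := by
    intro k
    induction k with
    | zero =>
      intro _
      refine ⟨by simp [loopState], ⟨fun x hx => ?_, fun a ha => rfl⟩, h0⟩
      simp [regs] at hx
      simp [loopState, hx.1]
    | succ k ih =>
      intro hk
      obtain ⟨i1, i2, i3⟩ := ih (by omega)
      refine ⟨by simp [loopState], ⟨fun x hx => ?_, fun a ha => ?_⟩, hs k hk _ i1 i2 i3⟩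
      · have hx' := hx
        simp [regs] at hx'
        simp [loopState, hx'.1, run_reg _ hx'.2, i2.1 x hx]
      · exact (run_arr (P := P) _ ha).trans (i2.2 a ha)
  exact (key K le_rfl).2.2

/-- By `Ok`, registers bounding loops are never written, so `M` bounds them at every later moment
and hence the number of rounds of each loop. Bodies do not write their counter, so the increments of
the `while` loop agree with the values prescribed by `loopState`. -/
theorem exec {B : List ℕ} {P : Code} {s : State} {M : ℕ} (hP : P.Ok B)
    (hM : ∀ b ∈ B, s.reg b ≤ M) :
    ∃ t, Exec P.toProgram s t (P.run s) ∧ t ≤ P.cost.eval M := by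
  induction P generalizing s with
  | skip => exact ⟨1, Exec.skip s, by simp [cost]⟩
  | assign x e => exact ⟨1, Exec.assign x e s, by simp [cost]⟩
  | store a i e => exact ⟨1, Exec.store a i e s, by simp [cost]⟩
  | seq P Q ihP ihQ =>
    simp only [Ok, Bool.and_eq_true] at hP
    obtain ⟨t, h1, h2⟩ := ihP hP.1 hM
    have hM' : ∀ b ∈ B, (P.run s).reg b ≤ M := fun b hb => by
      rw [run_reg]
      · exact hM b hb
      · exact fun h => not_mem_regs_of_ok hP.1 hb h
    obtain ⟨t', h3, h4⟩ := ihQ hP.2 hM'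
    refine ⟨_, Exec.seq h1 h3, ?_⟩
    simp only [cost, Polynomial.eval_add]; omega
  | ite b P Q ihP ihQ =>
    simp only [Ok, Bool.and_eq_true] at hP
    rw [run_ite]
    simp only [cost, Polynomial.eval_add, Polynomial.eval_one]
    split
    · rename_i hb
      obtain ⟨t, h1, h2⟩ := ihP hP.1 hM
      exact ⟨_, Exec.ite_true hb h1, by omega⟩
    · rename_i hb
      obtain ⟨t, h1, h2⟩ := ihQ hP.2 hM
      exact ⟨_, Exec.ite_false (by simpa using hb) h1, by omega⟩
  | loop c b P ih =>
    simp only [Ok, Bool.and_eq_true, decide_eq_true_eq] at hP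
    obtain ⟨⟨⟨hb, hc⟩, hcP⟩, hPB⟩ := hP
    rw [run_loop]
    set K := (s.reg b).toNat with hK
    set S := loopState P.run c s with hS
    have hreg : ∀ k, (S k).reg c = k ∧ ∀ x ∈ B, (S k).reg x = s.reg x := by
      intro k
      induction k with
      | zero =>
        refine ⟨by simp [hS, loopState], fun x hx => ?_⟩
        have : x ≠ c := fun h => hc (h ▸ hx)
        simp [hS, loopState, this]
      | succ k ihk =>
        refine ⟨by simp [hS, loopState], fun x hx => ?_⟩
        have : x ≠ c := fun h => hc (h ▸ hx)
        simp only [hS, loopState, State.reg_setReg, this, if_false]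
        rw [run_reg _ (fun h => not_mem_regs_of_ok hPB hx h)]
        exact ihk.2 x hx
    have hKM : K ≤ M := by have := hM b hb; omega
    -- Induction on the number `d` of rounds that are left. A round costs its body plus 2, for the
    -- test and the increment; the last failing test costs 1.
    have main : ∀ d ≤ K, ∃ t, Exec (.while (.not (.le (.reg b) (.reg c)))
        (.seq P.toProgram (.assign c (.add (.reg c) (.const 1))))) (S (K - d)) t (S K) ∧
        t ≤ d * (P.cost.eval M + 2) + 1 := by
      intro d
      induction d with
      | zero =>
        intro _
        refine ⟨1, Exec.while_false ?_, by simp⟩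
        simp only [Test.eval, Expr.eval, Nat.sub_zero, (hreg K).1, (hreg K).2 b hb]
        simp; omega
      | succ d ihd =>
        intro hd
        obtain ⟨t, h1, h2⟩ := ihd (by omega)
        obtain ⟨t', h3, h4⟩ := ih (s := S (K - (d + 1))) hPB
          (fun x hx => by rw [(hreg _).2 x hx]; exact hM x hx)
        have e : S (K - d) = (P.run (S (K - (d + 1)))).setReg c
            ((Expr.add (.reg c) (.const 1)).eval (P.run (S (K - (d + 1))))) := by
          have : K - d = K - (d + 1) + 1 := by omega
          simp only [Expr.eval, run_reg _ hcP, (hreg _).1]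
          rw [this]
          simp [hS, loopState]
        rw [e] at h1
        refine ⟨_, Exec.while_true ?_ (Exec.seq h3 (Exec.assign c _ _)) h1, ?_⟩
        · simp only [Test.eval, Expr.eval, (hreg _).1, (hreg _).2 b hb]
          simp; omega
        · have : (d + 1) * (P.cost.eval M + 2) =
            d * (P.cost.eval M + 2) + (P.cost.eval M + 2) := by ring
          omega
    obtain ⟨t, h1, h2⟩ := main K le_rfl
    rw [Nat.sub_self] at h1
    refine ⟨_, Exec.seq (Exec.assign c _ s) h1, ?_⟩
    have : K * (P.cost.eval M + 2) ≤ M * (P.cost.eval M + 2) := Nat.mul_le_mul_right _ hKM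
    simp only [cost, Polynomial.eval_add, Polynomial.eval_mul, Polynomial.eval_X,
      Polynomial.eval_ofNat]
    omega
where
  not_mem_regs_of_ok {B : List ℕ} {P : Code} {b : ℕ} (hP : P.Ok B) (hb : b ∈ B) : b ∉ P.regs := by
    induction P with
    | skip => simp [regs]
    | assign x e => simp [Ok] at hP; simp [regs]; rintro rfl; exact hP hb
    | store a i e => simp [regs]
    | seq P Q ihP ihQ => simp [Ok] at hP; simp [regs, ihP hP.1, ihQ hP.2]
    | ite _ P Q ihP ihQ => simp [Ok] at hP; simp [regs, ihP hP.1, ihQ hP.2]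
    | loop c d P ih =>
      simp [Ok] at hP
      simp [regs, ih hP.2]
      rintro rfl; exact hP.1.1.2 hb

end Code

namespace Test

/-- Equality of two expressions. -/
def eq (e f : Expr) : Test := .and (.le e f) (.le f e)

def lt (e f : Expr) : Test := .not (.le f e)

def or (b c : Test) : Test := .not (.and (.not b) (.not c))

@[simp] theorem eval_le (e f : Expr) (s : State) :
    (Test.le e f).eval s = true ↔ e.eval s ≤ f.eval s := by simp [eval]
@[simp] theorem eval_not (b : Test) (s : State) :
    (Test.not b).eval s = true ↔ ¬ b.eval s = true := by simp [eval]
@[simp] theorem eval_and (b c : Test) (s : State) :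
    (Test.and b c).eval s = true ↔ b.eval s = true ∧ c.eval s = true := by simp [eval]
@[simp] theorem eval_eq (e f : Expr) (s : State) :
    (Test.eq e f).eval s = true ↔ e.eval s = f.eval s := by
  rw [Test.eq, eval_and, eval_le, eval_le]; exact le_antisymm_iff.symm
@[simp] theorem eval_lt (e f : Expr) (s : State) :
    (Test.lt e f).eval s = true ↔ e.eval s < f.eval s := by simp [Test.lt]
@[simp] theorem eval_or (b c : Test) (s : State) :
    (Test.or b c).eval s = true ↔ b.eval s = true ∨ c.eval s = true := by
  simp only [Test.or, eval_not, eval_and]; tauto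

end Test

end SquareReconfig

namespace SquareReconfig
open Relation

/-! ### The compressed grid -/

/-- `y` is the smallest element of `X` above `x`, or `x` itself if there is none. -/
def NextOf (X : Set ℤ) (x y : ℤ) : Prop :=
  (y = x ∨ (x < y ∧ y ∈ X)) ∧ ∀ a ∈ X, x < a → x < y ∧ y ≤ a

theorem NextOf.unique {X : Set ℤ} {x y z : ℤ} (hy : NextOf X x y) (hz : NextOf X x z) : y = z := by
  obtain ⟨h1, h2⟩ := hy
  obtain ⟨h3, h4⟩ := hz
  rcases h1 with h1 | h1 <;> rcases h3 with h3 | h3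
  · omega
  · have := h2 z h3.2 h3.1; omega
  · have := h4 y h1.2 h1.1; omega
  · have := h2 z h3.2 h3.1; have := h4 y h1.2 h1.1; omega

/-- Adjacency in the grid with coordinates in `X`. -/
def GridAdj (X : Set ℤ) (u v : Cell) : Prop :=
  (u.2 = v.2 ∧ (NextOf X u.1 v.1 ∨ NextOf X v.1 u.1)) ∨
  (u.1 = v.1 ∧ (NextOf X u.2 v.2 ∨ NextOf X v.2 u.2))

theorem GridAdj.symm {X : Set ℤ} {u v : Cell} (h : GridAdj X u v) : GridAdj X v u := by
  rcases h with ⟨h1, h2⟩ | ⟨h1, h2⟩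
  · exact Or.inl ⟨h1.symm, h2.symm⟩
  · exact Or.inr ⟨h1.symm, h2.symm⟩

/-- Paths in the grid with coordinates in `X` inside the set `A`. -/
def GridConn (X : Set ℤ) (A : Set Cell) : Cell → Cell → Prop :=
  ReflTransGen fun u v => u ∈ A ∧ v ∈ A ∧ GridAdj X u v

theorem GridConn.symm {X : Set ℤ} {A : Set Cell} {u v : Cell} (h : GridConn X A u v) :
    GridConn X A v u := by
  induction h with
  | refl => exact ReflTransGen.refl
  | tail _ h ih => exact ReflTransGen.head ⟨h.2.1, h.1, h.2.2.symm⟩ ih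

theorem GridConn.trans {X : Set ℤ} {A : Set Cell} {u v w : Cell} (h : GridConn X A u v)
    (h' : GridConn X A v w) : GridConn X A u w := ReflTransGen.trans h h'

theorem GridConn.mono {X : Set ℤ} {A A' : Set Cell} (hA : A ⊆ A') {u v : Cell}
    (h : GridConn X A u v) : GridConn X A' u v := by
  induction h with
  | refl => exact ReflTransGen.refl
  | tail _ h ih => exact ReflTransGen.tail ih ⟨hA h.1, hA h.2.1, h.2.2⟩

/-- The grid points with coordinates in `X` whose cell lies in the domain. -/
def gridPoints (X : Set ℤ) (D : Domain) : Set Cell := {u | u.1 ∈ X ∧ u.2 ∈ X ∧ u ∈ D.cells}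

/-- `X` contains the coordinates of all sides of the rectangles of the domain. -/
def Covers (X : Set ℤ) : Domain → Prop
  | none => True
  | some rs => ∀ r ∈ rs, r.left ∈ X ∧ r.right ∈ X ∧ r.bottom ∈ X ∧ r.top ∈ X

theorem conn_row {A : Set Cell} {x y : ℤ} (k : ℕ) (h : ∀ j ≤ k, ((x + (j : ℕ), y) : Cell) ∈ A) :
    Conn A (x, y) (x + k, y) := by
  induction k with
  | zero => simp only [Nat.cast_zero, add_zero]; exact ReflTransGen.refl
  | succ k ih =>
    refine (ih fun j hj => h j (by omega)).trans (ReflTransGen.single ⟨h k (by omega), h _ le_rfl, ?_⟩)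
    rw [mem_nbrs]; push_cast; omega

theorem conn_col {A : Set Cell} {x y : ℤ} (k : ℕ) (h : ∀ j ≤ k, ((x, y + (j : ℕ)) : Cell) ∈ A) :
    Conn A (x, y) (x, y + k) := by
  induction k with
  | zero => simp only [Nat.cast_zero, add_zero]; exact ReflTransGen.refl
  | succ k ih =>
    refine (ih fun j hj => h j (by omega)).trans (ReflTransGen.single ⟨h k (by omega), h _ le_rfl, ?_⟩)
    rw [mem_nbrs]; push_cast; omega

section Geometry

variable {X : Set ℤ} {D : Domain}

/-- The right side of the rectangle around the first cell is a coordinate in `X` above `x`, hence at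
least the next one, so the rectangle reaches up to `x'`. -/
theorem mem_cells_between_fst (hD : Covers X D) {x x' y a : ℤ} (hx : ((x, y) : Cell) ∈ D.cells)
    (hn : NextOf X x x') (h1 : x ≤ a) (h2 : a < x') : ((a, y) : Cell) ∈ D.cells := by
  cases D with
  | none => simp [cells_none]
  | some rs =>
    rw [mem_cells_some] at hx ⊢
    obtain ⟨r, hr, h3, h4, h5, h6⟩ := hx
    have := hn.2 _ (hD r hr).2.1 h4
    dsimp only at *
    exact ⟨r, hr, by omega, by omega, h5, h6⟩

theorem mem_cells_between_snd (hD : Covers X D) {x y y' a : ℤ} (hx : ((x, y) : Cell) ∈ D.cells)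
    (hn : NextOf X y y') (h1 : y ≤ a) (h2 : a < y') : ((x, a) : Cell) ∈ D.cells := by
  cases D with
  | none => simp [cells_none]
  | some rs =>
    rw [mem_cells_some] at hx ⊢
    obtain ⟨r, hr, h3, h4, h5, h6⟩ := hx
    have := hn.2 _ (hD r hr).2.2.2 h6
    dsimp only at *
    exact ⟨r, hr, h3, h4, by omega, by omega⟩

theorem NextOf.le {x y : ℤ} (h : NextOf X x y) : x ≤ y := by
  rcases h.1 with h | h <;> omega

theorem NextOf.not_mem {x y a : ℤ} (h : NextOf X x y) (h1 : x < a) (h2 : a < y) : a ∉ X :=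
  fun ha => by have := h.2 a ha h1; omega

/-- Strictly between consecutive coordinates of `X` there is no side of a rectangle and no occupied
cell, so a segment can be blocked only at its ends. -/
theorem GridAdj.clearSegment (hD : Covers X D) {occ : Set Cell}
    (hocc : ∀ a ∈ occ, a.1 ∈ X ∧ a.2 ∈ X) {u v : Cell} (h : GridAdj X u v)
    (hu : u ∈ D.cells) (hv : v ∈ D.cells) (hu' : u ∉ occ) (hv' : v ∉ occ) :
    ClearSegment D occ u v := by
  have key1 : ∀ (x x' y : ℤ), NextOf X x x' → ((x, y) : Cell) ∈ D.cells → ((x', y) : Cell) ∈ D.cells →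
      ((x, y) : Cell) ∉ occ → ((x', y) : Cell) ∉ occ → ∀ a, x ≤ a → a ≤ x' →
      ((a, y) : Cell) ∈ D.cells ∧ ((a, y) : Cell) ∉ occ := by
    intro x x' y hn m1 m2 o1 o2 a h1 h2
    rcases eq_or_ne a x with rfl | h3
    · exact ⟨m1, o1⟩
    rcases eq_or_ne a x' with rfl | h4
    · exact ⟨m2, o2⟩
    exact ⟨mem_cells_between_fst hD m1 hn h1 (by omega),
      fun ho => hn.not_mem (by omega) (by omega) (hocc _ ho).1⟩
  have key2 : ∀ (x y y' : ℤ), NextOf X y y' → ((x, y) : Cell) ∈ D.cells → ((x, y') : Cell) ∈ D.cells →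
      ((x, y) : Cell) ∉ occ → ((x, y') : Cell) ∉ occ → ∀ a, y ≤ a → a ≤ y' →
      ((x, a) : Cell) ∈ D.cells ∧ ((x, a) : Cell) ∉ occ := by
    intro x y y' hn m1 m2 o1 o2 a h1 h2
    rcases eq_or_ne a y with rfl | h3
    · exact ⟨m1, o1⟩
    rcases eq_or_ne a y' with rfl | h4
    · exact ⟨m2, o2⟩
    exact ⟨mem_cells_between_snd hD m1 hn h1 (by omega),
      fun ho => hn.not_mem (by omega) (by omega) (hocc _ ho).2⟩
  obtain ⟨u1, u2⟩ := u
  obtain ⟨v1, v2⟩ := v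
  rcases h with ⟨h1, h2⟩ | ⟨h1, h2⟩ <;> dsimp only at h1 h2 <;> subst h1
  · refine ⟨Or.inr rfl, ?_⟩
    rintro ⟨a, b⟩ k1 k2 k3 k4
    dsimp only at k1 k2 k3 k4
    obtain rfl : b = u2 := by omega
    rcases h2 with h2 | h2 <;> have := h2.le
    · exact key1 _ _ _ h2 hu hv hu' hv' a (by omega) (by omega)
    · exact key1 _ _ _ h2 hv hu hv' hu' a (by omega) (by omega)
  · refine ⟨Or.inl rfl, ?_⟩
    rintro ⟨a, b⟩ k1 k2 k3 k4
    dsimp only at k1 k2 k3 k4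
    obtain rfl : a = u1 := by omega
    rcases h2 with h2 | h2 <;> have := h2.le
    · exact key2 _ _ _ h2 hu hv hu' hv' b (by omega) (by omega)
    · exact key2 _ _ _ h2 hv hu hv' hu' b (by omega) (by omega)

theorem GridAdj.conn (hD : Covers X D) {u v : Cell} (h : GridAdj X u v)
    (hu : u ∈ D.cells) (hv : v ∈ D.cells) : Conn D.cells u v := by
  have hc := (h.clearSegment hD (occ := ∅) (by simp) hu hv (by simp) (by simp)).2
  obtain ⟨u1, u2⟩ := u
  obtain ⟨v1, v2⟩ := v
  have key1 : ∀ (x x' y : ℤ), x ≤ x' → (∀ a, x ≤ a → a ≤ x' → ((a, y) : Cell) ∈ D.cells) →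
      Conn D.cells (x, y) (x', y) := by
    intro x x' y hxx h
    obtain ⟨k, rfl⟩ := Int.le.dest hxx
    exact conn_row k fun j hj => h _ (by omega) (by omega)
  have key2 : ∀ (x y y' : ℤ), y ≤ y' → (∀ a, y ≤ a → a ≤ y' → ((x, a) : Cell) ∈ D.cells) →
      Conn D.cells (x, y) (x, y') := by
    intro x y y' hyy h
    obtain ⟨k, rfl⟩ := Int.le.dest hyy
    exact conn_col k fun j hj => h _ (by omega) (by omega)
  rcases h with ⟨h1, h2⟩ | ⟨h1, h2⟩ <;> dsimp only at h1 h2 <;> subst h1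
  · rcases le_total u1 v1 with hl | hl
    · exact key1 _ _ _ hl fun a h1 h2 => (hc (a, u2) (by dsimp; omega) (by dsimp; omega)
        (by dsimp; omega) (by dsimp; omega)).1
    · exact (key1 _ _ _ hl fun a h1 h2 => (hc (a, u2) (by dsimp; omega) (by dsimp; omega)
        (by dsimp; omega) (by dsimp; omega)).1).symm
  · rcases le_total u2 v2 with hl | hl
    · exact key2 _ _ _ hl fun a h1 h2 => (hc (u1, a) (by dsimp; omega) (by dsimp; omega)
        (by dsimp; omega) (by dsimp; omega)).1
    · exact (key2 _ _ _ hl fun a h1 h2 => (hc (u1, a) (by dsimp; omega) (by dsimp; omega)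
        (by dsimp; omega) (by dsimp; omega)).1).symm

theorem GridConn.conn (hD : Covers X D) {u v : Cell} (h : GridConn X (gridPoints X D) u v) :
    Conn D.cells u v := by
  induction h with
  | refl => exact ReflTransGen.refl
  | tail _ h ih => exact ih.trans (h.2.2.conn hD h.1.2.2 h.2.1.2.2)

/-- `a` is the largest element of `X` up to `x`, or the smallest element if there is none. -/
def FloorOf (X : Set ℤ) (x a : ℤ) : Prop :=
  a ∈ X ∧ (∀ b ∈ X, b ≤ x → b ≤ a) ∧ (a ≤ x ∨ ∀ b ∈ X, a ≤ b)

theorem exists_floorOf (hf : X.Finite) (hne : X.Nonempty) (x : ℤ) : ∃ a, FloorOf X x a := by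
  by_cases h : ∃ b ∈ X, b ≤ x
  · obtain ⟨a, ⟨ha1, ha2⟩, ha3⟩ := Set.exists_max_image {b ∈ X | b ≤ x} id
      (hf.subset fun b hb => hb.1) h
    exact ⟨a, ha1, fun b hb hbx => ha3 b ⟨hb, hbx⟩, Or.inl ha2⟩
  · push Not at h
    obtain ⟨a, ha1, ha2⟩ := Set.exists_min_image X id hf hne
    exact ⟨a, ha1, fun b hb hbx => absurd hbx (not_le.2 (h b hb)), Or.inr ha2⟩

theorem FloorOf.eq_self {x a : ℤ} (h : FloorOf X x a) (hx : x ∈ X) : a = x := by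
  have h1 := h.2.1 x hx le_rfl
  rcases h.2.2 with h2 | h2
  · omega
  · have := h2 x hx; omega

/-- Rounding moves unit steps to equal or consecutive coordinates; this makes it a map of graphs
from all cells to the compressed grid, up to contracted edges. -/
theorem FloorOf.succ {x a b : ℤ} (h : FloorOf X x a) (h' : FloorOf X (x + 1) b) :
    b = a ∨ NextOf X a b := by
  obtain ⟨a1, a2, a3⟩ := h
  obtain ⟨b1, b2, b3⟩ := h'
  have k1 := a2 b b1
  have k2 := b2 a a1
  replace a3 : a ≤ x ∨ (x < a ∧ ∀ b ∈ X, a ≤ b) := by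
    rcases le_or_gt a x with h | h
    · exact Or.inl h
    · exact Or.inr ⟨h, a3.resolve_left (by omega)⟩
  rcases a3 with a3 | ⟨a4, a3⟩ <;> rcases b3 with b3 | b3
  · by_cases hab : b = a
    · exact Or.inl hab
    · refine Or.inr ⟨Or.inr ⟨by omega, b1⟩, fun c hc hac => ?_⟩
      have := a2 c hc
      exact ⟨by omega, by omega⟩
  · have := b3 a a1; exact Or.inl (by omega)
  · have := a3 b b1; exact Or.inl (by omega)
  · have := b3 a a1; have := a3 b b1; exact Or.inl (by omega)

/-- Left and bottom sides belong to `X`, so rounding down does not leave a rectangle. Rounding up to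
the minimum occurs only where no coordinate lies below, which concerns the unbounded scenario. -/
theorem mem_gridPoints_of_floorOf (hD : Covers X D) {z : Cell} (hz : z ∈ D.cells) {a b : ℤ}
    (ha : FloorOf X z.1 a) (hb : FloorOf X z.2 b) : ((a, b) : Cell) ∈ gridPoints X D := by
  refine ⟨ha.1, hb.1, ?_⟩
  cases D with
  | none => simp [cells_none]
  | some rs =>
    rw [mem_cells_some] at hz ⊢
    obtain ⟨r, hr, h1, h2, h3, h4⟩ := hz
    obtain ⟨c1, c2, c3, c4⟩ := hD r hr
    have k1 := ha.2.1 _ c1 h1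
    have k2 := hb.2.1 _ c3 h3
    refine ⟨r, hr, k1, ?_, k2, ?_⟩
    · rcases ha.2.2 with h | h
      · exact lt_of_le_of_lt h h2
      · exact lt_of_le_of_lt (h _ c1) (by omega)
    · rcases hb.2.2 with h | h
      · exact lt_of_le_of_lt h h4
      · exact lt_of_le_of_lt (h _ c3) (by omega)

/-- Rounding both coordinates is a retraction: it fixes the grid points and carries a path of cells
to a path in the compressed grid. The other direction fills in the cells between consecutive
coordinates. -/
theorem gridConn_iff (hf : X.Finite) (hD : Covers X D) {u v : Cell} (hu : u ∈ gridPoints X D)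
    (hv : v ∈ gridPoints X D) : GridConn X (gridPoints X D) u v ↔ Conn D.cells u v := by
  refine ⟨fun h => h.conn hD, fun h => ?_⟩
  choose f hfl using fun x => exists_floorOf (X := X) hf ⟨u.1, hu.1⟩ x
  have eu : ∀ w ∈ gridPoints X D, ((f w.1, f w.2) : Cell) = w := fun w hw =>
    Prod.ext ((hfl w.1).eq_self hw.1) ((hfl w.2).eq_self hw.2.1)
  suffices hs : GridConn X (gridPoints X D) (f u.1, f u.2) (f v.1, f v.2) by
    rwa [eu u hu, eu v hv] at hs
  clear hv
  induction h with
  | refl => exact ReflTransGen.refl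
  | @tail b c _ h ih =>
    refine ih.trans ?_
    obtain ⟨h1, h2, h3⟩ := h
    have m1 := mem_gridPoints_of_floorOf hD h1 (hfl b.1) (hfl b.2)
    have m2 := mem_gridPoints_of_floorOf hD h2 (hfl c.1) (hfl c.2)
    have step : ∀ x, f (x + 1) = f x ∨ NextOf X (f x) (f (x + 1)) := fun x => (hfl x).succ (hfl _)
    rw [mem_nbrs] at h3
    rcases h3 with ⟨e1, e2⟩ | ⟨e1, e2⟩ | ⟨e1, e2⟩ | ⟨e1, e2⟩
    · rw [e1, e2] at m2 ⊢
      rcases step b.1 with e | e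
      · rw [e]; exact ReflTransGen.refl
      · exact ReflTransGen.single ⟨m1, m2, Or.inl ⟨rfl, Or.inl e⟩⟩
    · obtain e1 : b.1 = c.1 + 1 := by omega
      rw [e1] at m1 ⊢; rw [e2] at m2 ⊢
      rcases step c.1 with e | e
      · rw [e]; exact ReflTransGen.refl
      · exact ReflTransGen.single ⟨m1, m2, Or.inl ⟨rfl, Or.inr e⟩⟩
    · rw [e1, e2] at m2 ⊢
      rcases step b.2 with e | e
      · rw [e]; exact ReflTransGen.refl
      · exact ReflTransGen.single ⟨m1, m2, Or.inr ⟨rfl, Or.inl e⟩⟩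
    · obtain e2 : b.2 = c.2 + 1 := by omega
      rw [e2] at m1 ⊢; rw [e1] at m2 ⊢
      rcases step c.2 with e | e
      · rw [e]; exact ReflTransGen.refl
      · exact ReflTransGen.single ⟨m1, m2, Or.inr ⟨rfl, Or.inr e⟩⟩

theorem chain_clearSegment (hD : Covers X D) {occ : Set Cell}
    (hocc : ∀ a ∈ occ, a.1 ∈ X ∧ a.2 ∈ X) {u : Cell} {w : List Cell}
    (hc : List.IsChain (GridAdj X) (u :: w)) (h : ∀ a ∈ u :: w, a ∈ D.cells ∧ a ∉ occ) :
    List.IsChain (ClearSegment D occ) (u :: w) := by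
  induction w generalizing u with
  | nil => simp
  | cons v w ih =>
    rw [List.isChain_cons_cons] at hc ⊢
    have h1 := h u (by simp)
    have h2 := h v (by simp)
    exact ⟨hc.1.clearSegment hD hocc h1.1 h2.1 h1.2 h2.2,
      ih hc.2 fun a ha => h a (List.mem_cons_of_mem _ ha)⟩

end Geometry

theorem gridConn_of_chain {X : Set ℤ} {A : Set Cell} {u : Cell} {w : List Cell} (hu : u ∈ A)
    (hc : List.IsChain (GridAdj X) (u :: w)) (h : ∀ a ∈ w, a ∈ A) :
    GridConn X A u (w.getLastD u) := by
  induction w generalizing u with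
  | nil => exact ReflTransGen.refl
  | cons v w ih =>
    rw [List.isChain_cons_cons] at hc
    rw [List.getLastD_cons]
    have hv := h v (by simp)
    exact (ReflTransGen.single ⟨hu, hv, hc.1⟩ : GridConn X A u v).trans
      (ih hv hc.2 fun a ha => h a (List.mem_cons_of_mem _ ha))

/-! ### Eliminating non-cut vertices -/

/-- Removing `v` does not disconnect any two vertices of `A`. -/
def NonCut (X : Set ℤ) (A : Set Cell) (v : Cell) : Prop :=
  ∀ a b, a ∈ A → b ∈ A → a ≠ v → b ≠ v → GridConn X A a b → GridConn X (A \ {v}) a b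

/-- A connection that meets `v` lies in the component of `r`, where both ends can be joined to `r`
without `v`; a connection that does not meet `v` survives anyway. -/
theorem nonCut_of_root {X : Set ℤ} {A : Set Cell} {r v : Cell}
    (h : ∀ q ∈ A, q ≠ v → GridConn X A r q → GridConn X (A \ {v}) r q)
    (hv : GridConn X A r v) : NonCut X A v := by
  intro a b ha hb hav hbv hab
  have key : ∀ c, GridConn X A a c → GridConn X (A \ {v}) a c ∨ GridConn X A a v := by
    intro c hc
    induction hc with
    | refl => exact Or.inl ReflTransGen.refl
    | @tail c d h1 h2 ih =>
      rcases ih with ih | ih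
      · by_cases hdv : d = v
        · subst hdv; exact Or.inr (ReflTransGen.tail h1 h2)
        · by_cases hcv : c = v
          · subst hcv; exact Or.inr h1
          · exact Or.inl (ReflTransGen.tail ih ⟨⟨h2.1, hcv⟩, ⟨h2.2.1, hdv⟩, h2.2.2⟩)
      · exact Or.inr ih
  rcases key b hab with h1 | h1
  · exact h1
  · have ra : GridConn X A r a := hv.trans h1.symm
    exact (h a ha hav ra).symm.trans (h b hb hbv (ra.trans hab))

open Classical in
/-- The state of the elimination: `A` are the remaining grid points, `S` and `T` the remaining starts
and targets. The moves in `M₁` are made first, the moves in `M₂` last; the squares outside `S` are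
where `M₁` puts them, and `M₂` completes the task once the squares in `S` occupy the targets in `T`. -/
structure Elimination (I : Instance) (X : Set ℤ) (A : Set Cell) (S T : Finset (Fin I.n))
    (M₁ M₂ : List (GridMove I.n)) : Prop where
  subset : A ⊆ gridPoints X I.domain
  conn : ∀ u ∈ A, ∀ v ∈ A, GridConn X (gridPoints X I.domain) u v → GridConn X A u v
  start_mem : ∀ i ∈ S, I.start i ∈ A
  target_mem : ∀ j ∈ T, I.target j ∈ A
  balance : ∀ z, (S.filter fun i => GridConn X (gridPoints X I.domain) z (I.start i)).card +
      (Finset.univ.filter fun j => GridConn X (gridPoints X I.domain) z (I.target j)).card =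
    (T.filter fun j => GridConn X (gridPoints X I.domain) z (I.target j)).card +
      (Finset.univ.filter fun i => GridConn X (gridPoints X I.domain) z (I.start i)).card
  clear : ClearSchedule I.domain I.start M₁
  injective : Function.Injective (cellFinal I.start M₁)
  mem : ∀ i, cellFinal I.start M₁ i ∈ gridPoints X I.domain
  unmoved : ∀ i ∈ S, cellFinal I.start M₁ i = I.start i
  removed : ∀ i, i ∉ S → cellFinal I.start M₁ i ∉ A
  completes : ∀ c : Fin I.n → Cell, Function.Injective c →
    (∀ i, i ∉ S → c i = cellFinal I.start M₁ i) →
    (∀ a, (∃ i ∈ S, c i = a) ↔ ∃ j ∈ T, I.target j = a) →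
    ClearSchedule I.domain c M₂ ∧ Set.range (cellFinal c M₂) = Set.range I.target
  nodup : ((M₁ ++ M₂).map GridMove.robot).Nodup
  robot : ∀ m ∈ M₁ ++ M₂, m.robot ∉ S

theorem Elimination.init (I : Instance) (X : Set ℤ)
    (hs : ∀ i, I.start i ∈ gridPoints X I.domain) (ht : ∀ i, I.target i ∈ gridPoints X I.domain) :
    Elimination I X (gridPoints X I.domain) Finset.univ Finset.univ [] [] where
  subset := subset_rfl
  conn := fun _ _ _ _ h => h
  start_mem := fun i _ => hs i
  target_mem := fun i _ => ht i
  balance := fun z => by omega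
  clear := trivial
  injective := I.start_injective
  mem := hs
  unmoved := fun _ _ => rfl
  removed := fun i hi => absurd (Finset.mem_univ i) hi
  completes := fun c _ _ h => ⟨trivial, by
    ext a; simpa [cellFinal] using h a⟩
  nodup := by simp
  robot := by simp

theorem card_filter_erase {α : Type*} [DecidableEq α] (p : α → Prop) [DecidablePred p]
    {S : Finset α} {i : α} (hi : i ∈ S) :
    ((S.erase i).filter p).card + (if p i then 1 else 0) = (S.filter p).card := by
  rw [Finset.filter_erase]
  split
  · exact Finset.card_erase_add_one (Finset.mem_filter.2 ⟨hi, ‹_›⟩)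
  · rw [Finset.erase_eq_of_notMem]
    · simp
    · simp [*]

namespace Elimination

variable {I : Instance} {X : Set ℤ} {A : Set Cell} {S T : Finset (Fin I.n)}
  {M₁ M₂ : List (GridMove I.n)}

theorem conn_diff (h : Elimination I X A S T M₁ M₂) {v : Cell} (hv : NonCut X A v) :
    ∀ a ∈ A \ {v}, ∀ b ∈ A \ {v}, GridConn X (gridPoints X I.domain) a b →
      GridConn X (A \ {v}) a b :=
  fun a ha b hb hab => hv a b ha.1 hb.1 ha.2 hb.2 (h.conn a ha.1 b hb.1 hab)

-- Matched starts and targets leave together and lie in one component, so in each component the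
-- difference of remaining starts and targets stays what it was. The sums express this without
-- subtraction and without assuming that the instance is balanced.
open Classical in
theorem balance_erase (h : Elimination I X A S T M₁ M₂) {i j : Fin I.n} (hi : i ∈ S) (hj : j ∈ T)
    (hij : GridConn X A (I.start i) (I.target j)) (z : Cell) :
    ((S.erase i).filter fun i => GridConn X (gridPoints X I.domain) z (I.start i)).card +
      (Finset.univ.filter fun j => GridConn X (gridPoints X I.domain) z (I.target j)).card =
    ((T.erase j).filter fun j => GridConn X (gridPoints X I.domain) z (I.target j)).card +
      (Finset.univ.filter fun i => GridConn X (gridPoints X I.domain) z (I.start i)).card := by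
  have h1 := card_filter_erase (fun i => GridConn X (gridPoints X I.domain) z (I.start i)) hi
  have h2 := card_filter_erase (fun j => GridConn X (gridPoints X I.domain) z (I.target j)) hj
  have h3 := h.balance z
  have hij' := hij.mono h.subset
  have e : GridConn X (gridPoints X I.domain) z (I.start i) ↔
      GridConn X (gridPoints X I.domain) z (I.target j) :=
    ⟨fun k => k.trans hij', fun k => k.trans hij'.symm⟩
  simp only [e] at h1
  omega

theorem skip (h : Elimination I X A S T M₁ M₂) {v : Cell} (hv : NonCut X A v)
    (hS : ∀ i ∈ S, I.start i ≠ v) (hT : ∀ j ∈ T, I.target j ≠ v) :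
    Elimination I X (A \ {v}) S T M₁ M₂ :=
  { h with
    subset := Set.sdiff_subset.trans h.subset
    conn := h.conn_diff hv
    start_mem := fun i hi => ⟨h.start_mem i hi, hS i hi⟩
    target_mem := fun j hj => ⟨h.target_mem j hj, hT j hj⟩
    removed := fun i hi ha => h.removed i hi ha.1 }

/-- The square never moves; from now on it stands outside the remaining vertices and cannot be in
the way of later paths. -/
theorem stay (h : Elimination I X A S T M₁ M₂) {i j : Fin I.n} (hi : i ∈ S) (hj : j ∈ T)
    (hij : I.start i = I.target j) (hv : NonCut X A (I.start i)) :
    Elimination I X (A \ {I.start i}) (S.erase i) (T.erase j) M₁ M₂ :=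
  { h with
    subset := Set.sdiff_subset.trans h.subset
    conn := h.conn_diff hv
    start_mem := fun i' hi' => ⟨h.start_mem i' (Finset.mem_of_mem_erase hi'), fun e =>
      (Finset.ne_of_mem_erase hi') (I.start_injective e)⟩
    target_mem := fun j' hj' => ⟨h.target_mem j' (Finset.mem_of_mem_erase hj'), fun e =>
      (Finset.ne_of_mem_erase hj') (I.target_injective ((show _ = _ from e).trans hij))⟩
    balance := h.balance_erase hi hj (by rw [hij]; exact ReflTransGen.refl)
    unmoved := fun i' hi' => h.unmoved i' (Finset.mem_of_mem_erase hi')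
    removed := fun i' hi' ha => by
      by_cases e : i' = i
      · subst e; exact ha.2 (h.unmoved _ hi)
      · exact h.removed i' (fun k => hi' (Finset.mem_erase.2 ⟨e, k⟩)) ha.1
    completes := fun c hc h1 h2 => by
      refine h.completes c hc (fun i' hi' => h1 i' fun k => hi' (Finset.mem_of_mem_erase k))
        fun a => ?_
      have hci : c i = I.target j := by
        rw [h1 i (by simp), h.unmoved i hi, hij]
      constructor
      · rintro ⟨i', hi', rfl⟩
        by_cases e : i' = i
        · subst e; exact ⟨j, hj, hci.symm⟩
        · obtain ⟨j', hj', e'⟩ := (h2 _).1 ⟨i', Finset.mem_erase.2 ⟨e, hi'⟩, rfl⟩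
          exact ⟨j', Finset.mem_of_mem_erase hj', e'⟩
      · rintro ⟨j', hj', rfl⟩
        by_cases e : j' = j
        · subst e; exact ⟨i, hi, hci⟩
        · obtain ⟨i', hi', e'⟩ := (h2 _).2 ⟨j', Finset.mem_erase.2 ⟨e, hj'⟩, rfl⟩
          exact ⟨i', Finset.mem_of_mem_erase hi', e'⟩
    robot := fun m hm hr => h.robot m hm (Finset.mem_of_mem_erase hr) }

theorem getLastD_mem {α : Type*} {l : List α} (h : l ≠ []) (a : α) : l.getLastD a ∈ l := by
  rw [List.getLastD_eq_getLast?, List.getLast?_eq_getLast_of_ne_nil h]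
  exact List.getLast_mem h

/-- The move comes after all of `M₁`. Squares in `S` are still at their starts, which the path
avoids, and all other squares are outside `A`. The reached target is removed from `A`, so it need
not be crossed again. -/
theorem forward (h : Elimination I X A S T M₁ M₂) (hD : Covers X I.domain) {i j : Fin I.n}
    {w : List Cell} (hi : i ∈ S) (hj : j ∈ T) (hw : w ≠ [])
    (hc : List.IsChain (GridAdj X) (I.start i :: w)) (hl : w.getLastD (I.start i) = I.target j)
    (hwA : ∀ a ∈ w, a ∈ A ∧ ∀ i' ∈ S, I.start i' ≠ a) (hv : NonCut X A (I.target j)) :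
    Elimination I X (A \ {I.target j}) (S.erase i) (T.erase j) (M₁ ++ [⟨i, w⟩]) M₂ := by
  have hjw : I.target j ∈ w := hl ▸ getLastD_mem hw _
  have hfin : cellFinal I.start (M₁ ++ [⟨i, w⟩]) =
      Function.update (cellFinal I.start M₁) i (I.target j) := by
    rw [cellFinal_append]
    simp only [cellFinal, List.foldl_cons, List.foldl_nil, cellApply]
    congr 1
    have := h.unmoved i hi
    rw [cellFinal] at this
    rw [this, hl]
  have hoth : ∀ a ∈ w, a ∉ others (cellFinal I.start M₁) i := by
    rintro a ha ⟨i', hi', e⟩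
    by_cases hS : i' ∈ S
    · exact (hwA a ha).2 i' hS ((h.unmoved i' hS).symm.trans e)
    · exact h.removed i' hS (e ▸ (hwA a ha).1)
  exact
  { subset := Set.sdiff_subset.trans h.subset
    conn := h.conn_diff hv
    start_mem := fun i' hi' => ⟨h.start_mem i' (Finset.mem_of_mem_erase hi'),
      (hwA _ hjw).2 i' (Finset.mem_of_mem_erase hi')⟩
    target_mem := fun j' hj' => ⟨h.target_mem j' (Finset.mem_of_mem_erase hj'), fun e =>
      (Finset.ne_of_mem_erase hj') (I.target_injective e)⟩
    balance := h.balance_erase hi hj (hl ▸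
      gridConn_of_chain (h.start_mem i hi) hc fun a ha => (hwA a ha).1)
    clear := by
      rw [clearSchedule_append]
      refine ⟨h.clear, ⟨?_, ?_, ?_⟩, trivial⟩
      · exact (h.mem i).2.2
      · rintro ⟨i', hi', e⟩; exact hi' (h.injective e)
      · have e : cellFinal I.start M₁ i = I.start i := h.unmoved i hi
        dsimp only
        rw [e]
        refine chain_clearSegment hD ?_ hc fun a ha => ?_
        · rintro a ⟨i', -, rfl⟩; exact ⟨(h.mem i').1, (h.mem i').2.1⟩
        · rcases List.mem_cons.1 ha with rfl | ha
          · refine ⟨I.start_mem i, ?_⟩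
            rintro ⟨i', hi', e'⟩; exact hi' (h.injective (e'.trans e.symm))
          · exact ⟨(h.subset (hwA a ha).1).2.2, hoth a ha⟩
    injective := by
      rw [hfin]
      intro a b hab
      by_cases ha : a = i <;> by_cases hb : b = i
      · rw [ha, hb]
      · subst ha
        simp only [Function.update_self, Function.update_of_ne hb] at hab
        exact absurd ⟨b, hb, hab.symm⟩ (hoth _ hjw)
      · subst hb
        simp only [Function.update_self, Function.update_of_ne ha] at hab
        exact absurd ⟨a, ha, hab⟩ (hoth _ hjw)
      · simp only [Function.update_of_ne ha, Function.update_of_ne hb] at hab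
        exact h.injective hab
    mem := fun i' => by
      rw [hfin]
      by_cases e : i' = i
      · subst e; simpa using h.subset (h.target_mem j hj)
      · simpa [e] using h.mem i'
    unmoved := fun i' hi' => by
      rw [hfin, Function.update_of_ne (Finset.ne_of_mem_erase hi')]
      exact h.unmoved i' (Finset.mem_of_mem_erase hi')
    removed := fun i' hi' ha => by
      rw [hfin] at ha
      by_cases e : i' = i
      · subst e; simp at ha
      · rw [Function.update_of_ne e] at ha
        exact h.removed i' (fun k => hi' (Finset.mem_erase.2 ⟨e, k⟩)) ha.1
    completes := fun c hcinj h1 h2 => by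
      rw [hfin] at h1
      refine h.completes c hcinj (fun i' hi' => ?_) fun a => ?_
      · have e : i' ≠ i := fun e => hi' (e ▸ hi)
        rw [h1 i' fun k => hi' (Finset.mem_of_mem_erase k), Function.update_of_ne e]
      have hci : c i = I.target j := by rw [h1 i (by simp), Function.update_self]
      constructor
      · rintro ⟨i', hi', rfl⟩
        by_cases e : i' = i
        · subst e; exact ⟨j, hj, hci.symm⟩
        · obtain ⟨j', hj', e'⟩ := (h2 _).1 ⟨i', Finset.mem_erase.2 ⟨e, hi'⟩, rfl⟩
          exact ⟨j', Finset.mem_of_mem_erase hj', e'⟩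
      · rintro ⟨j', hj', rfl⟩
        by_cases e : j' = j
        · subst e; exact ⟨i, hi, hci⟩
        · obtain ⟨i', hi', e'⟩ := (h2 _).2 ⟨j', Finset.mem_erase.2 ⟨e, hj'⟩, rfl⟩
          exact ⟨i', Finset.mem_of_mem_erase hi', e'⟩
    nodup := by
      have h1 := h.nodup
      have h2 : ∀ m ∈ M₁ ++ M₂, m.robot ≠ i := fun m hm e => h.robot m hm (e ▸ hi)
      have hp : ((M₁ ++ [(⟨i, w⟩ : GridMove I.n)] ++ M₂).map GridMove.robot).Perm
          (i :: (M₁ ++ M₂).map GridMove.robot) := by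
        simp
      rw [hp.nodup_iff, List.nodup_cons]
      refine ⟨fun hm => ?_, h1⟩
      obtain ⟨m, hm, e⟩ := List.mem_map.1 hm
      exact h2 m hm e
    robot := fun m hm => by
      have : m ∈ M₁ ++ M₂ ∨ m = ⟨i, w⟩ := by
        simp only [List.mem_append, List.mem_singleton] at hm ⊢; tauto
      rcases this with hm | rfl
      · exact fun hr => h.robot m hm (Finset.mem_of_mem_erase hr)
      · simp }

/-- The time reversal of `forward`: the move precedes all of `M₂`. By then the other squares in `S`
occupy the targets in `T.erase j`, so these targets have to be avoided instead of starts, and the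
square `i` waits at a vertex that is no longer in the graph. -/
theorem backward (h : Elimination I X A S T M₁ M₂) (hD : Covers X I.domain) {i j : Fin I.n}
    {w : List Cell} (hi : i ∈ S) (hj : j ∈ T) (hw : w ≠ [])
    (hc : List.IsChain (GridAdj X) (I.start i :: w)) (hl : w.getLastD (I.start i) = I.target j)
    (hwA : ∀ a ∈ w, a ∈ A ∧ ∀ j' ∈ T.erase j, I.target j' ≠ a)
    (hvT : ∀ j ∈ T, I.target j ≠ I.start i) (hv : NonCut X A (I.start i)) :
    Elimination I X (A \ {I.start i}) (S.erase i) (T.erase j) M₁ (⟨i, w⟩ :: M₂) := by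
  have hjw : I.target j ∈ w := hl ▸ getLastD_mem hw _
  exact
  { subset := Set.sdiff_subset.trans h.subset
    conn := h.conn_diff hv
    start_mem := fun i' hi' => ⟨h.start_mem i' (Finset.mem_of_mem_erase hi'), fun e =>
      (Finset.ne_of_mem_erase hi') (I.start_injective e)⟩
    target_mem := fun j' hj' => ⟨h.target_mem j' (Finset.mem_of_mem_erase hj'),
      hvT j' (Finset.mem_of_mem_erase hj')⟩
    balance := h.balance_erase hi hj (hl ▸
      gridConn_of_chain (h.start_mem i hi) hc fun a ha => (hwA a ha).1)
    clear := h.clear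
    injective := h.injective
    mem := h.mem
    unmoved := fun i' hi' => h.unmoved i' (Finset.mem_of_mem_erase hi')
    removed := fun i' hi' ha => by
      by_cases e : i' = i
      · subst e; exact ha.2 (h.unmoved _ hi)
      · exact h.removed i' (fun k => hi' (Finset.mem_erase.2 ⟨e, k⟩)) ha.1
    completes := fun c hcinj h1 h2 => by
      have hci : c i = I.start i := by rw [h1 i (by simp), h.unmoved i hi]
      -- In `c` the squares of `S` other than `i` are exactly on the targets other than `j`; the
      -- remaining squares are outside `A`.
      have hoth : ∀ a ∈ w, a ∉ others c i := by
        rintro a ha ⟨i', hi', e⟩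
        by_cases hS : i' ∈ S
        · obtain ⟨j', hj', e'⟩ := (h2 a).1 ⟨i', Finset.mem_erase.2 ⟨hi', hS⟩, e⟩
          exact (hwA a ha).2 j' hj' e'
        · rw [h1 i' fun k => hS (Finset.mem_of_mem_erase k)] at e
          exact h.removed i' hS (e ▸ (hwA a ha).1)
      have hmem : ∀ i', c i' ∈ gridPoints X I.domain := fun i' => by
        by_cases hS : i' ∈ S.erase i
        · obtain ⟨j', hj', e'⟩ := (h2 _).1 ⟨i', hS, rfl⟩
          rw [← e']; exact h.subset (h.target_mem j' (Finset.mem_of_mem_erase hj'))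
        · rw [h1 i' hS]; exact h.mem i'
      have hap : cellApply c ⟨i, w⟩ = Function.update c i (I.target j) := by
        simp only [cellApply, hci, hl]
      have hnext := h.completes (cellApply c ⟨i, w⟩) ?_ ?_ ?_
      · refine ⟨⟨⟨(hmem i).2.2, ?_, ?_⟩, hnext.1⟩, hnext.2⟩
        · rintro ⟨i', hi', e⟩; exact hi' (hcinj e)
        · dsimp only
          rw [hci]
          refine chain_clearSegment hD ?_ hc fun a ha => ?_
          · rintro a ⟨i', -, rfl⟩; exact ⟨(hmem i').1, (hmem i').2.1⟩
          · rcases List.mem_cons.1 ha with rfl | ha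
            · refine ⟨I.start_mem i, ?_⟩
              rintro ⟨i', hi', e'⟩; exact hi' (hcinj (e'.trans hci.symm))
            · exact ⟨(h.subset (hwA a ha).1).2.2, hoth a ha⟩
      · rw [hap]
        intro a b hab
        by_cases ha : a = i <;> by_cases hb : b = i
        · rw [ha, hb]
        · subst ha
          simp only [Function.update_self, Function.update_of_ne hb] at hab
          exact absurd ⟨b, hb, hab.symm⟩ (hoth _ hjw)
        · subst hb
          simp only [Function.update_self, Function.update_of_ne ha] at hab
          exact absurd ⟨a, ha, hab⟩ (hoth _ hjw)
        · simp only [Function.update_of_ne ha, Function.update_of_ne hb] at hab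
          exact hcinj hab
      · intro i' hi'
        have e : i' ≠ i := fun e => hi' (e ▸ hi)
        rw [hap, Function.update_of_ne e]
        exact h1 i' fun k => hi' (Finset.mem_of_mem_erase k)
      · intro a
        rw [hap]
        constructor
        · rintro ⟨i', hi', rfl⟩
          by_cases e : i' = i
          · subst e; exact ⟨j, hj, by simp⟩
          · obtain ⟨j', hj', e'⟩ := (h2 (c i')).1 ⟨i', Finset.mem_erase.2 ⟨e, hi'⟩, rfl⟩
            exact ⟨j', Finset.mem_of_mem_erase hj', by rw [Function.update_of_ne e, e']⟩
        · rintro ⟨j', hj', rfl⟩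
          by_cases e : j' = j
          · subst e; exact ⟨i, hi, by simp⟩
          · obtain ⟨i', hi', e'⟩ := (h2 _).2 ⟨j', Finset.mem_erase.2 ⟨e, hj'⟩, rfl⟩
            exact ⟨i', Finset.mem_of_mem_erase hi', by
              rw [Function.update_of_ne (Finset.ne_of_mem_erase hi'), e']⟩
    nodup := by
      have h1 := h.nodup
      have h2 : ∀ m ∈ M₁ ++ M₂, m.robot ≠ i := fun m hm e => h.robot m hm (e ▸ hi)
      have hp : ((M₁ ++ (⟨i, w⟩ : GridMove I.n) :: M₂).map GridMove.robot).Perm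
          (i :: (M₁ ++ M₂).map GridMove.robot) := by
        simp
      rw [hp.nodup_iff, List.nodup_cons]
      refine ⟨fun hm => ?_, h1⟩
      obtain ⟨m, hm, e⟩ := List.mem_map.1 hm
      exact h2 m hm e
    robot := fun m hm => by
      have : m ∈ M₁ ++ M₂ ∨ m = ⟨i, w⟩ := by
        simp only [List.mem_append, List.mem_cons] at hm ⊢; tauto
      rcases this with hm | rfl
      · exact fun hr => h.robot m hm (Finset.mem_of_mem_erase hr)
      · simp }

theorem isMonotoneSolution (h : Elimination I X A S T M₁ M₂) (hA : A = ∅) :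
    I.IsMonotoneSolution (M₁ ++ M₂) := by
  have hS : ∀ i, i ∉ S := fun i hi => by simpa [hA] using h.start_mem i hi
  have hT : ∀ j, j ∉ T := fun j hj => by simpa [hA] using h.target_mem j hj
  have hc := h.completes (cellFinal I.start M₁) h.injective (fun _ _ => rfl) fun a => by
    simp [hS, hT]
  refine Instance.isMonotoneSolution_of_clear ?_ ?_ h.nodup
  · rw [clearSchedule_append]; exact ⟨h.clear, hc.1⟩
  · rw [cellFinal_append]; exact hc.2

open Classical in
theorem card_eq_of_solvable (h : Elimination I X A S T M₁ M₂) (hf : X.Finite)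
    (hD : Covers X I.domain) (hs : ∀ i, I.start i ∈ gridPoints X I.domain)
    (ht : ∀ i, I.target i ∈ gridPoints X I.domain) (hI : I.Solvable) {z : Cell}
    (hz : z ∈ gridPoints X I.domain) :
    (S.filter fun i => GridConn X (gridPoints X I.domain) z (I.start i)).card =
      (T.filter fun j => GridConn X (gridPoints X I.domain) z (I.target j)).card := by
  have h1 := hI.card_eq z
  have h2 := h.balance z
  rw [Nat.card_eq_fintype_card, Nat.card_eq_fintype_card, Fintype.card_subtype,
    Fintype.card_subtype] at h1
  simp only [← gridConn_iff hf hD hz (hs _), ← gridConn_iff hf hD hz (ht _)] at h1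
  omega

/-- In a solvable instance every remaining target has a remaining start in its component, and this
component is still connected inside `A`. Hence a fruitless search proves unsolvability. -/
theorem exists_start (h : Elimination I X A S T M₁ M₂) (hf : X.Finite)
    (hD : Covers X I.domain) (hs : ∀ i, I.start i ∈ gridPoints X I.domain)
    (ht : ∀ i, I.target i ∈ gridPoints X I.domain) (hI : I.Solvable) {j : Fin I.n} (hj : j ∈ T) :
    ∃ i ∈ S, GridConn X A (I.target j) (I.start i) := by
  classical
  have h1 := h.card_eq_of_solvable hf hD hs ht hI (ht j)
  have h2 : 0 < (T.filter fun j' => GridConn X (gridPoints X I.domain) (I.target j)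
      (I.target j')).card := Finset.card_pos.2 ⟨j, Finset.mem_filter.2 ⟨hj, ReflTransGen.refl⟩⟩
  rw [← h1] at h2
  obtain ⟨i, hi⟩ := Finset.card_pos.1 h2
  rw [Finset.mem_filter] at hi
  exact ⟨i, hi.1, h.conn _ (h.target_mem j hj) _ (h.start_mem i hi.1) hi.2⟩

theorem exists_target (h : Elimination I X A S T M₁ M₂) (hf : X.Finite)
    (hD : Covers X I.domain) (hs : ∀ i, I.start i ∈ gridPoints X I.domain)
    (ht : ∀ i, I.target i ∈ gridPoints X I.domain) (hI : I.Solvable) {i : Fin I.n} (hi : i ∈ S) :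
    ∃ j ∈ T, GridConn X A (I.start i) (I.target j) := by
  classical
  have h1 := h.card_eq_of_solvable hf hD hs ht hI (hs i)
  have h2 : 0 < (S.filter fun i' => GridConn X (gridPoints X I.domain) (I.start i)
      (I.start i')).card := Finset.card_pos.2 ⟨i, Finset.mem_filter.2 ⟨hi, ReflTransGen.refl⟩⟩
  rw [h1] at h2
  obtain ⟨j, hj⟩ := Finset.card_pos.1 h2
  rw [Finset.mem_filter] at hj
  exact ⟨j, hj.1, h.conn _ (h.start_mem i hi) _ (h.target_mem j hj.1) hj.2⟩

end Elimination

end SquareReconfig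

namespace SquareReconfig
open Relation

/-! ### Graph search by a loop program -/

/-- The list of the vertices found by a search from `r` along the edges `E`, latest first; `pred`
holds the vertex from which each of them was found. -/
inductive SearchTree (E : ℤ → ℤ → Prop) (pred : ℤ → ℤ) (r : ℤ) : List ℤ → Prop where
  | root : SearchTree E pred r [r]
  | grow {l : List ℤ} {q : ℤ} : SearchTree E pred r l → q ∉ l → pred q ∈ l → E (pred q) q →
      SearchTree E pred r (q :: l)

/-- `w` lists the vertices on the way from `q` back to `r`, without `q`. -/
inductive PredPath (E : ℤ → ℤ → Prop) (pred : ℤ → ℤ) (r : ℤ) : ℤ → List ℤ → Prop where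
  | nil : PredPath E pred r r []
  | cons {q : ℤ} {w : List ℤ} : q ≠ r → E (pred q) q → PredPath E pred r (pred q) w →
      PredPath E pred r q (pred q :: w)

namespace SearchTree

variable {E : ℤ → ℤ → Prop} {pred : ℤ → ℤ} {r : ℤ} {l : List ℤ}

theorem congr (h : SearchTree E pred r l) {pred' : ℤ → ℤ} (hp : ∀ q ∈ l, pred' q = pred q) :
    SearchTree E pred' r l := by
  induction h with
  | root => exact root
  | @grow l q _ h2 h3 h4 ih =>
    have e := hp q (by simp)
    exact grow (ih fun a ha => hp a (List.mem_cons_of_mem _ ha)) h2 (by rwa [e]) (by rwa [e])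

theorem root_mem (h : SearchTree E pred r l) : r ∈ l := by
  induction h with
  | root => simp
  | grow _ _ _ _ ih => exact List.mem_cons_of_mem _ ih

theorem nodup (h : SearchTree E pred r l) : l.Nodup := by
  induction h with
  | root => simp
  | grow _ h2 _ _ ih => exact List.nodup_cons.2 ⟨h2, ih⟩

theorem forall_mem (h : SearchTree E pred r l) {P : ℤ → Prop} (hr : P r)
    (hE : ∀ p q, P p → E p q → P q) : ∀ q ∈ l, P q := by
  induction h with
  | root => simpa using hr
  | grow _ _ h3 h4 ih =>
    intro a ha
    rcases List.mem_cons.1 ha with rfl | ha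
    · exact hE _ _ (ih _ h3) h4
    · exact ih a ha

/-- A predecessor was found earlier than its successor, so following predecessors reaches the root.
The length bound guarantees that loops with as many rounds as there are vertices suffice to write a
path down. -/
theorem exists_predPath (h : SearchTree E pred r l) : ∀ q ∈ l, ∃ w, PredPath E pred r q w ∧
    w.length < l.length ∧ ∀ a ∈ w, a ∈ l := by
  induction h with
  | root => intro q hq; rw [List.mem_singleton.1 hq]; exact ⟨[], PredPath.nil, by simp, by simp⟩
  | @grow l q h1 h2 h3 h4 ih =>
    intro a ha
    rcases List.mem_cons.1 ha with rfl | ha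
    · obtain ⟨w, w1, w2, w3⟩ := ih _ h3
      refine ⟨_, PredPath.cons (fun e => h2 (e ▸ h1.root_mem)) h4 w1, by simp; omega, ?_⟩
      intro b hb
      rcases List.mem_cons.1 hb with rfl | hb
      · exact List.mem_cons_of_mem _ h3
      · exact List.mem_cons_of_mem _ (w3 b hb)
    · obtain ⟨w, w1, w2, w3⟩ := ih _ ha
      exact ⟨w, w1, by simp; omega, fun b hb => List.mem_cons_of_mem _ (w3 b hb)⟩

theorem length_le (h : SearchTree E pred r l) {N : ℕ} (hl : ∀ q ∈ l, 0 ≤ q ∧ q < N) :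
    l.length ≤ N := by
  have h1 : l.toFinset ⊆ Finset.Ico (0 : ℤ) N := fun q hq => by
    rw [List.mem_toFinset] at hq; rw [Finset.mem_Ico]; exact hl q hq
  have h2 := Finset.card_le_card h1
  rw [List.toFinset_card_of_nodup h.nodup] at h2
  simpa using h2

end SearchTree

/-- The data of the compressed grid in the memory: vertex `q` is the point `V q`, and arrays 4 and 5
hold the next coordinates. -/
structure GridData (X : Set ℤ) (N : ℕ) (V : ℤ → Cell) (s : State) : Prop where
  reg_size : s.reg 4 = N
  vertex : ∀ q, V q = (s.arr 2 q, s.arr 3 q)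
  next_fst : ∀ q : ℤ, 0 ≤ q → q < N → NextOf X (V q).1 (s.arr 4 q)
  next_snd : ∀ q : ℤ, 0 ≤ q → q < N → NextOf X (V q).2 (s.arr 5 q)

theorem GridData.frame {X : Set ℤ} {N : ℕ} {V : ℤ → Cell} {s t : State} (h : GridData X N V s)
    (h4 : t.reg 4 = s.reg 4) (a2 : t.arr 2 = s.arr 2) (a3 : t.arr 3 = s.arr 3)
    (a4 : t.arr 4 = s.arr 4) (a5 : t.arr 5 = s.arr 5) : GridData X N V t :=
  ⟨h4.trans h.reg_size, by rw [a2, a3]; exact h.vertex, by rw [a4]; exact h.next_fst,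
    by rw [a5]; exact h.next_snd⟩

theorem GridData.of_frame {X : Set ℤ} {N : ℕ} {V : ℤ → Cell} {P : Code} {s t : State}
    (h : GridData X N V s) (hf : P.Frame s t) (hr : 4 ∉ P.regs)
    (ha : 2 ∉ P.arrs ∧ 3 ∉ P.arrs ∧ 4 ∉ P.arrs ∧ 5 ∉ P.arrs) : GridData X N V t :=
  h.frame (hf.1 _ hr) (hf.2 _ ha.1) (hf.2 _ ha.2.1) (hf.2 _ ha.2.2.1) (hf.2 _ ha.2.2.2)

/-- Tests whether the vertices in registers `p` and `q` are adjacent. -/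
def adjTest (p q : ℕ) : Test :=
  .or (.and (.eq (.get 3 (.reg p)) (.get 3 (.reg q)))
        (.or (.eq (.get 4 (.reg p)) (.get 2 (.reg q))) (.eq (.get 4 (.reg q)) (.get 2 (.reg p)))))
      (.and (.eq (.get 2 (.reg p)) (.get 2 (.reg q)))
        (.or (.eq (.get 5 (.reg p)) (.get 3 (.reg q))) (.eq (.get 5 (.reg q)) (.get 3 (.reg p)))))

/-- The next coordinate is unique, so the relation `NextOf` can be tested as equality with the
stored value. -/
theorem eval_adjTest {X : Set ℤ} {N : ℕ} {V : ℤ → Cell} {s : State} (h : GridData X N V s)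
    {x y : ℕ} {p q : ℤ} (hx : s.reg x = p) (hy : s.reg y = q) (hp : 0 ≤ p ∧ p < N)
    (hq : 0 ≤ q ∧ q < N) : (adjTest x y).eval s = true ↔ GridAdj X (V p) (V q) := by
  have n1 : ∀ a, s.arr 4 p = a ↔ NextOf X (V p).1 a := fun a =>
    ⟨fun e => e ▸ h.next_fst p hp.1 hp.2, fun e => (h.next_fst p hp.1 hp.2).unique e⟩
  have n2 : ∀ a, s.arr 5 p = a ↔ NextOf X (V p).2 a := fun a =>
    ⟨fun e => e ▸ h.next_snd p hp.1 hp.2, fun e => (h.next_snd p hp.1 hp.2).unique e⟩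
  have n3 : ∀ a, s.arr 4 q = a ↔ NextOf X (V q).1 a := fun a =>
    ⟨fun e => e ▸ h.next_fst q hq.1 hq.2, fun e => (h.next_fst q hq.1 hq.2).unique e⟩
  have n4 : ∀ a, s.arr 5 q = a ↔ NextOf X (V q).2 a := fun a =>
    ⟨fun e => e ▸ h.next_snd q hq.1 hq.2, fun e => (h.next_snd q hq.1 hq.2).unique e⟩
  simp only [adjTest, Test.eval_or, Test.eval_and, Test.eval_eq, Expr.eval, hx, hy, n1, n2, n3, n4,
    GridAdj]
  rw [h.vertex p, h.vertex q]

/-- One relaxation: extend the search from vertex `reg 21` to vertex `reg 22`, if possible. -/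
def growCode (f : ℕ) : Code :=
  .ite (.and (.eq (.get 9 (.reg 21)) (.const 1)) (.and (.eq (.get 9 (.reg 22)) (.const 0))
      (.and (.eq (.get 6 (.reg 22)) (.const 1)) (.and (.eq (.get f (.reg 21)) (.const 0))
        (adjTest 21 22)))))
    (.store 9 (.reg 22) (.const 1) ;; .store 10 (.reg 22) (.reg 21) ;; .assign 12 (.reg 22))
    .skip

/-- Search from vertex `reg 11` among the vertices marked 1 in array 6, without going on from
vertices that are marked in array `f`. The vertices found are marked 1 in array 9, with their
predecessors in array 10; the last one found is in register 12. -/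
def searchCode (f : ℕ) : Code :=
  .loop 20 4 (.store 9 (.reg 20) (.const 0)) ;;
  .store 9 (.reg 11) (.const 1) ;;
  .assign 12 (.reg 11) ;;
  .loop 20 4 (.loop 21 4 (.loop 22 4 (growCode f)))

/-- The edges along which a search may go on. -/
def SearchEdge (X : Set ℤ) (N : ℕ) (V : ℤ → Cell) (alive flag : ℤ → ℤ) (p q : ℤ) : Prop :=
  (0 ≤ q ∧ q < N) ∧ alive q = 1 ∧ flag p = 0 ∧ GridAdj X (V p) (V q)

structure SearchInv (E : ℤ → ℤ → Prop) (N : ℕ) (r : ℤ) (l : List ℤ) (s : State) : Prop where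
  tree : SearchTree E (s.arr 10) r l
  last : l.head? = some (s.reg 12)
  reach : ∀ q : ℤ, 0 ≤ q → q < N → s.arr 9 q = if q ∈ l then 1 else 0
  range : ∀ q ∈ l, 0 ≤ q ∧ q < N

theorem SearchInv.setReg {E : ℤ → ℤ → Prop} {N : ℕ} {r : ℤ} {l : List ℤ} {s : State}
    (h : SearchInv E N r l s) {c : ℕ} (hc : c ≠ 12) (v : ℤ) : SearchInv E N r l (s.setReg c v) :=
  ⟨h.tree, by simpa [hc.symm] using h.last, h.reach, h.range⟩

section

variable {X : Set ℤ} {N : ℕ} {V : ℤ → Cell} {alive flag : ℤ → ℤ} {r : ℤ} {f : ℕ}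

theorem growCode_spec {s : State} {l : List ℤ} (hg : GridData X N V s) (ha : s.arr 6 = alive)
    (hfl : s.arr f = flag) (h : SearchInv (SearchEdge X N V alive flag) N r l s) {p q : ℤ}
    (hp : s.reg 21 = p) (hq : s.reg 22 = q) (hpN : 0 ≤ p ∧ p < N) (hqN : 0 ≤ q ∧ q < N) :
    ∃ l', l <:+ l' ∧ SearchInv (SearchEdge X N V alive flag) N r l' ((growCode f).run s) ∧
      (p ∈ l → SearchEdge X N V alive flag p q → q ∈ l') := by
  rw [growCode, Code.run_ite]
  split
  · rename_i hc
    rw [Test.eval_and, Test.eval_and, Test.eval_and, Test.eval_and, eval_adjTest hg hp hq hpN hqN]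
      at hc
    simp only [Test.eval_eq, Expr.eval, hp, hq, ha, hfl] at hc
    obtain ⟨c1, c2, c3, c4, c5⟩ := hc
    have hpl : p ∈ l := by
      by_contra hn; rw [h.reach p hpN.1 hpN.2, if_neg hn] at c1; omega
    have hql : q ∉ l := by
      intro hn; rw [h.reach q hqN.1 hqN.2, if_pos hn] at c2; omega
    refine ⟨q :: l, List.suffix_cons q l, ⟨?_, ?_, ?_, ?_⟩, fun _ _ => by simp⟩
    · simp only [Code.run_seq, Code.run_store, Code.run_assign, State.arr_setReg,
        State.arr_setArr_self, Expr.eval, State.reg_setArr, hp, hq,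
        State.arr_setArr_of_ne _ _ _ (show (10 : ℕ) ≠ 9 by decide)]
      refine SearchTree.grow (h.tree.congr fun a ha => ?_) hql (by simpa using hpl) ?_
      · rw [Function.update_of_ne]; rintro rfl; exact hql ha
      · simpa using ⟨hqN, c3, c4, c5⟩
    · simp [Expr.eval, hq]
    · intro a ha1 ha2
      simp only [Code.run_seq, Code.run_store, Code.run_assign, State.arr_setReg,
        State.arr_setArr_self, Expr.eval, State.reg_setArr, hq,
        State.arr_setArr_of_ne _ _ _ (show (9 : ℕ) ≠ 10 by decide)]
      by_cases e : a = q
      · subst e; simp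
      · simp [h.reach a ha1 ha2, e]
    · intro a ha
      rcases List.mem_cons.1 ha with rfl | ha
      · exact hqN
      · exact h.range a ha
  · rename_i hc
    rw [Test.eval_and, Test.eval_and, Test.eval_and, Test.eval_and, eval_adjTest hg hp hq hpN hqN]
      at hc
    simp only [Test.eval_eq, Expr.eval, hp, hq, ha, hfl] at hc
    refine ⟨l, List.suffix_rfl, h, fun hpl he => ?_⟩
    by_contra hql
    refine hc ⟨?_, ?_, he.2.1, he.2.2.1, he.2.2.2⟩
    · rw [h.reach p hpN.1 hpN.2, if_pos hpl]
    · rw [h.reach q hqN.1 hqN.2, if_neg hql]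

theorem growLoop_spec {s : State} {l : List ℤ} (hf9 : f ≠ 9) (hf10 : f ≠ 10)
    (hg : GridData X N V s) (ha : s.arr 6 = alive)
    (hfl : s.arr f = flag) (h : SearchInv (SearchEdge X N V alive flag) N r l s) {p : ℤ}
    (hp : s.reg 21 = p) (hpN : 0 ≤ p ∧ p < N) :
    ∃ l', l <:+ l' ∧
      SearchInv (SearchEdge X N V alive flag) N r l' ((Code.loop 22 4 (growCode f)).run s) ∧
      (p ∈ l → ∀ q, SearchEdge X N V alive flag p q → q ∈ l') := by
  have key := Code.loop_inv (c := 22) (P := growCode f) hg.reg_size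
    (fun k t => ∃ l', l <:+ l' ∧ SearchInv (SearchEdge X N V alive flag) N r l' t ∧
      (p ∈ l → ∀ q : ℤ, q < k → SearchEdge X N V alive flag p q → q ∈ l'))
    ⟨l, List.suffix_rfl, h.setReg (by decide) _, fun _ q hq he => by
      have := he.1.1; simp only [Nat.cast_zero] at hq; omega⟩ ?_
  · obtain ⟨l', h1, h2, h3⟩ := key
    exact ⟨l', h1, h2, fun hpl q he => h3 hpl q he.1.2 he⟩
  · rintro k hk t ht hfr ⟨l', h1, h2, h3⟩
    obtain ⟨l'', i1, i2, i3⟩ := growCode_spec (f := f) (hg.of_frame hfr (by simp [Code.regs, growCode])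
      (by simp [Code.arrs, growCode])) ((hfr.2 6 (by simp [Code.arrs, growCode])).trans ha)
      ((hfr.2 f (by simp [Code.arrs, growCode, hf9, hf10])).trans hfl) h2
      ((hfr.1 21 (by simp [Code.regs, growCode])).trans hp) ht hpN ⟨by omega, by omega⟩
    refine ⟨l'', h1.trans i1, i2.setReg (by decide) _, fun hpl q hq he => ?_⟩
    by_cases e : q = k
    · subst e; exact i3 (h1.subset hpl) he
    · exact i1.subset (h3 hpl q (by push_cast at hq; omega) he)

/-- One sweep over all pairs finds every successor of the vertices known before it; it may find
more. -/
theorem growLoop₂_spec {s : State} {l : List ℤ} (hf9 : f ≠ 9) (hf10 : f ≠ 10)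
    (hg : GridData X N V s) (ha : s.arr 6 = alive)
    (hfl : s.arr f = flag) (h : SearchInv (SearchEdge X N V alive flag) N r l s) :
    ∃ l', l <:+ l' ∧ SearchInv (SearchEdge X N V alive flag) N r l'
        ((Code.loop 21 4 (.loop 22 4 (growCode f))).run s) ∧
      (∀ p ∈ l, ∀ q, SearchEdge X N V alive flag p q → q ∈ l') := by
  have key := Code.loop_inv (c := 21) (P := .loop 22 4 (growCode f)) hg.reg_size
    (fun k t => ∃ l', l <:+ l' ∧ SearchInv (SearchEdge X N V alive flag) N r l' t ∧
      (∀ p ∈ l, p < k → ∀ q, SearchEdge X N V alive flag p q → q ∈ l'))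
    ⟨l, List.suffix_rfl, h.setReg (by decide) _, fun p hp hp0 => by
      have := (h.range p hp).1; simp only [Nat.cast_zero] at hp0; omega⟩ ?_
  · obtain ⟨l', h1, h2, h3⟩ := key
    exact ⟨l', h1, h2, fun p hp q he => h3 p hp (h.range p hp).2 q he⟩
  · rintro k hk t ht hfr ⟨l', h1, h2, h3⟩
    obtain ⟨l'', i1, i2, i3⟩ := growLoop_spec hf9 hf10
      (hg.of_frame hfr (by simp [Code.regs, growCode])
      (by simp [Code.arrs, growCode])) ((hfr.2 6 (by simp [Code.arrs, growCode])).trans ha)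
      ((hfr.2 f (by simp [Code.arrs, growCode, hf9, hf10])).trans hfl) h2
      ht ⟨by omega, by omega⟩
    refine ⟨l'', h1.trans i1, i2.setReg (by decide) _, fun p hp hpk q he => ?_⟩
    by_cases e : p = k
    · subst e; exact i3 (h1.subset hp) q he
    · exact i1.subset (h3 p hp (by push_cast at hpk; omega) q he)

/-- The search is by repeated sweeps, without a queue. A sweep that finds nothing new shows that the
list is closed under the edges. -/
theorem searchCode_spec {s : State} (hf9 : f ≠ 9) (hf10 : f ≠ 10) (hg : GridData X N V s)
    (ha : s.arr 6 = alive) (hfl : s.arr f = flag) (hr : s.reg 11 = r) (hrN : 0 ≤ r ∧ r < N) :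
    ∃ l, SearchInv (SearchEdge X N V alive flag) N r l ((searchCode f).run s) ∧
      ∀ p ∈ l, ∀ q, SearchEdge X N V alive flag p q → q ∈ l := by
  set P₁ : Code := .loop 20 4 (.store 9 (.reg 20) (.const 0)) with hP₁
  set t₁ := P₁.run s with ht₁
  have hz : ∀ q : ℤ, 0 ≤ q → q < N → t₁.arr 9 q = 0 := by
    refine Code.loop_inv (c := 20) (P := .store 9 (.reg 20) (.const 0)) hg.reg_size
      (fun k t => ∀ q : ℤ, 0 ≤ q → q < k → t.arr 9 q = 0) (fun q h1 h2 => by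
        simp only [Nat.cast_zero] at h2; omega) ?_
    intro k hk t ht _ ih q h1 h2
    simp only [Code.run_store, State.arr_setReg, State.arr_setArr_self, Expr.eval, ht]
    by_cases e : q = k
    · subst e; simp
    · rw [Function.update_of_ne e]; exact ih q h1 (by push_cast at h2; omega)
  have hfr₁ : P₁.Frame s t₁ := Code.frame_run _ _
  set P₂ : Code := P₁ ;; .store 9 (.reg 11) (.const 1) ;; .assign 12 (.reg 11) with hP₂
  set t₂ := P₂.run s with ht₂
  have hfr₂ : P₂.Frame s t₂ := Code.frame_run _ _
  have hinv : SearchInv (SearchEdge X N V alive flag) N r [r] t₂ := by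
    have e11 : t₁.reg 11 = r := (hfr₁.1 11 (by simp [hP₁, Code.regs])).trans hr
    have e : t₂ = (t₁.setArr 9 r 1).setReg 12 r := by
      simp only [ht₂, hP₂, Code.run_seq, ← ht₁, Code.run_store, Code.run_assign, Expr.eval, e11,
        State.reg_setArr]
    rw [e]
    refine ⟨SearchTree.root, by simp, fun q h1 h2 => ?_, by simpa using hrN⟩
    simp only [State.arr_setReg, State.arr_setArr_self, List.mem_singleton]
    by_cases e : q = r
    · subst e; simp
    · rw [Function.update_of_ne e, hz q h1 h2, if_neg e]
  have hg₂ : GridData X N V t₂ := hg.of_frame hfr₂ (by simp [hP₂, hP₁, Code.regs])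
    (by simp [hP₂, hP₁, Code.arrs])
  have ha₂ : t₂.arr 6 = alive := (hfr₂.2 6 (by simp [hP₂, hP₁, Code.arrs])).trans ha
  have hfl₂ : t₂.arr f = flag := (hfr₂.2 f (by simp [hP₂, hP₁, Code.arrs, hf9])).trans hfl
  -- After `k` sweeps the list is closed or has at least `k + 1` distinct vertices; for `k = N` the
  -- latter exceeds the number of vertices.
  have key := Code.loop_inv (c := 20) (P := .loop 21 4 (.loop 22 4 (growCode f))) hg₂.reg_size
    (fun k t => ∃ l, SearchInv (SearchEdge X N V alive flag) N r l t ∧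
      (k + 1 ≤ l.length ∨ ∀ p ∈ l, ∀ q, SearchEdge X N V alive flag p q → q ∈ l))
    ⟨[r], hinv.setReg (by decide) _, Or.inl (by simp)⟩ ?_
  · obtain ⟨l, h1, h2⟩ := key
    refine ⟨l, h1, h2.resolve_left fun h => ?_⟩
    have := h1.tree.length_le h1.range
    omega
  · rintro k hk t ht hfr ⟨l, h1, h2⟩
    obtain ⟨l', i1, i2, i3⟩ := growLoop₂_spec hf9 hf10
      (hg₂.of_frame hfr (by simp [Code.regs, growCode]) (by simp [Code.arrs, growCode]))
      ((hfr.2 6 (by simp [Code.arrs, growCode])).trans ha₂)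
      ((hfr.2 f (by simp [Code.arrs, growCode, hf9, hf10])).trans hfl₂) h1
    refine ⟨l', i2.setReg (by decide) _, ?_⟩
    rcases h2 with h2 | h2
    · by_cases e : l' = l
      · subst e; exact Or.inr i3
      · left
        have := i1.length_le
        have : l.length ≠ l'.length := fun e' => e (i1.eq_of_length e').symm
        omega
    · right
      have hall := i2.tree.forall_mem (P := (· ∈ l)) h1.tree.root_mem (fun p q hp he => h2 p hp q he)
      exact fun p hp q he => i1.subset (h2 p (hall p hp) q he)

end

end SquareReconfig

namespace SquareReconfig
open Relation

/-! ### Lists in memory -/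

/-- The list `l` is stored from index `o` on. -/
def Holds (a : ℤ → ℤ) : ℤ → List ℤ → Prop
  | _, [] => True
  | o, x :: l => a o = x ∧ Holds a (o + 1) l

theorem holds_append {a : ℤ → ℤ} {l l' : List ℤ} {o : ℤ} :
    Holds a o (l ++ l') ↔ Holds a o l ∧ Holds a (o + l.length) l' := by
  induction l generalizing o with
  | nil => simp [Holds]
  | cons x l ih =>
    simp only [List.cons_append, Holds, ih, List.length_cons, and_assoc]
    rw [show o + 1 + (l.length : ℤ) = o + ((l.length + 1 : ℕ) : ℤ) by push_cast; ring]

theorem Holds.congr {a b : ℤ → ℤ} {l : List ℤ} {o : ℤ} (h : Holds a o l)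
    (hab : ∀ k, o ≤ k → k < o + l.length → b k = a k) : Holds b o l := by
  induction l generalizing o with
  | nil => trivial
  | cons x l ih =>
    simp only [List.length_cons, Nat.cast_add, Nat.cast_one] at hab
    exact ⟨(hab o le_rfl (by omega)).trans h.1, ih h.2 fun k h1 h2 => hab k (by omega) (by omega)⟩

theorem Holds.getElem {a : ℤ → ℤ} {l : List ℤ} {o : ℤ} (h : Holds a o l) (k : ℕ)
    (hk : k < l.length) : a (o + k) = l[k] := by
  induction l generalizing o k with
  | nil => simp at hk
  | cons x l ih =>
    cases k with
    | zero => simpa using h.1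
    | succ k =>
      simp only [List.getElem_cons_succ]
      rw [← ih h.2 k (by simpa using hk)]
      congr 1; push_cast; ring

theorem holds_of_getElem {a : ℤ → ℤ} {l : List ℤ} {o : ℤ}
    (h : ∀ k (hk : k < l.length), a (o + k) = l[k]) : Holds a o l := by
  induction l generalizing o with
  | nil => trivial
  | cons x l ih =>
    have h0 := h 0 (Nat.succ_pos _)
    rw [Nat.cast_zero, add_zero] at h0
    refine ⟨h0, ih fun k hk => ?_⟩
    have := h (k + 1) (by simpa using hk)
    simp only [List.getElem_cons_succ] at this
    rw [← this]; congr 1; push_cast; ring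

theorem length_encodeCells (l : List Cell) : (encodeCells l).length = 2 * l.length := by
  induction l with
  | nil => rfl
  | cons z l ih => simp only [encodeCells, List.flatMap_cons, List.length_append, List.length_cons,
      List.length_nil] at ih ⊢; omega

theorem encodeCells_append (l l' : List Cell) :
    encodeCells (l ++ l') = encodeCells l ++ encodeCells l' := by
  simp [encodeCells]

theorem encodeCells_singleton (z : Cell) : encodeCells [z] = [z.1, z.2] := rfl

theorem encodeCells_cons (z : Cell) (l : List Cell) :
    encodeCells (z :: l) = z.1 :: z.2 :: encodeCells l := rfl

/-- The encoding of a list of moves. -/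
def encodeMoves {n : ℕ} (ms : List (GridMove n)) : List ℤ :=
  ms.flatMap fun m => ((m.robot : ℕ) : ℤ) :: (m.waypoints.length : ℤ) :: encodeCells m.waypoints

theorem encodeMoves_append {n : ℕ} (ms ms' : List (GridMove n)) :
    encodeMoves (ms ++ ms') = encodeMoves ms ++ encodeMoves ms' := by
  simp [encodeMoves]

theorem encodeMoves_cons {n : ℕ} (m : GridMove n) (ms : List (GridMove n)) :
    encodeMoves (m :: ms) = (((m.robot : ℕ) : ℤ) :: (m.waypoints.length : ℤ) ::
      encodeCells m.waypoints) ++ encodeMoves ms := rfl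

/-! ### Picking a vertex -/

/-- Find a vertex `reg 20` that passes the test, and write it into register `x`; `-1` if there is
none. -/
def pickCode (x : ℕ) (b : Test) : Code :=
  .assign x (.const (-1)) ;; .loop 20 4 (.ite b (.assign x (.reg 20)) .skip)

/-- The test is only ever evaluated in states that differ from `s` in `x` and the counter; hence the
form of `hb`. -/
theorem pickCode_spec {s : State} {x : ℕ} {b : Test} {N : ℕ} {P : ℤ → Prop} (hN : s.reg 4 = N)
    (hx : x ≠ 20 ∧ x ≠ 4)
    (hb : ∀ (t : State) (q : ℤ), (∀ y, y ≠ x → y ≠ 20 → t.reg y = s.reg y) → t.arr = s.arr →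
      t.reg 20 = q → 0 ≤ q → q < N → (b.eval t = true ↔ P q)) :
    (((pickCode x b).run s).reg x = -1 ∧ ∀ q : ℤ, 0 ≤ q → q < N → ¬ P q) ∨
    ∃ q : ℤ, ((pickCode x b).run s).reg x = q ∧ 0 ≤ q ∧ q < N ∧ P q := by
  have key := Code.loop_inv (s := s.setReg x (-1)) (c := 20) (b := 4)
    (P := .ite b (.assign x (.reg 20)) .skip) (K := N) (by simpa [hx.2.symm] using hN)
    (fun k t => (t.reg x = -1 ∧ ∀ q : ℤ, 0 ≤ q → q < k → ¬ P q) ∨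
      ∃ q : ℤ, t.reg x = q ∧ 0 ≤ q ∧ q < N ∧ P q)
    (Or.inl ⟨by simp [hx.1], fun q h1 h2 => by simp only [Nat.cast_zero] at h2; omega⟩) ?_
  · exact key
  · intro k hk t ht hfr ih
    have hbt := hb t k (fun y h1 h2 => by
        rw [hfr.1 y (by simp [Code.regs, h1, h2])]; simp [h1])
      (by funext a; exact hfr.2 a (by simp [Code.arrs])) ht (by omega) (by omega)
    rw [Code.run_ite]
    by_cases hP : P k
    · rw [if_pos (hbt.2 hP)]
      exact Or.inr ⟨k, by simp [Expr.eval, ht, hx.1], by omega, by omega, hP⟩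
    · rw [if_neg (fun h => hP (hbt.1 h))]
      rcases ih with ⟨h1, h2⟩ | ⟨q, h1, h2⟩
      · refine Or.inl ⟨by simp [hx.1, h1], fun q h3 h4 => ?_⟩
        by_cases e : q = k
        · rw [e]; exact hP
        · exact h2 q h3 (by push_cast at h4; omega)
      · exact Or.inr ⟨q, by simp [hx.1, h1], h2⟩

/-! ### Writing moves -/

theorem PredPath.eq_nil {E : ℤ → ℤ → Prop} {pred : ℤ → ℤ} {r : ℤ} {w : List ℤ}
    (h : PredPath E pred r r w) : w = [] := by
  cases h with
  | nil => rfl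
  | cons h => exact absurd rfl h

theorem PredPath.eq_cons {E : ℤ → ℤ → Prop} {pred : ℤ → ℤ} {r q : ℤ} {w : List ℤ}
    (h : PredPath E pred r q w) (hq : q ≠ r) :
    ∃ w', w = pred q :: w' ∧ PredPath E pred r (pred q) w' := by
  cases h with
  | nil => exact absurd rfl hq
  | cons _ _ h => exact ⟨_, rfl, h⟩

/-- One step of `forwardCode`. -/
def forwardStep : Code :=
  .ite (.eq (.reg 15) (.reg 13)) .skip
    (.assign 15 (.get 10 (.reg 15)) ;; .store 1 (.reg 0) (.get 2 (.reg 15)) ;;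
      .store 1 (.add (.reg 0) (.const 1)) (.get 3 (.reg 15)) ;;
      .assign 0 (.add (.reg 0) (.const 2)) ;; .assign 16 (.add (.reg 16) (.const 1)))

/-- Write the move of the square at vertex `reg 14` along the predecessors to vertex `reg 13` behind
the output. -/
def forwardCode : Code :=
  .store 1 (.reg 0) (.sub (.get 7 (.reg 14)) (.const 1)) ;;
  .assign 17 (.add (.reg 0) (.const 1)) ;; .assign 0 (.add (.reg 0) (.const 2)) ;;
  .assign 16 (.const 0) ;; .assign 15 (.reg 14) ;;
  .loop 20 4 forwardStep ;;
  .store 1 (.reg 17) (.reg 16) ;; .assign 9 (.add (.reg 9) (.const 1))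

/-- Predecessors lead from the square to the root of the search, so the waypoints appear in the
order of motion. Slot `o + 1` is kept for their number, known only after the loop. Flags store
indices plus 1, hence the subtraction. -/
theorem forwardCode_spec {s : State} {X : Set ℤ} {N : ℕ} {V : ℤ → Cell} {E : ℤ → ℤ → Prop}
    {u v o : ℤ} {w : List ℤ} (hg : GridData X N V s) (hw : PredPath E (s.arr 10) v u w)
    (hwN : w.length ≤ N) (hu : s.reg 14 = u) (hv : s.reg 13 = v) (ho : s.reg 0 = o) :
    (forwardCode.run s).reg 0 = o + 2 + 2 * w.length ∧
    (forwardCode.run s).reg 9 = s.reg 9 + 1 ∧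
    (∀ k < o, (forwardCode.run s).arr 1 k = s.arr 1 k) ∧
    Holds ((forwardCode.run s).arr 1) o
      ((s.arr 7 u - 1) :: (w.length : ℤ) :: encodeCells (w.map V)) := by
  set P₁ : Code := .store 1 (.reg 0) (.sub (.get 7 (.reg 14)) (.const 1)) ;;
    .assign 17 (.add (.reg 0) (.const 1)) ;; .assign 0 (.add (.reg 0) (.const 2)) ;;
    .assign 16 (.const 0) ;; .assign 15 (.reg 14) with hP₁
  set t₁ := P₁.run s with ht₁
  have hfr₁ : P₁.Frame s t₁ := Code.frame_run _ _
  have r0 : t₁.reg 0 = o + 2 := by simp [ht₁, hP₁, Expr.eval, ho]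
  have r16 : t₁.reg 16 = 0 := by simp [ht₁, hP₁, Expr.eval]
  have r15 : t₁.reg 15 = u := by simp [ht₁, hP₁, Expr.eval, hu]
  have r17 : t₁.reg 17 = o + 1 := by simp [ht₁, hP₁, Expr.eval, ho]
  have a1 : t₁.arr 1 = Function.update (s.arr 1) o (s.arr 7 u - 1) := by
    simp [ht₁, hP₁, Expr.eval, ho, hu]
  have hg₁ : GridData X N V t₁ := hg.of_frame hfr₁ (by simp [hP₁, Code.regs])
    (by simp [hP₁, Code.arrs])
  have r13 : t₁.reg 13 = v := (hfr₁.1 13 (by simp [hP₁, Code.regs])).trans hv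
  have r9 : t₁.reg 9 = s.reg 9 := hfr₁.1 9 (by simp [hP₁, Code.regs])
  have a10 : t₁.arr 10 = s.arr 10 := hfr₁.2 10 (by simp [hP₁, Code.arrs])
  set t₂ := (Code.loop 20 4 forwardStep).run t₁ with ht₂
  have hfr₂ : (Code.loop 20 4 forwardStep).Frame t₁ t₂ := Code.frame_run _ _
  -- `w₁` is written and `w₂` is left. The truncated difference also describes the idle rounds after
  -- the root has been reached, and it is 0 after `N` rounds because `w.length ≤ N`.
  have key : ∃ w₁ w₂, w = w₁ ++ w₂ ∧ PredPath E (s.arr 10) v (t₂.reg 15) w₂ ∧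
      w₂.length = w.length - N ∧ t₂.reg 0 = o + 2 + 2 * w₁.length ∧ t₂.reg 16 = w₁.length ∧
      (∀ k < o, t₂.arr 1 k = s.arr 1 k) ∧ t₂.arr 1 o = s.arr 7 u - 1 ∧
      Holds (t₂.arr 1) (o + 2) (encodeCells (w₁.map V)) := by
    refine Code.loop_inv (c := 20) (P := forwardStep) hg₁.reg_size
      (fun k t => ∃ w₁ w₂, w = w₁ ++ w₂ ∧ PredPath E (s.arr 10) v (t.reg 15) w₂ ∧
        w₂.length = w.length - k ∧ t.reg 0 = o + 2 + 2 * w₁.length ∧ t.reg 16 = w₁.length ∧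
        (∀ k < o, t.arr 1 k = s.arr 1 k) ∧ t.arr 1 o = s.arr 7 u - 1 ∧
        Holds (t.arr 1) (o + 2) (encodeCells (w₁.map V))) ?_ ?_
    · refine ⟨[], w, rfl, by simpa [r15] using hw, by simp, by simp [r0], by simp [r16], ?_, ?_,
        trivial⟩
      · intro k hk
        rw [State.arr_setReg, a1, Function.update_of_ne (by omega)]
      · rw [State.arr_setReg, a1, Function.update_self]
    · rintro k hk t ht hfr ⟨w₁, w₂, e, h1, h2, h3, h4, h5, h6, h7⟩
      have q13 : t.reg 13 = v := (hfr.1 13 (by simp [Code.regs, forwardStep])).trans r13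
      have q10 : t.arr 10 = s.arr 10 := (hfr.2 10 (by simp [Code.arrs, forwardStep])).trans a10
      have q2 : t.arr 2 = t₁.arr 2 := hfr.2 2 (by simp [Code.arrs, forwardStep])
      have q3 : t.arr 3 = t₁.arr 3 := hfr.2 3 (by simp [Code.arrs, forwardStep])
      rw [forwardStep, Code.run_ite]
      by_cases hc : t.reg 15 = v
      · rw [if_pos (by simp [Expr.eval, hc, q13])]
        rw [hc] at h1
        have e2 := h1.eq_nil
        subst e2
        refine ⟨w₁, [], e, by simpa [hc] using h1, ?_, by simp [h3], by simp [h4], h5, h6, h7⟩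
        simp only [List.length_nil] at h2 ⊢; omega
      · rw [if_neg (by simp [Expr.eval, hc, q13])]
        obtain ⟨w₃, rfl, h8⟩ := h1.eq_cons hc
        set p := s.arr 10 (t.reg 15) with hp
        have hV : V p = (t.arr 2 p, t.arr 3 p) := by rw [hg₁.vertex p, q2, q3]
        refine ⟨w₁ ++ [p], w₃, by simp [e], ?_, ?_, ?_, ?_, ?_, ?_, ?_⟩
        · simpa [Expr.eval, q10, ← hp] using h8
        · simp only [List.length_cons] at h2; omega
        · simp [Expr.eval, h3]; ring
        · simp [Expr.eval, h4]
        · intro x hx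
          simp only [Code.run_seq, Code.run_store, Code.run_assign, State.arr_setReg,
            State.arr_setArr_self, Expr.eval, State.reg_setReg, State.reg_setArr, h3,
            OfNat.zero_ne_ofNat, if_false]
          rw [Function.update_of_ne (by omega), Function.update_of_ne (by omega)]
          exact h5 x hx
        · simp only [Code.run_seq, Code.run_store, Code.run_assign, State.arr_setReg,
            State.arr_setArr_self, Expr.eval, State.reg_setReg, State.reg_setArr, h3,
            OfNat.zero_ne_ofNat, if_false]
          rw [Function.update_of_ne (by omega), Function.update_of_ne (by omega)]
          exact h6
        · rw [List.map_append, encodeCells_append, holds_append, length_encodeCells,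
            List.length_map, List.map_singleton, encodeCells_singleton, hV]
          simp only [Code.run_seq, Code.run_store, Code.run_assign, State.arr_setReg,
            State.arr_setArr_self, Expr.eval, State.reg_setReg, State.reg_setArr, q10, ← hp,
            State.arr_setArr_of_ne _ _ _ (show (3 : ℕ) ≠ 1 by decide)]
          simp only [OfNat.zero_ne_ofNat, if_false, h3, if_true]
          refine ⟨h7.congr fun x hx1 hx2 => ?_, ?_, ?_, trivial⟩
          · rw [length_encodeCells, List.length_map] at hx2
            push_cast at hx2
            rw [Function.update_of_ne (by omega), Function.update_of_ne (by omega)]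
          · push_cast
            rw [Function.update_of_ne (by omega), Function.update_self]
          · push_cast
            rw [Function.update_self]
  obtain ⟨w₁, w₂, e, h1, h2, h3, h4, h5, h6, h7⟩ := key
  have e2 : w₂ = [] := List.length_eq_zero_iff.1 (by omega)
  subst e2
  rw [List.append_nil] at e
  subst e
  have r17' : t₂.reg 17 = o + 1 := (hfr₂.1 17 (by simp [Code.regs, forwardStep])).trans r17
  have r9' : t₂.reg 9 = s.reg 9 := (hfr₂.1 9 (by simp [Code.regs, forwardStep])).trans r9
  have efin : forwardCode.run s = (t₂.setArr 1 (o + 1) w.length).setReg 9 (s.reg 9 + 1) := by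
    have : forwardCode.run s = (Code.store 1 (.reg 17) (.reg 16) ;;
      .assign 9 (.add (.reg 9) (.const 1))).run t₂ := rfl
    rw [this]
    simp [Expr.eval, r17', h4, r9']
  rw [efin]
  refine ⟨by simp [h3], by simp, fun k hk => ?_, ?_, ?_, ?_⟩
  · rw [State.arr_setReg, State.arr_setArr_self, Function.update_of_ne (by omega)]
    exact h5 k hk
  · rw [State.arr_setReg, State.arr_setArr_self, Function.update_of_ne (by omega)]
    exact h6
  · rw [State.arr_setReg, State.arr_setArr_self, Function.update_self]
  · rw [show o + 1 + 1 = o + 2 by ring]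
    refine h7.congr fun k h1 h2 => ?_
    rw [State.arr_setReg, State.arr_setArr_self, Function.update_of_ne (by omega)]

/-- One step of `backwardCode`. -/
def backwardStep : Code :=
  .ite (.eq (.reg 15) (.reg 13)) .skip
    (.assign 10 (.sub (.reg 10) (.const 2)) ;; .store 11 (.reg 10) (.get 2 (.reg 15)) ;;
      .store 11 (.add (.reg 10) (.const 1)) (.get 3 (.reg 15)) ;;
      .assign 15 (.get 10 (.reg 15)) ;; .assign 16 (.add (.reg 16) (.const 1)))

/-- Write the move of the square at vertex `reg 13` against the predecessors to vertex `reg 14` in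
front of array 11, which grows downwards. -/
def backwardCode : Code :=
  .assign 16 (.const 0) ;; .assign 15 (.reg 14) ;;
  .loop 20 4 backwardStep ;;
  .assign 10 (.sub (.reg 10) (.const 2)) ;;
  .store 11 (.reg 10) (.sub (.get 7 (.reg 13)) (.const 1)) ;;
  .store 11 (.add (.reg 10) (.const 1)) (.reg 16) ;; .assign 9 (.add (.reg 9) (.const 1))

/-- Now the square stands at the root and moves against the predecessors. Writing towards smaller
indices reverses the path and also puts the new move in front of the older final moves. The root `v`
is the starting point and not a waypoint, so `z` omits it. -/
theorem backwardCode_spec {s : State} {X : Set ℤ} {N : ℕ} {V : ℤ → Cell} {E : ℤ → ℤ → Prop}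
    {u v o : ℤ} {w : List ℤ} {old : List ℤ} (hg : GridData X N V s)
    (hw : PredPath E (s.arr 10) v u w)
    (hwN : w.length ≤ N) (hu : s.reg 14 = u) (hv : s.reg 13 = v) (ho : s.reg 10 = o)
    (hold : Holds (s.arr 11) o old) :
    ∃ z : List ℤ, u :: w = z ++ [v] ∧
    (backwardCode.run s).reg 10 = o - 2 - 2 * z.length ∧
    (backwardCode.run s).reg 9 = s.reg 9 + 1 ∧
    Holds ((backwardCode.run s).arr 11) (o - 2 - 2 * z.length)
      (((s.arr 7 v - 1) :: (z.length : ℤ) :: encodeCells (z.reverse.map V)) ++ old) := by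
  set P₁ : Code := .assign 16 (.const 0) ;; .assign 15 (.reg 14) with hP₁
  set t₁ := P₁.run s with ht₁
  have hfr₁ : P₁.Frame s t₁ := Code.frame_run _ _
  have r10 : t₁.reg 10 = o := (hfr₁.1 10 (by simp [hP₁, Code.regs])).trans ho
  have r16 : t₁.reg 16 = 0 := by simp [ht₁, hP₁, Expr.eval]
  have r15 : t₁.reg 15 = u := by simp [ht₁, hP₁, Expr.eval, hu]
  have hg₁ : GridData X N V t₁ := hg.of_frame hfr₁ (by simp [hP₁, Code.regs])
    (by simp [hP₁, Code.arrs])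
  have r13 : t₁.reg 13 = v := (hfr₁.1 13 (by simp [hP₁, Code.regs])).trans hv
  have r9 : t₁.reg 9 = s.reg 9 := hfr₁.1 9 (by simp [hP₁, Code.regs])
  have a10 : t₁.arr 10 = s.arr 10 := hfr₁.2 10 (by simp [hP₁, Code.arrs])
  have a7 : t₁.arr 7 = s.arr 7 := hfr₁.2 7 (by simp [hP₁, Code.arrs])
  have a11 : t₁.arr 11 = s.arr 11 := hfr₁.2 11 (by simp [hP₁, Code.arrs])
  set t₂ := (Code.loop 20 4 backwardStep).run t₁ with ht₂
  have hfr₂ : (Code.loop 20 4 backwardStep).Frame t₁ t₂ := Code.frame_run _ _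
  have key : ∃ z w₂, u :: w = z ++ t₂.reg 15 :: w₂ ∧ PredPath E (s.arr 10) v (t₂.reg 15) w₂ ∧
      w₂.length = w.length - N ∧ t₂.reg 10 = o - 2 * z.length ∧ t₂.reg 16 = z.length ∧
      Holds (t₂.arr 11) (o - 2 * z.length) (encodeCells (z.reverse.map V) ++ old) := by
    refine Code.loop_inv (c := 20) (P := backwardStep) hg₁.reg_size
      (fun k t => ∃ z w₂, u :: w = z ++ t.reg 15 :: w₂ ∧ PredPath E (s.arr 10) v (t.reg 15) w₂ ∧
      w₂.length = w.length - k ∧ t.reg 10 = o - 2 * z.length ∧ t.reg 16 = z.length ∧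
      Holds (t.arr 11) (o - 2 * z.length) (encodeCells (z.reverse.map V) ++ old)) ?_ ?_
    · exact ⟨[], w, by simp [r15], by simpa [r15] using hw, by simp, by simp [r10], by simp [r16],
        by simpa [a11, encodeCells] using hold⟩
    · rintro k hk t ht hfr ⟨z, w₂, e, h1, h2, h3, h4, h5⟩
      have q13 : t.reg 13 = v := (hfr.1 13 (by simp [Code.regs, backwardStep])).trans r13
      have q10 : t.arr 10 = s.arr 10 := (hfr.2 10 (by simp [Code.arrs, backwardStep])).trans a10
      have q2 : t.arr 2 = t₁.arr 2 := hfr.2 2 (by simp [Code.arrs, backwardStep])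
      have q3 : t.arr 3 = t₁.arr 3 := hfr.2 3 (by simp [Code.arrs, backwardStep])
      rw [backwardStep, Code.run_ite]
      by_cases hc : t.reg 15 = v
      · rw [if_pos (by simp [Expr.eval, hc, q13])]
        have h1' := h1
        rw [hc] at h1'
        have e2 := h1'.eq_nil
        subst e2
        refine ⟨z, [], by simpa using e, by simpa using h1, ?_, by simp [h3], by simp [h4], h5⟩
        simp only [List.length_nil] at h2 ⊢; omega
      · rw [if_neg (by simp [Expr.eval, hc, q13])]
        obtain ⟨w₃, rfl, h8⟩ := h1.eq_cons hc
        set c := t.reg 15 with hcdef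
        set p := s.arr 10 c with hp
        have hV : V c = (t.arr 2 c, t.arr 3 c) := by rw [hg₁.vertex c, q2, q3]
        refine ⟨z ++ [c], w₃, ?_, ?_, ?_, ?_, ?_, ?_⟩
        · simp [Expr.eval, ← hcdef, e, State.arr_setArr_of_ne _ _ _ (show (10 : ℕ) ≠ 11 by decide),
            q10, ← hp]
        · simpa [Expr.eval, ← hcdef, State.arr_setArr_of_ne _ _ _ (show (10 : ℕ) ≠ 11 by decide),
            q10, ← hp] using h8
        · simp only [List.length_cons] at h2; omega
        · simp [Expr.eval, h3]; ring
        · simp [Expr.eval, h4]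
        · rw [List.reverse_append, List.reverse_singleton, List.singleton_append, List.map_cons,
            encodeCells_cons, hV]
          simp only [Code.run_seq, Code.run_store, Code.run_assign, State.arr_setReg,
            State.arr_setArr_self, Expr.eval, State.reg_setReg, State.reg_setArr,
            State.arr_setArr_of_ne _ _ _ (show (3 : ℕ) ≠ 11 by decide)]
          simp only [Nat.reduceEqDiff, if_false, h3, if_true, ← hcdef]
          refine ⟨?_, ?_, ?_⟩
          · simp only [List.length_append, List.length_singleton]
            push_cast
            rw [Function.update_of_ne (by omega),
              show o - 2 * ((z.length : ℤ) + 1) = o - 2 * z.length - 2 by ring, Function.update_self]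
          · simp only [List.length_append, List.length_singleton]
            push_cast
            rw [show o - 2 * ((z.length : ℤ) + 1) + 1 = o - 2 * z.length - 2 + 1 by ring,
              Function.update_self]
          · have hidx : o - 2 * ((z ++ [c]).length : ℤ) + 1 + 1 = o - 2 * z.length := by
              simp only [List.length_append, List.length_singleton]
              push_cast
              ring
            rw [hidx]
            refine h5.congr fun x hx1 hx2 => ?_
            rw [Function.update_of_ne (by omega), Function.update_of_ne (by omega)]
  obtain ⟨z, w₂, e, h1, h2, h3, h4, h5⟩ := key
  have e2 : w₂ = [] := List.length_eq_zero_iff.1 (by omega)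
  subst e2
  have ev : t₂.reg 15 = v := by
    by_contra hc
    obtain ⟨w₃, h, -⟩ := h1.eq_cons hc
    simp at h
  rw [ev] at e
  have r13' : t₂.reg 13 = v := (hfr₂.1 13 (by simp [Code.regs, backwardStep])).trans r13
  have r9' : t₂.reg 9 = s.reg 9 := (hfr₂.1 9 (by simp [Code.regs, backwardStep])).trans r9
  have a7' : t₂.arr 7 = s.arr 7 := (hfr₂.2 7 (by simp [Code.arrs, backwardStep])).trans a7
  have efin : backwardCode.run s = (Code.assign 10 (.sub (.reg 10) (.const 2)) ;;
      .store 11 (.reg 10) (.sub (.get 7 (.reg 13)) (.const 1)) ;;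
      .store 11 (.add (.reg 10) (.const 1)) (.reg 16) ;;
      .assign 9 (.add (.reg 9) (.const 1))).run t₂ := rfl
  have e11 : (backwardCode.run s).arr 11 = Function.update (Function.update (t₂.arr 11)
      (o - 2 * z.length - 2) (s.arr 7 v - 1)) (o - 2 * z.length - 2 + 1) z.length := by
    rw [efin]
    simp [Expr.eval, h3, h4, r13', a7']
  refine ⟨z, e, ?_, ?_, ?_, ?_, ?_⟩
  · rw [efin]; simp [Expr.eval, h3]; ring
  · rw [efin]; simp [Expr.eval, r9']
  · rw [e11, Function.update_of_ne (by omega),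
      show o - 2 - 2 * (z.length : ℤ) = o - 2 * z.length - 2 by ring, Function.update_self]
  · rw [e11, show o - 2 - 2 * (z.length : ℤ) + 1 = o - 2 * z.length - 2 + 1 by ring,
      Function.update_self]
  · rw [e11, show o - 2 - 2 * (z.length : ℤ) + 1 + 1 = o - 2 * z.length by ring]
    refine h5.congr fun k h1 h2 => ?_
    rw [Function.update_of_ne (by omega), Function.update_of_ne (by omega)]

end SquareReconfig

namespace SquareReconfig
open Relation

/-! ### The elimination algorithm as a loop program -/

/-- The vertices marked 1 in `alive` represent the points of `A`, each once. -/
structure Vertices (N : ℕ) (V : ℤ → Cell) (alive : ℤ → ℤ) (A : Set Cell) : Prop where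
  inj : ∀ p q : ℤ, 0 ≤ p → p < N → alive p = 1 → 0 ≤ q → q < N → alive q = 1 → V p = V q → p = q
  mem : ∀ a, a ∈ A ↔ ∃ q : ℤ, 0 ≤ q ∧ q < N ∧ alive q = 1 ∧ V q = a

/-- The array `fl` holds, at each remaining vertex, the number of the element of `S` that is
positioned there plus 1, and 0 if there is none. -/
def Flags (N : ℕ) (V : ℤ → Cell) (alive fl : ℤ → ℤ) {n : ℕ} (S : Finset (Fin n))
    (pos : Fin n → Cell) : Prop :=
  ∀ q : ℤ, 0 ≤ q → q < N → alive q = 1 → (fl q = 0 ∧ ∀ i ∈ S, pos i ≠ V q) ∨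
    ∃ i ∈ S, pos i = V q ∧ fl q = ((i : ℕ) : ℤ) + 1

section

variable {N : ℕ} {V : ℤ → Cell} {alive fl : ℤ → ℤ} {A : Set Cell}

theorem Vertices.remove (h : Vertices N V alive A) {v : ℤ} (hv : 0 ≤ v ∧ v < N)
    (hva : alive v = 1) : Vertices N V (Function.update alive v 0) (A \ {V v}) := by
  have key : ∀ q, Function.update alive v 0 q = 1 ↔ q ≠ v ∧ alive q = 1 := fun q => by
    by_cases e : q = v
    · subst e; simp
    · simp [e]
  constructor
  · intro p q h1 h2 h3 h4 h5 h6 h7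
    exact h.inj p q h1 h2 ((key p).1 h3).2 h4 h5 ((key q).1 h6).2 h7
  · intro a
    simp only [key]
    rw [Set.mem_sdiff, h.mem, Set.mem_singleton_iff]
    constructor
    · rintro ⟨⟨q, h1, h2, h3, rfl⟩, h4⟩
      exact ⟨q, h1, h2, ⟨fun e => h4 (by rw [e]), h3⟩, rfl⟩
    · rintro ⟨q, h1, h2, ⟨h3, h4⟩, rfl⟩
      exact ⟨⟨q, h1, h2, h4, rfl⟩, fun e => h3 (h.inj q v h1 h2 h4 hv.1 hv.2 hva e)⟩

variable {n : ℕ} {S : Finset (Fin n)} {pos : Fin n → Cell}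

/-- For a partner whose vertex stays in the graph the flag has to be cleared. In `remove_erase` the
vertex itself disappears, and flags of removed vertices are not constrained. -/
theorem Flags.erase (h : Flags N V alive fl S pos) (hV : Vertices N V alive A)
    (hpos : Function.Injective pos) {u : ℤ} (hu : 0 ≤ u ∧ u < N) (hua : alive u = 1) {i : Fin n}
    (hi : pos i = V u) : Flags N V alive (Function.update fl u 0) (S.erase i) pos := by
  intro q h1 h2 h3
  by_cases e : q = u
  · subst e
    refine Or.inl ⟨by simp, fun i' hi' e' => Finset.ne_of_mem_erase hi' (hpos (e'.trans hi.symm))⟩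
  · rw [Function.update_of_ne e]
    rcases h q h1 h2 h3 with ⟨h4, h5⟩ | ⟨i', h4, h5, h6⟩
    · exact Or.inl ⟨h4, fun i' hi' => h5 i' (Finset.mem_of_mem_erase hi')⟩
    · refine Or.inr ⟨i', Finset.mem_erase.2 ⟨?_, h4⟩, h5, h6⟩
      rintro rfl
      exact e (hV.inj q u h1 h2 h3 hu.1 hu.2 hua (h5.symm.trans hi))

theorem Flags.remove (h : Flags N V alive fl S pos) (v : ℤ) :
    Flags N V (Function.update alive v 0) fl S pos := by
  intro q h1 h2 h3
  refine h q h1 h2 ?_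
  by_cases e : q = v
  · subst e; simp at h3
  · rwa [Function.update_of_ne e] at h3

theorem Flags.remove_erase (h : Flags N V alive fl S pos) (hV : Vertices N V alive A)
    {v : ℤ} (hv : 0 ≤ v ∧ v < N) (hva : alive v = 1) {i : Fin n}
    (hi : pos i = V v) : Flags N V (Function.update alive v 0) fl (S.erase i) pos := by
  intro q h1 h2 h3
  have e : q ≠ v := by rintro rfl; simp at h3
  have h3' := h3
  rw [Function.update_of_ne e] at h3'
  rcases h.remove v q h1 h2 h3 with ⟨h4, h5⟩ | ⟨i', h4, h5, h6⟩
  · exact Or.inl ⟨h4, fun i' hi' => h5 i' (Finset.mem_of_mem_erase hi')⟩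
  · refine Or.inr ⟨i', Finset.mem_erase.2 ⟨?_, h4⟩, h5, h6⟩
    rintro rfl
    exact e (hV.inj q v h1 h2 h3' hv.1 hv.2 hva (h5.symm.trans hi))

variable {X : Set ℤ} {flag pred : ℤ → ℤ} {r : ℤ} {l : List ℤ}

theorem SearchTree.alive_of_mem (h : SearchTree (SearchEdge X N V alive flag) pred r l)
    (hr : 0 ≤ r ∧ r < N) (hra : alive r = 1) : ∀ q ∈ l, (0 ≤ q ∧ q < N) ∧ alive q = 1 :=
  h.forall_mem ⟨hr, hra⟩ fun _ _ _ he => ⟨he.1, he.2.1⟩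

theorem SearchTree.gridConn (h : SearchTree (SearchEdge X N V alive flag) pred r l) {B : Set Cell}
    (hB : ∀ q ∈ l, V q ∈ B) : ∀ q ∈ l, GridConn X B (V r) (V q) := by
  induction h with
  | root => intro q hq; rw [List.mem_singleton.1 hq]; exact ReflTransGen.refl
  | @grow l q h1 h2 h3 h4 ih =>
    intro a ha
    have hB' : ∀ q ∈ l, V q ∈ B := fun q hq => hB q (List.mem_cons_of_mem _ hq)
    rcases List.mem_cons.1 ha with rfl | ha
    · exact ReflTransGen.tail (ih hB' _ h3) ⟨hB' _ h3, hB a (by simp), h4.2.2.2⟩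
    · exact ih hB' a ha

/-- Follow a connection from the root: either every vertex on it is found, or the search stopped at
a flagged vertex, which was itself found. Hence a search that meets no flag has seen the whole
component. -/
theorem search_complete (hV : Vertices N V alive A)
    (hcl : ∀ p ∈ l, ∀ q, SearchEdge X N V alive flag p q → q ∈ l) (hr : r ∈ l) {c : Cell}
    (hc : GridConn X A (V r) c) : (∃ q ∈ l, V q = c) ∨ ∃ q ∈ l, flag q ≠ 0 := by
  induction hc with
  | refl => exact Or.inl ⟨r, hr, rfl⟩
  | @tail b c _ h ih =>
    rcases ih with ⟨p, hp, rfl⟩ | ih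
    · by_cases hf : flag p = 0
      · obtain ⟨q, h1, h2, h3, rfl⟩ := (hV.mem c).1 h.2.1
        exact Or.inl ⟨q, hcl p hp q ⟨⟨h1, h2⟩, h3, hf, h.2.2⟩, rfl⟩
      · exact Or.inr ⟨p, hp, hf⟩
    · exact Or.inr ih

/-- The vertex found last is a leaf of the search tree, and the rest of the tree joins all other
vertices of the component to the root. If the root is the only vertex found, nothing else is in its
component. -/
theorem nonCut_last {v : ℤ} (hV : Vertices N V alive A)
    (h : SearchTree (SearchEdge X N V alive flag) pred r (v :: l)) (hr : 0 ≤ r ∧ r < N)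
    (hra : alive r = 1) (hflag : ∀ q, flag q = 0)
    (hcl : ∀ p ∈ v :: l, ∀ q, SearchEdge X N V alive flag p q → q ∈ v :: l) :
    NonCut X A (V v) := by
  have hal := h.alive_of_mem hr hra
  have hA : ∀ q ∈ v :: l, V q ∈ A := fun q hq =>
    (hV.mem _).2 ⟨q, (hal q hq).1.1, (hal q hq).1.2, (hal q hq).2, rfl⟩
  refine nonCut_of_root (r := V r) (fun c hc hcv hrc => ?_) (h.gridConn hA v (by simp))
  rcases search_complete hV hcl h.root_mem hrc with ⟨q, hq, rfl⟩ | ⟨q, _, hq⟩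
  · rcases List.mem_cons.1 hq with rfl | hq'
    · exact absurd rfl hcv
    cases h with
    | root => simp at hq'
    | grow h1 h2 h3 h4 =>
      refine h1.gridConn (B := A \ {V v})
        (fun p hp => ⟨hA p (List.mem_cons_of_mem _ hp), fun e => h2 ?_⟩) q hq'
      have hp' := hal p (List.mem_cons_of_mem _ hp)
      have hv' := hal v (by simp)
      rwa [← hV.inj p v hp'.1.1 hp'.1.2 hp'.2 hv'.1.1 hv'.1.2 hv'.2 e]
  · exact absurd (hflag q) hq

/-- Each predecessor was a vertex from which the search went on, hence unflagged. So the path avoids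
all flagged vertices except possibly the one where it begins. -/
theorem PredPath.chain {q : ℤ} {w : List ℤ}
    (h : PredPath (SearchEdge X N V alive flag) pred r q w) :
    List.IsChain (GridAdj X) (V q :: w.map V) ∧ (w.map V).getLastD (V q) = V r ∧
      ∀ a ∈ w, flag a = 0 := by
  induction h with
  | nil => simp
  | @cons q w h1 h2 h3 ih =>
    refine ⟨?_, ?_, ?_⟩
    · rw [List.map_cons, List.isChain_cons_cons]
      exact ⟨h2.2.2.2.symm, ih.1⟩
    · rw [List.map_cons, List.getLastD_cons]; exact ih.2.1
    · intro a ha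
      rcases List.mem_cons.1 ha with rfl | ha
      · exact h2.2.2.1
      · exact ih.2.2 a ha

end

/-- The memory represents a state of the elimination; the moves made so far are in array 1 and the
final moves in array 11. -/
structure Memory (I : Instance) (X : Set ℤ) (N : ℕ) (V : ℤ → Cell) (A : Set Cell)
    (S T : Finset (Fin I.n)) (M₁ M₂ : List (GridMove I.n)) (s : State) : Prop where
  grid : GridData X N V s
  verts : Vertices N V (s.arr 6) A
  starts : Flags N V (s.arr 6) (s.arr 7) S I.start
  targets : Flags N V (s.arr 6) (s.arr 8) T I.target
  fail : s.reg 8 = 0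
  count : s.reg 9 = (M₁ ++ M₂).length
  outPtr : s.reg 0 = 2 + (encodeMoves M₁).length
  out : Holds (s.arr 1) 2 (encodeMoves M₁)
  backPtr : s.reg 10 = -((encodeMoves M₂).length : ℤ)
  back : Holds (s.arr 11) (s.reg 10) (encodeMoves M₂)
  zero : ∀ q, s.arr 12 q = 0
  len : ∀ m ∈ M₂, m.waypoints.length ≤ N

/-- Bring a square to the target at vertex `reg 13`. -/
def fetchCode : Code :=
  .assign 11 (.reg 13) ;; searchCode 7 ;;
  pickCode 14 (.and (.eq (.get 9 (.reg 20)) (.const 1))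
    (.not (.eq (.get 7 (.reg 20)) (.const 0)))) ;;
  .ite (.lt (.reg 14) (.const 0)) (.assign 8 (.const 1))
    (forwardCode ;; .store 7 (.reg 14) (.const 0))

/-- Let the square at vertex `reg 13` move to a target in the end. -/
def sendCode : Code :=
  .assign 11 (.reg 13) ;; searchCode 8 ;;
  pickCode 14 (.and (.eq (.get 9 (.reg 20)) (.const 1))
    (.not (.eq (.get 8 (.reg 20)) (.const 0)))) ;;
  .ite (.lt (.reg 14) (.const 0)) (.assign 8 (.const 1))
    (backwardCode ;; .store 8 (.reg 14) (.const 0))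

/-- Eliminate a non-cut vertex, if there are vertices left. -/
def stepCode : Code :=
  .ite (.eq (.reg 8) (.const 0))
    (pickCode 11 (.eq (.get 6 (.reg 20)) (.const 1)) ;;
      .ite (.lt (.reg 11) (.const 0)) .skip
        (searchCode 12 ;; .assign 13 (.reg 12) ;;
          .ite (.eq (.get 7 (.reg 13)) (.const 0))
            (.ite (.eq (.get 8 (.reg 13)) (.const 0)) .skip fetchCode)
            (.ite (.eq (.get 8 (.reg 13)) (.const 0)) sendCode .skip) ;;
          .store 6 (.reg 13) (.const 0)))
    .skip

section

variable {I : Instance} {X : Set ℤ} {N : ℕ} {V : ℤ → Cell} {A : Set Cell}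
  {S T : Finset (Fin I.n)} {M₁ M₂ : List (GridMove I.n)} {s : State}

/-- The search from the vertex in register 13 and the choice of a marked vertex in register 14. -/
theorem searchPick_spec (f : ℕ) (hf : f = 7 ∨ f = 8) (hg : GridData X N V s)
    (hV : Vertices N V (s.arr 6) A) {v : ℤ} (hv : s.reg 13 = v)
    (hvN : 0 ≤ v ∧ v < N) (hva : s.arr 6 v = 1) :
    let t := (Code.assign 11 (.reg 13) ;; searchCode f ;;
      pickCode 14 (.and (.eq (.get 9 (.reg 20)) (.const 1))
        (.not (.eq (.get f (.reg 20)) (.const 0))))).run s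
    (t.reg 14 = -1 ∧ ∀ q : ℤ, 0 ≤ q → q < N → s.arr 6 q = 1 → s.arr f q ≠ 0 →
      ¬ GridConn X A (V v) (V q)) ∨
    ∃ u w, t.reg 14 = u ∧ 0 ≤ u ∧ u < N ∧ s.arr 6 u = 1 ∧ s.arr f u ≠ 0 ∧
      PredPath (SearchEdge X N V (s.arr 6) (s.arr f)) (t.arr 10) v u w ∧ w.length ≤ N ∧
      ∀ a ∈ w, (0 ≤ a ∧ a < N) ∧ s.arr 6 a = 1 := by
  intro t
  have hf9 : f ≠ 9 := by omega
  have hf10 : f ≠ 10 := by omega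
  set t₁ := (Code.assign 11 (.reg 13)).run s with ht₁
  have hg₁ : GridData X N V t₁ := hg.frame (by simp [ht₁]) rfl rfl rfl rfl
  obtain ⟨l, h1, h2⟩ := searchCode_spec (s := t₁) (X := X) (N := N) (V := V) (r := v) (f := f)
    (alive := s.arr 6) (flag := s.arr f) hf9 hf10 hg₁ rfl rfl (by simp [ht₁, Expr.eval, hv]) hvN
  set t₂ := (searchCode f).run t₁ with ht₂
  have hfr₂ : (searchCode f).Frame t₁ t₂ := Code.frame_run _ _
  have e4 : t₂.reg 4 = N := (hfr₂.1 4 (by simp [Code.regs, searchCode, growCode])).trans hg₁.reg_size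
  have ef : t₂.arr f = s.arr f :=
    hfr₂.2 f (by simp [Code.arrs, searchCode, growCode, hf9, hf10])
  have hal := h1.tree.alive_of_mem hvN hva
  have ht : t = (pickCode 14 (.and (.eq (.get 9 (.reg 20)) (.const 1))
        (.not (.eq (.get f (.reg 20)) (.const 0))))).run t₂ := rfl
  have h10 : t.arr 10 = t₂.arr 10 := by
    rw [ht]; exact Code.run_arr _ (by simp [Code.arrs, pickCode])
  have hpick := pickCode_spec (s := t₂) (x := 14) (N := N) (P := fun q => q ∈ l ∧ s.arr f q ≠ 0)
    (b := .and (.eq (.get 9 (.reg 20)) (.const 1)) (.not (.eq (.get f (.reg 20)) (.const 0)))) e4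
    (by decide) (by
      intro t' q _ h4 h5 q1 q2
      rw [Test.eval_and, Test.eval_not, Test.eval_eq, Test.eval_eq]
      simp [Expr.eval, h4, h5, ef, h1.reach q q1 q2])
  rcases hpick with ⟨h3, h4⟩ | ⟨u, h3, h4, h5, h6, h7⟩
  · refine Or.inl ⟨h3, fun q q1 q2 q3 q4 hc => ?_⟩
    -- In both cases a flagged vertex was found, and the choice would have succeeded.
    rcases search_complete hV h2 h1.tree.root_mem hc with ⟨p, hp, e⟩ | ⟨p, hp, hpf⟩
    · have hp' := hal p hp
      have := hV.inj p q hp'.1.1 hp'.1.2 hp'.2 q1 q2 q3 e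
      subst this
      exact h4 p q1 q2 ⟨hp, q4⟩
    · exact h4 p (hal p hp).1.1 (hal p hp).1.2 ⟨hp, hpf⟩
  · obtain ⟨w, w1, w2, w3⟩ := h1.tree.exists_predPath u h6
    refine Or.inr ⟨u, w, h3, h4, h5, (hal u h6).2, h7, ?_, ?_, fun a ha => hal a (w3 a ha)⟩
    · rw [h10]; exact w1
    · have := h1.tree.length_le h1.range; omega

theorem Flags.ne_zero_iff {alive fl : ℤ → ℤ} {n : ℕ} {S : Finset (Fin n)} {pos : Fin n → Cell}
    (h : Flags N V alive fl S pos) {q : ℤ} (h1 : 0 ≤ q) (h2 : q < N) (h3 : alive q = 1) :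
    fl q ≠ 0 ↔ ∃ i ∈ S, pos i = V q := by
  rcases h q h1 h2 h3 with ⟨h4, h5⟩ | ⟨i, h4, h5, h6⟩
  · exact iff_of_false (by simp [h4]) fun ⟨i, hi, e⟩ => h5 i hi e
  · exact iff_of_true (by omega) ⟨i, h4, h5⟩

/-- What holds after the vertex `v` has been eliminated. -/
def Eliminated (I : Instance) (X : Set ℤ) (N : ℕ) (V : ℤ → Cell) (A : Set Cell) (t : State) :
    Prop :=
  (t.reg 8 = 1 ∧ ¬ I.Solvable) ∨ ∃ S T M₁ M₂,
    Elimination I X A S T M₁ M₂ ∧ Memory I X N V A S T M₁ M₂ t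

/-- The case of a vertex that is a target but no start. The search from it stops at starts, so the
path from the chosen square avoids every other remaining square. -/
theorem fetch_spec (hX : X.Finite) (hD : Covers X I.domain)
    (hs : ∀ i, I.start i ∈ gridPoints X I.domain) (ht : ∀ i, I.target i ∈ gridPoints X I.domain)
    (hE : Elimination I X A S T M₁ M₂) (hM : Memory I X N V A S T M₁ M₂ s) {v : ℤ}
    (hv : s.reg 13 = v) (hvN : 0 ≤ v ∧ v < N) (hva : s.arr 6 v = 1) (hcut : NonCut X A (V v))
    (hvS : s.arr 7 v = 0) (hvT : s.arr 8 v ≠ 0) :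
    Eliminated I X N V (A \ {V v}) ((fetchCode ;; .store 6 (.reg 13) (.const 0)).run s) := by
  obtain ⟨j, hj, hjv⟩ := (hM.targets.ne_zero_iff hvN.1 hvN.2 hva).1 hvT
  have hsp := searchPick_spec 7 (Or.inl rfl) hM.grid hM.verts hv hvN hva
  set P₁ : Code := .assign 11 (.reg 13) ;; searchCode 7 ;;
    pickCode 14 (.and (.eq (.get 9 (.reg 20)) (.const 1))
      (.not (.eq (.get 7 (.reg 20)) (.const 0)))) with hP₁
  set t₁ := P₁.run s with ht₁
  have hfr : P₁.Frame s t₁ := Code.frame_run _ _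
  have r13 : t₁.reg 13 = v :=
    (hfr.1 13 (by simp [hP₁, Code.regs, searchCode, growCode, pickCode])).trans hv
  have efin : (fetchCode ;; .store 6 (.reg 13) (.const 0)).run s =
    (Code.ite (.lt (.reg 14) (.const 0)) (.assign 8 (.const 1))
      (forwardCode ;; .store 7 (.reg 14) (.const 0)) ;; .store 6 (.reg 13) (.const 0)).run t₁ := rfl
  rw [efin, Code.run_seq, Code.run_ite]
  rcases hsp with ⟨h1, h2⟩ | ⟨u, w, h1, h2, h3, h4, h5, h6, h7, h8⟩
  · rw [if_pos (by simp [Expr.eval, h1])]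
    -- No start was found although solvability would provide one in the same component.
    refine Or.inl ⟨by simp [Expr.eval], fun hI => ?_⟩
    obtain ⟨i, hi, hc⟩ := hE.exists_start hX hD hs ht hI hj
    obtain ⟨q, q1, q2, q3, q4⟩ := (hM.verts.mem _).1 (hE.start_mem i hi)
    refine h2 q q1 q2 q3 ((hM.starts.ne_zero_iff q1 q2 q3).2 ⟨i, hi, q4.symm⟩) ?_
    rw [← hjv, q4]; exact hc
  · rw [if_neg (by simp [Expr.eval, h1]; omega)]
    rw [Code.run_seq]
    have hg₁ : GridData X N V t₁ := hM.grid.of_frame hfr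
      (by simp [hP₁, Code.regs, searchCode, growCode, pickCode])
      (by simp [hP₁, Code.arrs, searchCode, growCode, pickCode])
    have e0 : t₁.reg 0 = 2 + (encodeMoves M₁).length :=
      (hfr.1 0 (by simp [hP₁, Code.regs, searchCode, growCode, pickCode])).trans hM.outPtr
    obtain ⟨f1, f2, f3, f4⟩ := forwardCode_spec hg₁ h6 h7 h1 r13 e0
    set t₂ := forwardCode.run t₁ with ht₂
    have hfr₂ : forwardCode.Frame t₁ t₂ := Code.frame_run _ _
    have k7 : t₁.arr 7 = s.arr 7 :=
      hfr.2 7 (by simp [hP₁, Code.arrs, searchCode, growCode, pickCode])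
    obtain ⟨i, hi, hiu, hifl⟩ : ∃ i ∈ S, I.start i = V u ∧ s.arr 7 u = ((i : ℕ) : ℤ) + 1 :=
      (hM.starts u h2 h3 h4).resolve_left fun h => h5 h.1
    obtain ⟨c1, c2, c3⟩ := h6.chain
    have huv : u ≠ v := by rintro rfl; exact h5 hvS
    have hwne : w ≠ [] := by
      obtain ⟨w', e, -⟩ := h6.eq_cons huv
      simp [e]
    have hE' : Elimination I X (A \ {V v}) (S.erase i) (T.erase j) (M₁ ++ [⟨i, w.map V⟩]) M₂ := by
      rw [← hjv]
      refine hE.forward hD hi hj (by simpa using hwne) (by rw [hiu]; exact c1)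
        (by rw [hiu, hjv]; exact c2) ?_ (by rw [hjv]; exact hcut)
      intro a ha
      obtain ⟨q, hq, rfl⟩ := List.mem_map.1 ha
      obtain ⟨⟨q1, q2⟩, q3⟩ := h8 q hq
      refine ⟨(hM.verts.mem _).2 ⟨q, q1, q2, q3, rfl⟩, fun i' hi' e => ?_⟩
      exact (hM.starts.ne_zero_iff q1 q2 q3).2 ⟨i', hi', e⟩ (c3 q hq)
    refine Or.inr ⟨_, _, _, _, hE', ?_⟩
    have x14 : t₂.reg 14 = u := (hfr₂.1 14 (by simp [Code.regs, forwardCode, forwardStep])).trans h1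
    have x13 : t₂.reg 13 = v := (hfr₂.1 13 (by simp [Code.regs, forwardCode, forwardStep])).trans r13
    have key : ∀ a, a ≠ 1 → a ≠ 9 → a ≠ 10 → t₂.arr a = s.arr a := fun a h1 h2 h3 =>
      (hfr₂.2 a (by simp [Code.arrs, forwardCode, forwardStep, h1])).trans
        (hfr.2 a (by simp [hP₁, Code.arrs, searchCode, growCode, pickCode, h2, h3]))
    have e1 : t₁.arr 1 = s.arr 1 :=
      hfr.2 1 (by simp [hP₁, Code.arrs, searchCode, growCode, pickCode])
    have e6 : t₂.arr 6 = s.arr 6 := key 6 (by decide) (by decide) (by decide)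
    have e7 : t₂.arr 7 = s.arr 7 := key 7 (by decide) (by decide) (by decide)
    have e8 : t₂.arr 8 = s.arr 8 := key 8 (by decide) (by decide) (by decide)
    have e11 : t₂.arr 11 = s.arr 11 := key 11 (by decide) (by decide) (by decide)
    have e12 : t₂.arr 12 = s.arr 12 := key 12 (by decide) (by decide) (by decide)
    have g8 : t₂.reg 8 = s.reg 8 :=
      (hfr₂.1 8 (by simp [Code.regs, forwardCode, forwardStep])).trans
      (hfr.1 8 (by simp [hP₁, Code.regs, searchCode, growCode, pickCode]))
    have g9 : t₁.reg 9 = s.reg 9 :=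
      hfr.1 9 (by simp [hP₁, Code.regs, searchCode, growCode, pickCode])
    have g10 : t₂.reg 10 = s.reg 10 :=
      (hfr₂.1 10 (by simp [Code.regs, forwardCode, forwardStep])).trans
      (hfr.1 10 (by simp [hP₁, Code.regs, searchCode, growCode, pickCode]))
    have hg₂ : GridData X N V t₂ := hg₁.of_frame hfr₂ (by simp [Code.regs, forwardCode, forwardStep])
      (by simp [Code.arrs, forwardCode, forwardStep])
    set t₃ := (Code.store 6 (.reg 13) (.const 0)).run ((Code.store 7 (.reg 14) (.const 0)).run t₂)
      with ht₃
    have y6 : t₃.arr 6 = Function.update (s.arr 6) v 0 := by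
      simp [ht₃, Expr.eval, x13, State.arr_setArr, e6]
    have y7 : t₃.arr 7 = Function.update (s.arr 7) u 0 := by
      simp [ht₃, Expr.eval, x14, State.arr_setArr, e7]
    have y : ∀ a, a ≠ 6 → a ≠ 7 → t₃.arr a = t₂.arr a := fun a h1 h2 => by
      simp [ht₃, State.arr_setArr, h1, h2]
    have z : ∀ x, t₃.reg x = t₂.reg x := fun x => rfl
    have henc : encodeMoves (M₁ ++ [(⟨i, w.map V⟩ : GridMove I.n)]) = encodeMoves M₁ ++
        (((i : ℕ) : ℤ) :: (w.length : ℤ) :: encodeCells (w.map V)) := by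
      simp [encodeMoves]
    exact
    { grid := hg₂.frame (z 4) (y 2 (by decide) (by decide)) (y 3 (by decide) (by decide))
        (y 4 (by decide) (by decide)) (y 5 (by decide) (by decide))
      verts := by rw [y6]; exact hM.verts.remove hvN hva
      starts := by
        rw [y6, y7]
        exact (hM.starts.erase hM.verts I.start_injective ⟨h2, h3⟩ h4 hiu).remove v
      targets := by
        rw [y6, y 8 (by decide) (by decide), e8]
        exact hM.targets.remove_erase hM.verts hvN hva hjv
      fail := by rw [z, g8, hM.fail]
      count := by rw [z, f2, g9, hM.count]; simp; ring
      outPtr := by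
        rw [z, f1, henc]
        simp only [List.length_append, List.length_cons, length_encodeCells, List.length_map]
        push_cast; ring
      out := by
        rw [y 1 (by decide) (by decide), henc, holds_append]
        refine ⟨hM.out.congr fun k k1 k2 => ?_, ?_⟩
        · rw [f3 k k2, e1]
        · rw [k7, hifl, add_sub_cancel_right] at f4
          exact f4
      backPtr := by rw [z, g10]; exact hM.backPtr
      back := by rw [y 11 (by decide) (by decide), z, g10, e11]; exact hM.back
      zero := by rw [y 12 (by decide) (by decide), e12]; exact hM.zero
      len := hM.len }

/-- The case of a vertex that is a start but no target, dual to `fetch_spec`: the search stops at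
targets, and its path is used in the opposite direction. -/
theorem send_spec (hX : X.Finite) (hD : Covers X I.domain)
    (hs : ∀ i, I.start i ∈ gridPoints X I.domain) (ht : ∀ i, I.target i ∈ gridPoints X I.domain)
    (hE : Elimination I X A S T M₁ M₂) (hM : Memory I X N V A S T M₁ M₂ s) {v : ℤ}
    (hv : s.reg 13 = v) (hvN : 0 ≤ v ∧ v < N) (hva : s.arr 6 v = 1) (hcut : NonCut X A (V v))
    (hvS : s.arr 7 v ≠ 0) (hvT : s.arr 8 v = 0) :
    Eliminated I X N V (A \ {V v}) ((sendCode ;; .store 6 (.reg 13) (.const 0)).run s) := by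
  obtain ⟨i, hi, hiv, hifl⟩ : ∃ i ∈ S, I.start i = V v ∧ s.arr 7 v = ((i : ℕ) : ℤ) + 1 :=
    (hM.starts v hvN.1 hvN.2 hva).resolve_left fun h => hvS h.1
  have hsp := searchPick_spec 8 (Or.inr rfl) hM.grid hM.verts hv hvN hva
  set P₁ : Code := .assign 11 (.reg 13) ;; searchCode 8 ;;
    pickCode 14 (.and (.eq (.get 9 (.reg 20)) (.const 1))
      (.not (.eq (.get 8 (.reg 20)) (.const 0)))) with hP₁
  set t₁ := P₁.run s with ht₁
  have hfr : P₁.Frame s t₁ := Code.frame_run _ _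
  have r13 : t₁.reg 13 = v :=
    (hfr.1 13 (by simp [hP₁, Code.regs, searchCode, growCode, pickCode])).trans hv
  have efin : (sendCode ;; .store 6 (.reg 13) (.const 0)).run s =
    (Code.ite (.lt (.reg 14) (.const 0)) (.assign 8 (.const 1))
      (backwardCode ;; .store 8 (.reg 14) (.const 0)) ;; .store 6 (.reg 13) (.const 0)).run t₁ := rfl
  rw [efin, Code.run_seq, Code.run_ite]
  rcases hsp with ⟨h1, h2⟩ | ⟨u, w, h1, h2, h3, h4, h5, h6, h7, h8⟩
  · rw [if_pos (by simp [Expr.eval, h1])]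
    refine Or.inl ⟨by simp [Expr.eval], fun hI => ?_⟩
    obtain ⟨j, hj, hc⟩ := hE.exists_target hX hD hs ht hI hi
    obtain ⟨q, q1, q2, q3, q4⟩ := (hM.verts.mem _).1 (hE.target_mem j hj)
    refine h2 q q1 q2 q3 ((hM.targets.ne_zero_iff q1 q2 q3).2 ⟨j, hj, q4.symm⟩) ?_
    rw [← hiv, q4]; exact hc
  · rw [if_neg (by simp [Expr.eval, h1]; omega)]
    rw [Code.run_seq]
    have hg₁ : GridData X N V t₁ := hM.grid.of_frame hfr
      (by simp [hP₁, Code.regs, searchCode, growCode, pickCode])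
      (by simp [hP₁, Code.arrs, searchCode, growCode, pickCode])
    have e10 : t₁.reg 10 = s.reg 10 :=
      hfr.1 10 (by simp [hP₁, Code.regs, searchCode, growCode, pickCode])
    have e11 : t₁.arr 11 = s.arr 11 :=
      hfr.2 11 (by simp [hP₁, Code.arrs, searchCode, growCode, pickCode])
    obtain ⟨z, f0, f1, f2, f3⟩ := backwardCode_spec hg₁ h6 h7 h1 r13 e10
      (by rw [e11]; exact hM.back)
    set t₂ := backwardCode.run t₁ with ht₂
    have hfr₂ : backwardCode.Frame t₁ t₂ := Code.frame_run _ _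
    have k7 : t₁.arr 7 = s.arr 7 :=
      hfr.2 7 (by simp [hP₁, Code.arrs, searchCode, growCode, pickCode])
    obtain ⟨j, hj, hju⟩ := (hM.targets.ne_zero_iff h2 h3 h4).1 h5
    obtain ⟨c1, c2, c3⟩ := h6.chain
    have huv : u ≠ v := by rintro rfl; exact h5 hvT
    obtain ⟨z', rfl⟩ : ∃ z', z = u :: z' := by
      cases z with
      | nil => simp only [List.nil_append, List.cons.injEq] at f0; exact absurd f0.1 huv
      | cons a z' => exact ⟨z', by simp only [List.cons_append, List.cons.injEq] at f0; rw [f0.1]⟩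
    have hw : w = z' ++ [v] := by simpa using f0
    have hlen : (u :: z').length ≤ N := by
      rw [hw] at h7; simpa using h7
    have hE' : Elimination I X (A \ {V v}) (S.erase i) (T.erase j) M₁
        (⟨i, ((u :: z').reverse).map V⟩ :: M₂) := by
      rw [← hiv]
      refine hE.backward hD hi hj (by simp) ?_ ?_ ?_ ?_ (by rw [hiv]; exact hcut)
      -- The waypoints are the reversed search path without `v`; adjacency is symmetric, so the
      -- chain can be reversed.
      · have hr : (V u :: w.map V).reverse = I.start i :: ((u :: z').reverse).map V := by
          rw [hw, hiv]; simp
        rw [← hr, List.isChain_reverse]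
        exact c1.imp fun _ _ h => h.symm
      · rw [List.reverse_cons, List.map_append, List.map_singleton, hju,
          List.getLastD_eq_getLast?, List.getLast?_append]
        rfl
      · intro a ha
        obtain ⟨q, hq, rfl⟩ := List.mem_map.1 ha
        rw [List.mem_reverse] at hq
        rcases List.mem_cons.1 hq with rfl | hq
        · refine ⟨(hM.verts.mem _).2 ⟨q, h2, h3, h4, rfl⟩, fun j' hj' e => ?_⟩
          exact Finset.ne_of_mem_erase hj' (I.target_injective (e.trans hju.symm))
        · have hqw : q ∈ w := by rw [hw]; simp [hq]
          obtain ⟨⟨q1, q2⟩, q3⟩ := h8 q hqw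
          refine ⟨(hM.verts.mem _).2 ⟨q, q1, q2, q3, rfl⟩, fun j' hj' e => ?_⟩
          exact (hM.targets.ne_zero_iff q1 q2 q3).2 ⟨j', Finset.mem_of_mem_erase hj', e⟩ (c3 q hqw)
      · intro j' hj' e
        exact (hM.targets.ne_zero_iff hvN.1 hvN.2 hva).2 ⟨j', hj', e.trans hiv⟩ hvT
    refine Or.inr ⟨_, _, _, _, hE', ?_⟩
    have x14 : t₂.reg 14 = u :=
      (hfr₂.1 14 (by simp [Code.regs, backwardCode, backwardStep])).trans h1
    have x13 : t₂.reg 13 = v :=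
      (hfr₂.1 13 (by simp [Code.regs, backwardCode, backwardStep])).trans r13
    have key : ∀ a, a ≠ 11 → a ≠ 9 → a ≠ 10 → t₂.arr a = s.arr a := fun a h1 h2 h3 =>
      (hfr₂.2 a (by simp [Code.arrs, backwardCode, backwardStep, h1])).trans
        (hfr.2 a (by simp [hP₁, Code.arrs, searchCode, growCode, pickCode, h2, h3]))
    have e1 : t₂.arr 1 = s.arr 1 := key 1 (by decide) (by decide) (by decide)
    have e6 : t₂.arr 6 = s.arr 6 := key 6 (by decide) (by decide) (by decide)
    have e7 : t₂.arr 7 = s.arr 7 := key 7 (by decide) (by decide) (by decide)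
    have e8 : t₂.arr 8 = s.arr 8 := key 8 (by decide) (by decide) (by decide)
    have e12 : t₂.arr 12 = s.arr 12 := key 12 (by decide) (by decide) (by decide)
    have g8 : t₂.reg 8 = s.reg 8 :=
      (hfr₂.1 8 (by simp [Code.regs, backwardCode, backwardStep])).trans
      (hfr.1 8 (by simp [hP₁, Code.regs, searchCode, growCode, pickCode]))
    have g9 : t₁.reg 9 = s.reg 9 :=
      hfr.1 9 (by simp [hP₁, Code.regs, searchCode, growCode, pickCode])
    have g0 : t₂.reg 0 = s.reg 0 :=
      (hfr₂.1 0 (by simp [Code.regs, backwardCode, backwardStep])).trans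
      (hfr.1 0 (by simp [hP₁, Code.regs, searchCode, growCode, pickCode]))
    have hg₂ : GridData X N V t₂ := hg₁.of_frame hfr₂
      (by simp [Code.regs, backwardCode, backwardStep])
      (by simp [Code.arrs, backwardCode, backwardStep])
    set t₃ := (Code.store 6 (.reg 13) (.const 0)).run ((Code.store 8 (.reg 14) (.const 0)).run t₂)
      with ht₃
    have y6 : t₃.arr 6 = Function.update (s.arr 6) v 0 := by
      simp [ht₃, Expr.eval, x13, State.arr_setArr, e6]
    have y8 : t₃.arr 8 = Function.update (s.arr 8) u 0 := by
      simp [ht₃, Expr.eval, x14, State.arr_setArr, e8]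
    have y : ∀ a, a ≠ 6 → a ≠ 8 → t₃.arr a = t₂.arr a := fun a h1 h2 => by
      simp [ht₃, State.arr_setArr, h1, h2]
    have z : ∀ x, t₃.reg x = t₂.reg x := fun x => rfl
    rw [k7, hifl, add_sub_cancel_right] at f3
    have henc : encodeMoves ((⟨i, ((u :: z').reverse).map V⟩ : GridMove I.n) :: M₂) =
        (((i : ℕ) : ℤ) :: ((u :: z').length : ℤ) :: encodeCells (((u :: z').reverse).map V)) ++
          encodeMoves M₂ := by
      rw [encodeMoves_cons]
      simp only [List.length_map, List.length_reverse]
    have hptr : t₂.reg 10 = s.reg 10 - 2 - 2 * (u :: z').length := f1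
    exact
    { grid := hg₂.frame (z 4) (y 2 (by decide) (by decide)) (y 3 (by decide) (by decide))
        (y 4 (by decide) (by decide)) (y 5 (by decide) (by decide))
      verts := by rw [y6]; exact hM.verts.remove hvN hva
      starts := by
        rw [y6, y 7 (by decide) (by decide), e7]
        exact hM.starts.remove_erase hM.verts hvN hva hiv
      targets := by
        rw [y6, y8]
        exact (hM.targets.erase hM.verts I.target_injective ⟨h2, h3⟩ h4 hju).remove v
      fail := by rw [z, g8, hM.fail]
      count := by rw [z, f2, g9, hM.count]; simp; ring
      outPtr := by rw [z, g0]; exact hM.outPtr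
      out := by rw [y 1 (by decide) (by decide), e1]; exact hM.out
      backPtr := by
        rw [z, hptr, hM.backPtr, henc]
        simp only [List.length_append, List.length_cons, length_encodeCells, List.length_map,
          List.length_reverse]
        push_cast; ring
      back := by rw [y 11 (by decide) (by decide), z, hptr, henc]; exact f3
      zero := by rw [y 12 (by decide) (by decide), e12]; exact hM.zero
      len := by
        intro m hm
        rcases List.mem_cons.1 hm with rfl | hm
        · simpa using hlen
        · exact hM.len m hm }

end

end SquareReconfig

namespace SquareReconfig
open Relation

/-! ### One elimination step and the loop over all vertices. -/

section

variable {I : Instance} {X : Set ℤ} {N : ℕ} {V : ℤ → Cell} {A : Set Cell}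
  {S T : Finset (Fin I.n)} {M₁ M₂ : List (GridMove I.n)} {s : State}

theorem Memory.congr {t : State} (h : Memory I X N V A S T M₁ M₂ s)
    (hr : ∀ x ∈ [0, 4, 8, 9, 10], t.reg x = s.reg x)
    (ha : ∀ a ∈ [1, 2, 3, 4, 5, 6, 7, 8, 11, 12], t.arr a = s.arr a) :
    Memory I X N V A S T M₁ M₂ t := by
  simp only [List.mem_cons, List.not_mem_nil, or_false, forall_eq_or_imp, forall_eq] at hr ha
  obtain ⟨r0, r4, r8, r9, r10⟩ := hr
  obtain ⟨a1, a2, a3, a4, a5, a6, a7, a8, a11, a12⟩ := ha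
  exact ⟨h.grid.frame r4 a2 a3 a4 a5, a6 ▸ h.verts, by rw [a6, a7]; exact h.starts,
    by rw [a6, a8]; exact h.targets, r8.trans h.fail, r9.trans h.count, r0.trans h.outPtr,
    a1 ▸ h.out, r10.trans h.backPtr, by rw [a11, r10]; exact h.back, a12 ▸ h.zero, h.len⟩

theorem Memory.of_frame {P : Code} {t : State} (h : Memory I X N V A S T M₁ M₂ s)
    (hf : P.Frame s t) (hr : ∀ x ∈ [0, 4, 8, 9, 10], x ∉ P.regs)
    (ha : ∀ a ∈ [1, 2, 3, 4, 5, 6, 7, 8, 11, 12], a ∉ P.arrs) :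
    Memory I X N V A S T M₁ M₂ t :=
  h.congr (fun x hx => hf.1 x (hr x hx)) fun a hx => hf.2 a (ha a hx)

theorem Memory.remove (h : Memory I X N V A S T M₁ M₂ s) {v : ℤ} (hvN : 0 ≤ v ∧ v < N)
    (hva : s.arr 6 v = 1) {S' T' : Finset (Fin I.n)}
    (hS : S' = S ∨ ∃ i, I.start i = V v ∧ S' = S.erase i)
    (hT : T' = T ∨ ∃ j, I.target j = V v ∧ T' = T.erase j) :
    Memory I X N V (A \ {V v}) S' T' M₁ M₂ (s.setArr 6 v 0) := by
  have e6 : (s.setArr 6 v 0).arr 6 = Function.update (s.arr 6) v 0 := by simp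
  have e : ∀ a, a ≠ 6 → (s.setArr 6 v 0).arr a = s.arr a := fun a ha =>
    State.arr_setArr_of_ne _ _ _ ha
  refine ⟨h.grid.frame rfl (e 2 (by decide)) (e 3 (by decide)) (e 4 (by decide)) (e 5 (by decide)),
    by rw [e6]; exact h.verts.remove hvN hva, ?_, ?_, h.fail, h.count, h.outPtr,
    by rw [e 1 (by decide)]; exact h.out, h.backPtr, by rw [e 11 (by decide)]; exact h.back,
    by rw [e 12 (by decide)]; exact h.zero, h.len⟩
  · rw [e6, e 7 (by decide)]
    rcases hS with rfl | ⟨i, hi, rfl⟩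
    · exact h.starts.remove v
    · exact h.starts.remove_erase h.verts hvN hva hi
  · rw [e6, e 8 (by decide)]
    rcases hT with rfl | ⟨i, hi, rfl⟩
    · exact h.targets.remove v
    · exact h.targets.remove_erase h.verts hvN hva hi

theorem Vertices.finite {alive : ℤ → ℤ} (h : Vertices N V alive A) : A.Finite :=
  ((Set.finite_Ico (0 : ℤ) N).image V).subset fun a ha => by
    obtain ⟨q, h1, h2, _, rfl⟩ := (h.mem a).1 ha
    exact ⟨q, ⟨h1, h2⟩, rfl⟩

theorem Vertices.ncard_le {alive : ℤ → ℤ} (h : Vertices N V alive A) : A.ncard ≤ N := by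
  have h1 : A ⊆ V '' (Set.Ico (0 : ℤ) N) := fun a ha => by
    obtain ⟨q, h1, h2, _, rfl⟩ := (h.mem a).1 ha
    exact ⟨q, ⟨h1, h2⟩, rfl⟩
  refine (Set.ncard_le_ncard h1 ((Set.finite_Ico (0 : ℤ) N).image V)).trans
    ((Set.ncard_image_le (Set.finite_Ico (0 : ℤ) N)).trans ?_)
  rw [← Finset.coe_Ico, Set.ncard_coe_finset]
  simp

/-- Array 12 is zero everywhere, so the first search is unrestricted and its last vertex is not a
cut vertex. The four combinations of the two flags at this vertex correspond to `skip`, `forward`,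
`backward` and `stay`. -/
theorem stepCode_spec (hX : X.Finite) (hD : Covers X I.domain)
    (hs : ∀ i, I.start i ∈ gridPoints X I.domain) (ht : ∀ i, I.target i ∈ gridPoints X I.domain)
    (hN : s.reg 4 = N) (h : Eliminated I X N V A s) :
    ∃ A', (A'.Finite ∧ A'.ncard ≤ A.ncard - 1) ∧ Eliminated I X N V A' (stepCode.run s) := by
  rcases h with ⟨h1, h2⟩ | ⟨S, T, M₁, M₂, hE, hM⟩
  · refine ⟨∅, by simp, Or.inl ⟨?_, h2⟩⟩
    rw [stepCode, Code.run_ite, if_neg (by simp [Expr.eval, h1])]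
    exact h1
  rw [stepCode, Code.run_ite, if_pos (by simp [Expr.eval, hM.fail]), Code.run_seq]
  have hpick := pickCode_spec (s := s) (x := 11) (N := N) (P := fun q => s.arr 6 q = 1)
    (b := .eq (.get 6 (.reg 20)) (.const 1)) hN (by decide) (by
      intro t q _ h4 h5 q1 q2
      simp [Expr.eval, h4, h5])
  set t₁ := (pickCode 11 (.eq (.get 6 (.reg 20)) (.const 1))).run s with ht₁
  have hfr₁ : (pickCode 11 (.eq (.get 6 (.reg 20)) (.const 1))).Frame s t₁ := Code.frame_run _ _
  have hM₁ : Memory I X N V A S T M₁ M₂ t₁ := hM.of_frame hfr₁ (by simp [Code.regs, pickCode])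
    (by simp [Code.arrs, pickCode])
  have e6 : t₁.arr 6 = s.arr 6 := hfr₁.2 6 (by simp [Code.arrs, pickCode])
  rcases hpick with ⟨h1, h2⟩ | ⟨r, h1, h2, h3, h4⟩
  · rw [Code.run_ite, if_pos (by simp [Expr.eval, h1])]
    have hA : A = ∅ := by
      rw [Set.eq_empty_iff_forall_notMem]
      intro a ha
      obtain ⟨q, q1, q2, q3, _⟩ := (hM.verts.mem a).1 ha
      exact h2 q q1 q2 q3
    exact ⟨A, ⟨by simp [hA], by simp [hA]⟩, Or.inr ⟨S, T, M₁, M₂, hE, hM₁⟩⟩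
  rw [Code.run_ite, if_neg (by simp [Expr.eval, h1]; omega)]
  set P₂ : Code := searchCode 12 ;; .assign 13 (.reg 12) with hP₂
  obtain ⟨l, i1, i2⟩ := searchCode_spec (s := t₁) (f := 12) (by decide) (by decide) hM₁.grid rfl rfl
    h1 ⟨h2, h3⟩
  set t₂ := P₂.run t₁ with ht₂
  have hfr₂ : P₂.Frame t₁ t₂ := Code.frame_run _ _
  have hM₂ : Memory I X N V A S T M₁ M₂ t₂ := hM₁.of_frame hfr₂
    (by simp [hP₂, Code.regs, searchCode, growCode])
    (by simp [hP₂, Code.arrs, searchCode, growCode])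
  have e6' : t₂.arr 6 = t₁.arr 6 := hfr₂.2 6 (by simp [hP₂, Code.arrs, searchCode, growCode])
  have htree := i1.tree
  have hhead := i1.last
  have hr13 : t₂.reg 13 = ((searchCode 12).run t₁).reg 12 := by simp [ht₂, hP₂, Expr.eval]
  obtain ⟨v, l', rfl⟩ : ∃ v l', l = v :: l' := by
    cases l with
    | nil => simp at hhead
    | cons v l' => exact ⟨v, l', rfl⟩
  have hv : t₂.reg 13 = v := by rw [hr13]; simpa using hhead.symm
  have hal := htree.alive_of_mem ⟨h2, h3⟩ (by rw [e6]; exact h4) v (by simp)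
  have hcut : NonCut X A (V v) := nonCut_last hM₁.verts htree ⟨h2, h3⟩ (by rw [e6]; exact h4)
    hM₁.zero i2
  have hva : t₂.arr 6 v = 1 := by rw [e6']; exact hal.2
  have hvA : V v ∈ A := (hM₂.verts.mem _).2 ⟨v, hal.1.1, hal.1.2, hva, rfl⟩
  have hfin := hM.verts.finite
  refine ⟨A \ {V v}, ⟨hfin.sdiff, ?_⟩, ?_⟩
  · rw [Set.ncard_sdiff_singleton_of_mem hvA]
  have erun : ((searchCode 12 ;; .assign 13 (.reg 12) ;;
          .ite (.eq (.get 7 (.reg 13)) (.const 0))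
            (.ite (.eq (.get 8 (.reg 13)) (.const 0)) .skip fetchCode)
            (.ite (.eq (.get 8 (.reg 13)) (.const 0)) sendCode .skip) ;;
          .store 6 (.reg 13) (.const 0)) : Code).run t₁ =
      ((Code.ite (.eq (.get 7 (.reg 13)) (.const 0))
            (.ite (.eq (.get 8 (.reg 13)) (.const 0)) .skip fetchCode)
            (.ite (.eq (.get 8 (.reg 13)) (.const 0)) sendCode .skip)) ;;
          .store 6 (.reg 13) (.const 0)).run t₂ := rfl
  rw [erun, Code.run_seq, Code.run_ite]
  have estore : (Code.store 6 (.reg 13) (.const 0)).run t₂ = t₂.setArr 6 v 0 := by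
    simp [Expr.eval, hv]
  by_cases c7 : t₂.arr 7 v = 0
  · rw [if_pos (by simp [Expr.eval, hv, c7]), Code.run_ite]
    have nS : ∀ i ∈ S, I.start i ≠ V v := fun i hi e =>
      (hM₂.starts.ne_zero_iff hal.1.1 hal.1.2 hva).2 ⟨i, hi, e⟩ c7
    by_cases c8 : t₂.arr 8 v = 0
    · rw [if_pos (by simp [Expr.eval, hv, c8]), Code.run_skip, estore]
      have nT : ∀ i ∈ T, I.target i ≠ V v := fun i hi e =>
        (hM₂.targets.ne_zero_iff hal.1.1 hal.1.2 hva).2 ⟨i, hi, e⟩ c8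
      exact Or.inr ⟨S, T, M₁, M₂, hE.skip hcut nS nT,
        hM₂.remove hal.1 hva (Or.inl rfl) (Or.inl rfl)⟩
    · rw [if_neg (by simp [Expr.eval, hv, c8])]
      exact fetch_spec hX hD hs ht hE hM₂ hv hal.1 hva hcut c7 c8
  · rw [if_neg (by simp [Expr.eval, hv, c7]), Code.run_ite]
    by_cases c8 : t₂.arr 8 v = 0
    · rw [if_pos (by simp [Expr.eval, hv, c8])]
      exact send_spec hX hD hs ht hE hM₂ hv hal.1 hva hcut c7 c8
    · rw [if_neg (by simp [Expr.eval, hv, c8]), Code.run_skip, estore]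
      obtain ⟨i, hi, hiv⟩ := (hM₂.starts.ne_zero_iff hal.1.1 hal.1.2 hva).1 c7
      obtain ⟨j, hj, hjv⟩ := (hM₂.targets.ne_zero_iff hal.1.1 hal.1.2 hva).1 c8
      have hst := hE.stay hi hj (hiv.trans hjv.symm) (hiv ▸ hcut)
      rw [hiv] at hst
      exact Or.inr ⟨S.erase i, T.erase j, M₁, M₂, hst,
        hM₂.remove hal.1 hva (Or.inr ⟨i, hiv, rfl⟩) (Or.inr ⟨j, hjv, rfl⟩)⟩

theorem Eliminated.setReg (h : Eliminated I X N V A s) {c : ℕ} (hc : c ∉ [0, 4, 8, 9, 10]) (v : ℤ) :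
    Eliminated I X N V A (s.setReg c v) := by
  have key : ∀ x ∈ [0, 4, 8, 9, 10], (s.setReg c v).reg x = s.reg x := fun x hx => by
    rw [State.reg_setReg, if_neg]; rintro rfl; exact hc hx
  rcases h with ⟨h1, h2⟩ | ⟨S, T, M₁, M₂, hE, hM⟩
  · exact Or.inl ⟨(key 8 (by simp)).trans h1, h2⟩
  · exact Or.inr ⟨S, T, M₁, M₂, hE, hM.congr key fun _ _ => rfl⟩

/-- At most `N` vertices remain initially and each round removes one while there are any, so after
`N` rounds either none is left or failure has been recorded. -/
theorem stepLoop_spec (hX : X.Finite) (hD : Covers X I.domain)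
    (hs : ∀ i, I.start i ∈ gridPoints X I.domain) (ht : ∀ i, I.target i ∈ gridPoints X I.domain)
    (hE : Elimination I X A S T M₁ M₂) (hM : Memory I X N V A S T M₁ M₂ s) :
    Eliminated I X N V ∅ ((Code.loop 23 4 stepCode).run s) := by
  have h4 : 4 ∉ (Code.loop 23 4 stepCode).regs := by
    simp [Code.regs, stepCode, fetchCode, sendCode, searchCode, growCode, pickCode, forwardCode,
      forwardStep, backwardCode, backwardStep]
  have key := Code.loop_inv (c := 23) (P := stepCode) hM.grid.reg_size
    (fun k t => ∃ A : Set Cell, (A.Finite ∧ A.ncard ≤ N - k) ∧ Eliminated I X N V A t)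
    ⟨A, ⟨hM.verts.finite, hM.verts.ncard_le⟩,
      Eliminated.setReg (Or.inr ⟨S, T, M₁, M₂, hE, hM⟩) (by decide) _⟩ ?_
  · obtain ⟨A', ⟨h1, h2⟩, h3⟩ := key
    have : A' = ∅ := (Set.ncard_eq_zero h1).1 (by omega)
    rwa [this] at h3
  · rintro k hk t htk hfr ⟨A', ⟨h1, h2⟩, h3⟩
    obtain ⟨A'', ⟨h5, h6⟩, h7⟩ := stepCode_spec hX hD hs ht
      ((hfr.1 4 h4).trans hM.grid.reg_size) h3
    exact ⟨A'', ⟨h5, by omega⟩, h7.setReg (by decide) _⟩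

/-! ### Writing the answer -/

/-- Compute the length of the list of final moves. -/
def lengthCode : Code :=
  .ite (.eq (.reg 8) (.const 0)) (.assign 19 (.sub (.const 0) (.reg 10))) (.assign 19 (.const 0))

/-- Copy the final moves behind the other moves. -/
def copyCode : Code :=
  .loop 20 19 (.store 1 (.reg 0) (.get 11 (.reg 10)) ;; .assign 0 (.add (.reg 0) (.const 1)) ;;
    .assign 10 (.add (.reg 10) (.const 1)))

/-- Write the head of the answer. -/
def headCode : Code :=
  .ite (.eq (.reg 8) (.const 0))
    (.store 1 (.const 0) (.const 1) ;; .store 1 (.const 1) (.reg 9))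
    (.store 1 (.const 0) (.const 0) ;; .assign 0 (.const 1))

theorem output_eq {t : State} {l : List ℤ} (h0 : t.reg 0 = l.length) (h : Holds (t.arr 1) 0 l) :
    t.output = l := by
  rw [State.output, h0, Int.toNat_natCast]
  refine List.ext_getElem (by simp) fun k h1 h2 => ?_
  have hm : List.flatMap (fun a : ℕ => [(a : ℤ)]) (List.range l.length) =
      (List.range l.length).map fun a : ℕ => (a : ℤ) := List.map_eq_flatMap.symm
  have := h.getElem k h2
  simpa [hm] using this

/-- The moves of `M₁` were written from index 2 on, which leaves room for the head; those of `M₂`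
are appended. After a failure the copy loop has 0 rounds. -/
theorem answerCode_spec (h : Eliminated I X N V ∅ s) :
    ∃ a : Option (List (GridMove I.n)), I.IsCorrectAnswer a ∧
      ((copyCode ;; headCode).run (lengthCode.run s)).output = encodeAnswer a := by
  rcases h with ⟨h1, h2⟩ | ⟨S, T, M₁, M₂, hE, hM⟩
  · refine ⟨none, h2, ?_⟩
    have e1 : lengthCode.run s = s.setReg 19 0 := by
      rw [lengthCode, Code.run_ite, if_neg (by simp [Expr.eval, h1])]; rfl
    set t := copyCode.run (lengthCode.run s) with ht
    have e8 : t.reg 8 = 1 := by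
      rw [ht, Code.run_reg _ (by simp [Code.regs, copyCode]), e1]; simpa using h1
    have e2 : (copyCode ;; headCode).run (lengthCode.run s) = headCode.run t := rfl
    rw [e2, headCode, Code.run_ite, if_neg (by simp [Expr.eval, e8])]
    refine output_eq (by simp [Expr.eval, encodeAnswer]) ⟨?_, trivial⟩
    simp [Expr.eval]
  · refine ⟨some (M₁ ++ M₂), hE.isMonotoneSolution rfl, ?_⟩
    have e1 : lengthCode.run s = s.setReg 19 ((encodeMoves M₂).length) := by
      rw [lengthCode, Code.run_ite, if_pos (by simp [Expr.eval, hM.fail])]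
      simp [Expr.eval, hM.backPtr]
    set t := copyCode.run (lengthCode.run s) with ht
    have e8 : t.reg 8 = 0 := by
      rw [ht, Code.run_reg _ (by simp [Code.regs, copyCode]), e1]; simpa using hM.fail
    have e9 : t.reg 9 = (M₁ ++ M₂).length := by
      rw [ht, Code.run_reg _ (by simp [Code.regs, copyCode]), e1]; simpa using hM.count
    have e2 : (copyCode ;; headCode).run (lengthCode.run s) = headCode.run t := rfl
    have hM' : Memory I X N V ∅ S T M₁ M₂ (lengthCode.run s) := by
      rw [e1]; exact hM.congr (by simp) fun _ _ => rfl
    set s' := lengthCode.run s with hs'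
    have key : t.reg 0 = 2 + (encodeMoves M₁).length + (encodeMoves M₂).length ∧
        Holds (t.arr 1) 2 (encodeMoves M₁ ++ (encodeMoves M₂).take (encodeMoves M₂).length) := by
      have := Code.loop_inv (s := s') (c := 20) (b := 19)
        (P := .store 1 (.reg 0) (.get 11 (.reg 10)) ;; .assign 0 (.add (.reg 0) (.const 1)) ;;
          .assign 10 (.add (.reg 10) (.const 1))) (K := (encodeMoves M₂).length)
        (by rw [e1]; simp)
        (fun k t => t.reg 0 = 2 + (encodeMoves M₁).length + k ∧ t.reg 10 = s'.reg 10 + k ∧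
          Holds (t.arr 1) 2 (encodeMoves M₁ ++ (encodeMoves M₂).take k))
        ⟨by simp [hM'.outPtr], by simp, by simpa using hM'.out⟩ ?_
      · exact ⟨this.1, this.2.2⟩
      · rintro k hk u hu hfr ⟨u1, u2, u3⟩
        have e11 : u.arr 11 = s'.arr 11 := hfr.2 11 (by simp [Code.arrs])
        have ek : s'.arr 11 (s'.reg 10 + k) = (encodeMoves M₂)[k] := hM'.back.getElem k hk
        refine ⟨?_, ?_, ?_⟩
        · simp [Expr.eval, u1]; ring
        · simp [Expr.eval, u2]; ring
        · rw [List.take_add_one, List.getElem?_eq_getElem hk, Option.toList_some, ← List.append_assoc,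
            holds_append]
          simp only [Code.run_seq, Code.run_store, Code.run_assign, State.arr_setReg,
            State.arr_setArr_self, Expr.eval, u1, u2, e11, ek]
          have hlen : (((encodeMoves M₁ ++ (encodeMoves M₂).take k).length : ℕ) : ℤ) =
              (encodeMoves M₁).length + k := by
            rw [List.length_append, List.length_take, min_eq_left (by omega)]; push_cast; ring
          refine ⟨u3.congr fun x x1 x2 => ?_, ?_, trivial⟩
          · rw [hlen] at x2
            rw [Function.update_of_ne (by omega)]
          · rw [hlen, show (2 : ℤ) + ((encodeMoves M₁).length + k) =
              2 + (encodeMoves M₁).length + k by ring, Function.update_self]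
    rw [List.take_length, ← encodeMoves_append] at key
    have hans : encodeAnswer (some (M₁ ++ M₂)) =
        1 :: ((M₁ ++ M₂).length : ℤ) :: encodeMoves (M₁ ++ M₂) := rfl
    rw [e2, headCode, Code.run_ite, if_pos (by simp [Expr.eval, e8])]
    have ea : ((Code.store 1 (.const 0) (.const 1) ;; .store 1 (.const 1) (.reg 9)).run t).arr 1 =
        Function.update (Function.update (t.arr 1) 0 1) 1 (M₁ ++ M₂).length := by
      simp [Expr.eval, e9]
    refine output_eq ?_ ?_
    · rw [hans]
      simp only [List.length_cons, encodeMoves_append, List.length_append]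
      simp [Expr.eval, key.1]; ring
    · rw [ea, hans]
      refine ⟨by simp, by simp, key.2.congr fun k k1 k2 => ?_⟩
      rw [Function.update_of_ne (by omega), Function.update_of_ne (by omega)]

theorem length_encodeMoves_le (h : ∀ m ∈ M₂, m.waypoints.length ≤ N) :
    (encodeMoves M₂).length ≤ M₂.length * (2 + 2 * N) := by
  induction M₂ with
  | nil => simp [encodeMoves]
  | cons m ms ih =>
    rw [encodeMoves_cons]
    have h1 := ih fun m hm => h m (List.mem_cons_of_mem _ hm)
    have h2 := h m (by simp)
    simp only [List.length_append, List.length_cons, length_encodeCells]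
    have : (ms.length + 1) * (2 + 2 * N) = ms.length * (2 + 2 * N) + (2 + 2 * N) := by ring
    omega

/-- Every square moves at most once, so there are at most `I.n` final moves, each with at most `N`
waypoints. This bounds the copy loop. -/
theorem lengthCode_le (h : Eliminated I X N V A s) :
    (lengthCode.run s).reg 19 ≤ ((I.n * (2 + 2 * N) : ℕ) : ℤ) := by
  rw [lengthCode, Code.run_ite]
  rcases h with ⟨h1, h2⟩ | ⟨S, T, M₁, M₂, hE, hM⟩
  · rw [if_neg (by simp [Expr.eval, h1])]
    simp [Expr.eval]; positivity
  · rw [if_pos (by simp [Expr.eval, hM.fail])]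
    simp only [Code.run_assign, State.reg_setReg, if_true, Expr.eval, hM.backPtr]
    have h1 := length_encodeMoves_le hM.len
    have h2 : M₂.length ≤ I.n := by
      have := hE.nodup.length_le_card
      simp only [List.length_map, List.length_append, Fintype.card_fin] at this
      omega
    have h3 := Nat.mul_le_mul_right (2 + 2 * N) h2
    rw [zero_sub, neg_neg]
    exact_mod_cast h1.trans h3

end

end SquareReconfig

namespace SquareReconfig
open Relation

/-! ### Reading the input -/

/-- All numbers in the input. -/
def Instance.numbers (I : Instance) : Set ℤ := {x | x ∈ I.encode}

/-- The input and its size and layout in memory. -/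
structure Input (I : Instance) (s : State) : Prop where
  length : s.reg 1 = I.encode.length
  count : s.reg 2 = I.n
  size : s.reg 4 = ((I.encode.length * I.encode.length : ℕ) : ℤ)
  numbers : ∀ x, x ∈ I.numbers ↔ ∃ k : ℤ, 0 ≤ k ∧ k < I.encode.length ∧ s.arr 0 k = x
  start : ∀ i : Fin I.n, I.start i = (s.arr 0 (s.reg 5 + 2 * (i : ℕ)), s.arr 0 (s.reg 5 + 2 * (i : ℕ) + 1))
  target : ∀ i : Fin I.n,
    I.target i = (s.arr 0 (s.reg 6 + 2 * (i : ℕ)), s.arr 0 (s.reg 6 + 2 * (i : ℕ) + 1))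
  cells : ∃ m : ℕ, s.reg 3 = m ∧ m ≤ I.encode.length ∧
    ((s.reg 18 = 0 ∧ ∀ z, z ∈ I.domain.cells) ∨ (s.reg 18 = 1 ∧ ∀ z : Cell, z ∈ I.domain.cells ↔
      ∃ k < m, s.arr 0 (2 + 4 * (k : ℕ)) ≤ z.1 ∧ z.1 < s.arr 0 (2 + 4 * (k : ℕ) + 1) ∧
        s.arr 0 (2 + 4 * (k : ℕ) + 2) ≤ z.2 ∧ z.2 < s.arr 0 (2 + 4 * (k : ℕ) + 3)))

theorem Input.congr {I : Instance} {s t : State} (h : Input I s)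
    (hr : ∀ x ∈ [1, 2, 3, 4, 5, 6, 18], t.reg x = s.reg x) (ha : t.arr 0 = s.arr 0) :
    Input I t := by
  simp only [List.mem_cons, List.not_mem_nil, or_false, forall_eq_or_imp, forall_eq] at hr
  obtain ⟨r1, r2, r3, r4, r5, r6, r18⟩ := hr
  exact ⟨r1.trans h.length, r2.trans h.count, r4.trans h.size, by rw [ha]; exact h.numbers,
    by rw [ha, r5]; exact h.start, by rw [ha, r6]; exact h.target,
    by rw [ha, r3, r18]; exact h.cells⟩

theorem Input.of_frame {I : Instance} {P : Code} {s t : State} (h : Input I s) (hf : P.Frame s t)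
    (hr : ∀ x ∈ [1, 2, 3, 4, 5, 6, 18], x ∉ P.regs) (ha : 0 ∉ P.arrs) : Input I t :=
  h.congr (fun x hx => hf.1 x (hr x hx)) (hf.2 0 ha)

/-- Without multiplication, the square of the input length is formed by repeated addition and four
times the number of rectangles by doubling. Output starts at index 2, behind the head. -/
def parseCode : Code :=
  .loop 20 1 (.assign 4 (.add (.reg 4) (.reg 1))) ;;
  .assign 18 (.get 0 (.const 0)) ;;
  .ite (.le (.reg 18) (.const 0)) (.assign 3 (.const 0) ;; .assign 5 (.const 2))
    (.assign 3 (.get 0 (.const 1)) ;;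
      .assign 5 (.add (.add (.add (.reg 3) (.reg 3)) (.add (.reg 3) (.reg 3))) (.const 3))) ;;
  .assign 2 (.get 0 (.sub (.reg 5) (.const 1))) ;;
  .assign 6 (.add (.reg 5) (.add (.reg 2) (.reg 2))) ;;
  .assign 0 (.const 2)

theorem holds_init (l : List ℤ) : Holds ((State.init l).arr 0) 0 l := by
  refine holds_of_getElem fun k hk => ?_
  simp [State.init, hk]

theorem holds_encodeCells {a : ℤ → ℤ} {l : List Cell} {o : ℤ} (h : Holds a o (encodeCells l))
    (k : ℕ) (hk : k < l.length) : l[k] = (a (o + 2 * k), a (o + 2 * k + 1)) := by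
  induction l generalizing o k with
  | nil => simp at hk
  | cons z l ih =>
    rw [encodeCells_cons] at h
    obtain ⟨h1, h2, h3⟩ := h
    cases k with
    | zero => simp [h1, h2]
    | succ k =>
      rw [List.getElem_cons_succ, ih h3 k (by simpa using hk)]
      push_cast
      congr 2 <;> ring

theorem length_encodeRects (rs : List Rect) :
    (rs.flatMap fun r => [r.left, r.right, r.bottom, r.top]).length = 4 * rs.length := by
  induction rs with
  | nil => rfl
  | cons z l ih =>
    simp only [List.flatMap_cons, List.length_append, List.length_cons, List.length_nil] at ih ⊢
    omega

theorem holds_encodeRects {a : ℤ → ℤ} {rs : List Rect} {o : ℤ}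
    (h : Holds a o (rs.flatMap fun r => [r.left, r.right, r.bottom, r.top]))
    (k : ℕ) (hk : k < rs.length) : rs[k].left = a (o + 4 * k) ∧ rs[k].right = a (o + 4 * k + 1) ∧
      rs[k].bottom = a (o + 4 * k + 2) ∧ rs[k].top = a (o + 4 * k + 3) := by
  induction rs generalizing o k with
  | nil => simp at hk
  | cons z l ih =>
    rw [List.flatMap_cons] at h
    obtain ⟨h1, h2, h3, h4, h5⟩ := h
    cases k with
    | zero =>
      simp only [List.getElem_cons_zero, Nat.cast_zero, mul_zero, add_zero]
      exact ⟨h1.symm, h2.symm, by rw [← h3]; congr 1; ring, by rw [← h4]; congr 1; ring⟩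
    | succ k =>
      have h5' : Holds a (o + 4) (l.flatMap fun r => [r.left, r.right, r.bottom, r.top]) := by
        rw [show o + 4 = o + 1 + 1 + 1 + 1 by ring]; exact h5
      obtain ⟨i1, i2, i3, i4⟩ := ih h5' k (by simpa using hk)
      rw [List.getElem_cons_succ, i1, i2, i3, i4]
      push_cast
      refine ⟨?_, ?_, ?_, ?_⟩ <;> congr 1 <;> ring

theorem parseCode_spec (I : Instance) {s : State} (h1 : s.reg 1 = I.encode.length)
    (h4 : s.reg 4 = 0) (ha : s.arr 0 = (State.init I.encode).arr 0) :
    Input I (parseCode.run s) ∧ (parseCode.run s).reg 0 = 2 := by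
  set L := I.encode.length with hL
  have hh : Holds (s.arr 0) 0 I.encode := by rw [ha]; exact holds_init _
  set t₁ := (Code.loop 20 1 (.assign 4 (.add (.reg 4) (.reg 1)))).run s with ht₁
  have hfr₁ : (Code.loop 20 1 (.assign 4 (.add (.reg 4) (.reg 1)))).Frame s t₁ := Code.frame_run _ _
  have r1 : t₁.reg 1 = L := (hfr₁.1 1 (by simp [Code.regs])).trans h1
  have a0 : t₁.arr 0 = s.arr 0 := hfr₁.2 0 (by simp [Code.arrs])
  have r4 : t₁.reg 4 = ((L * L : ℕ) : ℤ) := by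
    refine Code.loop_inv (c := 20) (P := .assign 4 (.add (.reg 4) (.reg 1))) h1
      (fun k t => t.reg 4 = ((k * L : ℕ) : ℤ)) (by simp [h4]) ?_
    intro k _ t _ hfr ih
    have e : t.reg 1 = L := (hfr.1 1 (by simp [Code.regs])).trans h1
    simp [Expr.eval, ih, e]; ring
  have hnum : ∀ x, x ∈ I.numbers ↔ ∃ k : ℤ, 0 ≤ k ∧ k < L ∧ s.arr 0 k = x := by
    intro x
    constructor
    · intro hx
      obtain ⟨k, hk, rfl⟩ := List.getElem_of_mem (show x ∈ I.encode from hx)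
      refine ⟨k, by omega, by omega, ?_⟩
      have := hh.getElem k hk
      rwa [zero_add] at this
    · rintro ⟨k, k1, k2, rfl⟩
      lift k to ℕ using k1
      have hk : k < I.encode.length := by omega
      have := hh.getElem k hk
      rw [zero_add] at this
      rw [this]
      exact List.getElem_mem hk
  set P₂ : Code := .assign 18 (.get 0 (.const 0)) ;;
    .ite (.le (.reg 18) (.const 0)) (.assign 3 (.const 0) ;; .assign 5 (.const 2))
    (.assign 3 (.get 0 (.const 1)) ;;
      .assign 5 (.add (.add (.add (.reg 3) (.reg 3)) (.add (.reg 3) (.reg 3))) (.const 3))) with hP₂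
  set t₂ := P₂.run t₁ with ht₂
  have hfr₂ : P₂.Frame t₁ t₂ := Code.frame_run _ _
  have b0 : t₂.arr 0 = s.arr 0 := (hfr₂.2 0 (by simp [hP₂, Code.arrs])).trans a0
  have henc : I.encode = I.domain.encode ++ (I.n : ℤ) ::
    (encodeCells (List.ofFn I.start) ++ encodeCells (List.ofFn I.target)) := rfl
  rw [henc, holds_append] at hh
  obtain ⟨hh1, hh2, hh3⟩ := hh
  rw [holds_append] at hh3
  obtain ⟨hh3, hh4⟩ := hh3
  rw [length_encodeCells, List.length_ofFn] at hh4
  have key : t₂.reg 5 = I.domain.encode.length + 1 ∧ ∃ m : ℕ, t₂.reg 3 = m ∧ m ≤ L ∧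
    ((t₂.reg 18 = 0 ∧ ∀ z, z ∈ I.domain.cells) ∨ (t₂.reg 18 = 1 ∧ ∀ z : Cell, z ∈ I.domain.cells ↔
      ∃ k < m, s.arr 0 (2 + 4 * (k : ℕ)) ≤ z.1 ∧ z.1 < s.arr 0 (2 + 4 * (k : ℕ) + 1) ∧
        s.arr 0 (2 + 4 * (k : ℕ) + 2) ≤ z.2 ∧ z.2 < s.arr 0 (2 + 4 * (k : ℕ) + 3))) := by
    have e0 : t₂ = (if (Test.le (.reg 18) (.const 0)).eval (t₁.setReg 18 (s.arr 0 0)) then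
      ((t₁.setReg 18 (s.arr 0 0)).setReg 3 0).setReg 5 2 else
      ((t₁.setReg 18 (s.arr 0 0)).setReg 3 (s.arr 0 1)).setReg 5
        (s.arr 0 1 + s.arr 0 1 + (s.arr 0 1 + s.arr 0 1) + 3)) := by
      simp only [ht₂, hP₂, Code.run_seq, Code.run_ite, Code.run_assign, Expr.eval, a0,
        State.arr_setReg, State.reg_setReg, if_true]
    have hLe : L = I.domain.encode.length + (1 + (2 * I.n + 2 * I.n)) := by
      rw [hL, henc]
      simp only [List.length_append, List.length_cons, length_encodeCells, List.length_ofFn]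
      ring
    rcases hd : I.domain with _ | rs
    · rw [hd] at hh1
      have c0 : s.arr 0 0 = 0 := hh1.1
      rw [e0, if_pos (by simp [Expr.eval, c0])]
      refine ⟨by simp [Domain.encode], 0, by simp, by omega, Or.inl ⟨by simp [c0], ?_⟩⟩
      intro z; rw [cells_none]; trivial
    · rw [hd] at hh1 hLe
      obtain ⟨c0, c1, c2⟩ := hh1
      have c1' : s.arr 0 1 = rs.length := c1
      have c2' : Holds (s.arr 0) 2 (rs.flatMap fun r => [r.left, r.right, r.bottom, r.top]) := c2
      have hlen : (Domain.encode (some rs)).length = 2 + 4 * rs.length := by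
        simp only [Domain.encode, List.length_cons, length_encodeRects]; omega
      rw [e0, if_neg (by simp [Expr.eval, c0])]
      refine ⟨?_, rs.length, by simp [c1'], by omega, Or.inr ⟨by simp [c0], ?_⟩⟩
      · rw [hlen]; simp [c1']; ring
      · intro z
        rw [mem_cells_some]
        constructor
        · rintro ⟨r, hr, d⟩
          obtain ⟨k, hk, rfl⟩ := List.getElem_of_mem hr
          obtain ⟨d1, d2, d3, d4⟩ := holds_encodeRects c2' k hk
          rw [d1, d2, d3, d4] at d
          exact ⟨k, hk, d⟩
        · rintro ⟨k, hk, d⟩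
          obtain ⟨d1, d2, d3, d4⟩ := holds_encodeRects c2' k hk
          rw [← d1, ← d2, ← d3, ← d4] at d
          exact ⟨rs[k], List.getElem_mem hk, d⟩
  obtain ⟨r5, hm⟩ := key
  have q1 : t₂.reg 1 = L := (hfr₂.1 1 (by simp [hP₂, Code.regs])).trans r1
  have q4 : t₂.reg 4 = ((L * L : ℕ) : ℤ) := (hfr₂.1 4 (by simp [hP₂, Code.regs])).trans r4
  have hn : s.arr 0 (I.domain.encode.length : ℤ) = I.n := by
    rw [zero_add] at hh2; exact hh2
  have efin : parseCode.run s = ((t₂.setReg 2 I.n).setReg 6 (I.domain.encode.length + 1 +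
      (I.n + I.n))).setReg 0 2 := by
    have : parseCode.run s = (Code.assign 2 (.get 0 (.sub (.reg 5) (.const 1))) ;;
      .assign 6 (.add (.reg 5) (.add (.reg 2) (.reg 2))) ;; .assign 0 (.const 2)).run t₂ := rfl
    rw [this]
    simp only [Code.run_seq, Code.run_assign, Expr.eval, b0, r5, add_sub_cancel_right, hn,
      State.reg_setReg, if_true]
    simp
  rw [efin]
  refine ⟨⟨by simpa using q1, by simp, by simpa using q4, ?_, ?_, ?_, ?_⟩, by simp⟩
  · simp only [State.arr_setReg, b0]; exact hnum
  · intro i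
    have := holds_encodeCells hh3 i (by simp)
    simp only [List.getElem_ofFn, Fin.eta] at this
    simp only [State.arr_setReg, b0, State.reg_setReg, Nat.reduceEqDiff, if_false, r5,
      OfNat.ofNat_ne_zero]
    rw [this, zero_add]
  · intro i
    have := holds_encodeCells hh4 i (by simp)
    simp only [List.getElem_ofFn, Fin.eta] at this
    simp only [State.arr_setReg, b0, State.reg_setReg, Nat.reduceEqDiff, if_false, if_true,
      OfNat.ofNat_ne_zero]
    rw [this]
    push_cast
    congr 2 <;> ring
  · simpa [b0] using hm

theorem Instance.numbers_finite (I : Instance) : I.numbers.Finite := List.finite_toSet _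

/-- Taking all input numbers as coordinates spares sorting coordinates from counts; the superfluous
ones only refine the grid. -/
theorem Instance.covers (I : Instance) : Covers I.numbers I.domain := by
  have key : ∀ x ∈ I.domain.encode, x ∈ I.numbers := fun x hx => by
    show x ∈ I.encode
    exact List.mem_append_left _ hx
  rcases hd : I.domain with _ | rs
  · trivial
  · intro r hr
    rw [hd] at key
    refine ⟨?_, ?_, ?_, ?_⟩ <;> refine key _ (List.mem_cons_of_mem _ (List.mem_cons_of_mem _ ?_)) <;>
      exact List.mem_flatMap.2 ⟨r, hr, by simp⟩

theorem mem_encodeCells {l : List Cell} {z : Cell} (h : z ∈ l) :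
    z.1 ∈ encodeCells l ∧ z.2 ∈ encodeCells l :=
  ⟨List.mem_flatMap.2 ⟨z, h, by simp⟩, List.mem_flatMap.2 ⟨z, h, by simp⟩⟩

theorem Instance.start_mem_gridPoints (I : Instance) (i : Fin I.n) :
    I.start i ∈ gridPoints I.numbers I.domain := by
  have h := mem_encodeCells (List.mem_ofFn.2 ⟨i, rfl⟩ : I.start i ∈ List.ofFn I.start)
  have key : ∀ x ∈ encodeCells (List.ofFn I.start), x ∈ I.numbers := fun x hx => by
    show x ∈ I.encode
    exact List.mem_append_right _ (List.mem_cons_of_mem _ (List.mem_append_left _ hx))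
  exact ⟨key _ h.1, key _ h.2, I.start_mem i⟩

theorem Instance.target_mem_gridPoints (I : Instance) (i : Fin I.n) :
    I.target i ∈ gridPoints I.numbers I.domain := by
  have h := mem_encodeCells (List.mem_ofFn.2 ⟨i, rfl⟩ : I.target i ∈ List.ofFn I.target)
  have key : ∀ x ∈ encodeCells (List.ofFn I.target), x ∈ I.numbers := fun x hx => by
    show x ∈ I.encode
    exact List.mem_append_right _ (List.mem_cons_of_mem _ (List.mem_append_right _ hx))
  exact ⟨key _ h.1, key _ h.2, I.target_mem i⟩

/-! ### Building the compressed grid -/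

/-- Write the next input number after register `x` into register `y`. -/
def nextCode (x y : ℕ) : Code :=
  .assign y (.reg x) ;;
  .loop 22 1 (.ite (.and (.lt (.reg x) (.get 0 (.reg 22)))
      (.or (.le (.reg y) (.reg x)) (.lt (.get 0 (.reg 22)) (.reg y))))
    (.assign y (.get 0 (.reg 22))) .skip)

/-- Write into register 33 whether the cell in registers 31, 32 is in the domain. -/
def domainCode : Code :=
  .ite (.le (.reg 18) (.const 0)) (.assign 33 (.const 1))
    (.assign 33 (.const 0) ;; .assign 34 (.const 2) ;;
      .loop 22 3 (.ite (.and (.le (.get 0 (.reg 34)) (.reg 31))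
          (.and (.lt (.reg 31) (.get 0 (.add (.reg 34) (.const 1))))
            (.and (.le (.get 0 (.add (.reg 34) (.const 2))) (.reg 32))
              (.lt (.reg 32) (.get 0 (.add (.reg 34) (.const 3)))))))
          (.assign 33 (.const 1)) .skip ;;
        .assign 34 (.add (.reg 34) (.const 4))))

/-- Set register 33 to 0 if the point in registers 31, 32 is an earlier vertex. -/
def duplicateCode : Code :=
  .loop 22 4 (.ite (.and (.lt (.reg 22) (.reg 30)) (.and (.eq (.get 2 (.reg 22)) (.reg 31))
    (.eq (.get 3 (.reg 22)) (.reg 32)))) (.assign 33 (.const 0)) .skip)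

def vertexCode : Code :=
  .assign 31 (.get 0 (.reg 20)) ;; .assign 32 (.get 0 (.reg 21)) ;;
  nextCode 31 35 ;; nextCode 32 36 ;; domainCode ;; duplicateCode ;;
  .store 2 (.reg 30) (.reg 31) ;; .store 3 (.reg 30) (.reg 32) ;;
  .store 4 (.reg 30) (.reg 35) ;; .store 5 (.reg 30) (.reg 36) ;;
  .store 6 (.reg 30) (.reg 33) ;; .assign 30 (.add (.reg 30) (.const 1))

def buildCode : Code :=
  .assign 30 (.const 0) ;; .loop 20 1 (.loop 21 1 vertexCode)

section

variable {I : Instance} {s : State}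

theorem nextCode_spec (h : Input I s) {x y : ℕ} (hxy : x ≠ y) (hx : x ≠ 22 ∧ x ≠ 1)
    (hy : y ≠ 22 ∧ y ≠ 1) :
    NextOf I.numbers (s.reg x) (((nextCode x y).run s).reg y) := by
  -- As long as no larger number has been seen, register `y` equals register `x`; this is the
  -- meaning of the test `reg y ≤ reg x` in the loop.
  have key := Code.loop_inv (s := s.setReg y (s.reg x)) (c := 22) (b := 1)
    (P := .ite (.and (.lt (.reg x) (.get 0 (.reg 22)))
      (.or (.le (.reg y) (.reg x)) (.lt (.get 0 (.reg 22)) (.reg y))))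
      (.assign y (.get 0 (.reg 22))) .skip) (K := I.encode.length)
    (by simpa [hy.2.symm] using h.length)
    (fun k t => (t.reg y = s.reg x ∨ (s.reg x < t.reg y ∧ t.reg y ∈ I.numbers)) ∧
      ∀ q : ℤ, 0 ≤ q → q < k → s.reg x < s.arr 0 q → s.reg x < t.reg y ∧ t.reg y ≤ s.arr 0 q)
    ⟨Or.inl (by simp [hy.1]), fun q q1 q2 => by simp only [Nat.cast_zero] at q2; omega⟩ ?_
  · refine ⟨key.1, fun a ha hlt => ?_⟩
    obtain ⟨k, k1, k2, rfl⟩ := (h.numbers a).1 ha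
    exact key.2 k k1 k2 hlt
  · rintro k hk t ht hfr ⟨i1, i2⟩
    have ex : t.reg x = s.reg x := by
      rw [hfr.1 x (by simp [Code.regs, hx.1, hxy])]; simp [hxy]
    have ea : t.arr 0 = s.arr 0 := by rw [hfr.2 0 (by simp [Code.arrs])]; simp
    have hmem : s.arr 0 k ∈ I.numbers := (h.numbers _).2 ⟨k, by omega, by omega, rfl⟩
    rw [Code.run_ite]
    by_cases hc : s.reg x < s.arr 0 k ∧ (t.reg y ≤ s.reg x ∨ s.arr 0 k < t.reg y)
    · rw [if_pos (by simpa [Expr.eval, ex, ea, ht] using hc)]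
      have e : (((Code.assign y (.get 0 (.reg 22))).run t).setReg 22 (k + 1)).reg y = s.arr 0 k := by
        simp [Expr.eval, hy.1, ht, ea]
      rw [e]
      refine ⟨Or.inr ⟨hc.1, hmem⟩, fun q q1 q2 q3 => ⟨hc.1, ?_⟩⟩
      by_cases eq : q = k
      · rw [eq]
      · have := i2 q q1 (by push_cast at q2; omega) q3
        omega
    · rw [if_neg (by simpa [Expr.eval, ex, ea, ht] using hc)]
      have e : ((Code.skip.run t).setReg 22 (k + 1)).reg y = t.reg y := by simp [hy.1]
      rw [e]
      refine ⟨i1, fun q q1 q2 q3 => ?_⟩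
      by_cases eq : q = k
      · subst eq; omega
      · exact i2 q q1 (by push_cast at q2; omega) q3

theorem domainCode_spec (h : Input I s) :
    ((domainCode.run s).reg 33 = 1 ∧ ((s.reg 31, s.reg 32) : Cell) ∈ I.domain.cells) ∨
    ((domainCode.run s).reg 33 = 0 ∧ ((s.reg 31, s.reg 32) : Cell) ∉ I.domain.cells) := by
  obtain ⟨m, hm, _, hc⟩ := h.cells
  rw [domainCode, Code.run_ite]
  rcases hc with ⟨h18, hc⟩ | ⟨h18, hc⟩
  · rw [if_pos (by simp [Expr.eval, h18])]
    exact Or.inl ⟨by simp [Expr.eval], hc _⟩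
  · rw [if_neg (by simp [Expr.eval, h18]), hc]
    dsimp only
    have key := Code.loop_inv (s := (s.setReg 33 0).setReg 34 2) (c := 22) (b := 3)
      (P := .ite (.and (.le (.get 0 (.reg 34)) (.reg 31))
          (.and (.lt (.reg 31) (.get 0 (.add (.reg 34) (.const 1))))
            (.and (.le (.get 0 (.add (.reg 34) (.const 2))) (.reg 32))
              (.lt (.reg 32) (.get 0 (.add (.reg 34) (.const 3)))))))
          (.assign 33 (.const 1)) .skip ;;
        .assign 34 (.add (.reg 34) (.const 4))) (K := m) (by simpa using hm)
      (fun k t => t.reg 34 = 2 + 4 * k ∧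
        ((t.reg 33 = 1 ∧ ∃ j < k, s.arr 0 (2 + 4 * (j : ℕ)) ≤ s.reg 31 ∧
          s.reg 31 < s.arr 0 (2 + 4 * (j : ℕ) + 1) ∧ s.arr 0 (2 + 4 * (j : ℕ) + 2) ≤ s.reg 32 ∧
          s.reg 32 < s.arr 0 (2 + 4 * (j : ℕ) + 3)) ∨
        (t.reg 33 = 0 ∧ ¬ ∃ j < k, s.arr 0 (2 + 4 * (j : ℕ)) ≤ s.reg 31 ∧
          s.reg 31 < s.arr 0 (2 + 4 * (j : ℕ) + 1) ∧ s.arr 0 (2 + 4 * (j : ℕ) + 2) ≤ s.reg 32 ∧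
          s.reg 32 < s.arr 0 (2 + 4 * (j : ℕ) + 3))))
      ⟨by simp, Or.inr ⟨by simp, by simp⟩⟩ ?_
    · exact key.2
    · rintro k hk t ht hfr ⟨i1, i2⟩
      have e31 : t.reg 31 = s.reg 31 := by rw [hfr.1 31 (by simp [Code.regs])]; simp
      have e32 : t.reg 32 = s.reg 32 := by rw [hfr.1 32 (by simp [Code.regs])]; simp
      have ea : t.arr 0 = s.arr 0 := by rw [hfr.2 0 (by simp [Code.arrs])]; simp
      rw [Code.run_seq, Code.run_ite]
      by_cases hp : s.arr 0 (2 + 4 * (k : ℕ)) ≤ s.reg 31 ∧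
          s.reg 31 < s.arr 0 (2 + 4 * (k : ℕ) + 1) ∧ s.arr 0 (2 + 4 * (k : ℕ) + 2) ≤ s.reg 32 ∧
          s.reg 32 < s.arr 0 (2 + 4 * (k : ℕ) + 3)
      · rw [if_pos (by simpa [Expr.eval, e31, e32, ea, i1] using hp)]
        exact ⟨by simp [Expr.eval, i1]; ring,
          Or.inl ⟨by simp [Expr.eval], k, by omega, hp⟩⟩
      · rw [if_neg (by simpa [Expr.eval, e31, e32, ea, i1] using hp)]
        refine ⟨by simp [Expr.eval, i1]; ring, ?_⟩
        rcases i2 with ⟨j1, j, j2, j3⟩ | ⟨j1, j2⟩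
        · exact Or.inl ⟨by simpa using j1, j, by omega, j3⟩
        · refine Or.inr ⟨by simpa using j1, ?_⟩
          rintro ⟨j, j3, j4⟩
          rcases Nat.lt_succ_iff_lt_or_eq.1 j3 with j5 | rfl
          · exact j2 ⟨j, j5, j4⟩
          · exact hp j4

theorem duplicateCode_spec {N : ℕ} (hN : s.reg 4 = N) (hp : s.reg 30 ≤ N) :
    ((duplicateCode.run s).reg 33 = 0 ∧
      ∃ q, 0 ≤ q ∧ q < s.reg 30 ∧ s.arr 2 q = s.reg 31 ∧ s.arr 3 q = s.reg 32) ∨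
    ((duplicateCode.run s).reg 33 = s.reg 33 ∧
      ∀ q, 0 ≤ q → q < s.reg 30 → ¬ (s.arr 2 q = s.reg 31 ∧ s.arr 3 q = s.reg 32)) := by
  have key := Code.loop_inv (c := 22) (b := 4)
    (P := .ite (.and (.lt (.reg 22) (.reg 30)) (.and (.eq (.get 2 (.reg 22)) (.reg 31))
      (.eq (.get 3 (.reg 22)) (.reg 32)))) (.assign 33 (.const 0)) .skip) hN
    (fun k t => (t.reg 33 = 0 ∧
        ∃ q, 0 ≤ q ∧ q < s.reg 30 ∧ s.arr 2 q = s.reg 31 ∧ s.arr 3 q = s.reg 32) ∨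
      (t.reg 33 = s.reg 33 ∧ ∀ q : ℤ, 0 ≤ q → q < k → q < s.reg 30 →
        ¬ (s.arr 2 q = s.reg 31 ∧ s.arr 3 q = s.reg 32)))
    (Or.inr ⟨by simp, fun q q1 q2 => by simp only [Nat.cast_zero] at q2; omega⟩) ?_
  · rcases key with k | ⟨k1, k2⟩
    · exact Or.inl k
    · exact Or.inr ⟨k1, fun q q1 q2 => k2 q q1 (by omega) q2⟩
  · rintro k hk t ht hfr ih
    have e30 : t.reg 30 = s.reg 30 := hfr.1 30 (by simp [Code.regs])
    have e31 : t.reg 31 = s.reg 31 := hfr.1 31 (by simp [Code.regs])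
    have e32 : t.reg 32 = s.reg 32 := hfr.1 32 (by simp [Code.regs])
    have ea : t.arr = s.arr := by funext a; exact hfr.2 a (by simp [Code.arrs])
    rw [Code.run_ite]
    by_cases hc : (k : ℤ) < s.reg 30 ∧ s.arr 2 k = s.reg 31 ∧ s.arr 3 k = s.reg 32
    · rw [if_pos (by simpa [Expr.eval, e30, e31, e32, ea, ht] using hc)]
      exact Or.inl ⟨by simp [Expr.eval], k, by omega, hc.1, hc.2⟩
    · rw [if_neg (by simpa [Expr.eval, e30, e31, e32, ea, ht] using hc)]
      rcases ih with ⟨i1, i2⟩ | ⟨i1, i2⟩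
      · exact Or.inl ⟨by simpa using i1, i2⟩
      · refine Or.inr ⟨by simpa using i1, fun q q1 q2 q3 q4 => ?_⟩
        by_cases e : q = k
        · subst e; exact hc ⟨q3, q4⟩
        · exact i2 q q1 (by push_cast at q2; omega) q3 q4

/-- The first `p` vertices have been built. -/
def Built (I : Instance) (p : ℤ) (s : State) : Prop :=
  ∀ q, 0 ≤ q → q < p → (s.arr 2 q ∈ I.numbers ∧ s.arr 3 q ∈ I.numbers) ∧
    NextOf I.numbers (s.arr 2 q) (s.arr 4 q) ∧ NextOf I.numbers (s.arr 3 q) (s.arr 5 q) ∧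
    (s.arr 6 q = 1 ↔ ((s.arr 2 q, s.arr 3 q) : Cell) ∈ I.domain.cells ∧
      ∀ q', 0 ≤ q' → q' < q → ¬ (s.arr 2 q' = s.arr 2 q ∧ s.arr 3 q' = s.arr 3 q))

theorem vertexCode_spec (h : Input I s) {i j p : ℤ} (hi : s.reg 20 = i) (hj : s.reg 21 = j)
    (hp : s.reg 30 = p) (hiL : 0 ≤ i ∧ i < I.encode.length) (hjL : 0 ≤ j ∧ j < I.encode.length)
    (hpN : 0 ≤ p ∧ p ≤ (I.encode.length * I.encode.length : ℕ)) (hb : Built I p s) :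
    Built I (p + 1) (vertexCode.run s) ∧ (vertexCode.run s).reg 30 = p + 1 ∧
    (vertexCode.run s).arr 2 = Function.update (s.arr 2) p (s.arr 0 i) ∧
    (vertexCode.run s).arr 3 = Function.update (s.arr 3) p (s.arr 0 j) := by
  set P₁ : Code := .assign 31 (.get 0 (.reg 20)) ;; .assign 32 (.get 0 (.reg 21)) with hP₁
  set t₁ := P₁.run s with ht₁
  have f₁ : P₁.Frame s t₁ := Code.frame_run _ _
  have x31 : t₁.reg 31 = s.arr 0 i := by simp [ht₁, hP₁, Expr.eval, hi]
  have x32 : t₁.reg 32 = s.arr 0 j := by simp [ht₁, hP₁, Expr.eval, hj]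
  have h₁ : Input I t₁ := h.of_frame f₁ (by simp [hP₁, Code.regs]) (by simp [hP₁, Code.arrs])
  have n1 := nextCode_spec h₁ (x := 31) (y := 35) (by decide) (by decide) (by decide)
  set t₂ := (nextCode 31 35).run t₁ with ht₂
  have f₂ : (nextCode 31 35).Frame t₁ t₂ := Code.frame_run _ _
  have h₂ : Input I t₂ := h₁.of_frame f₂ (by simp [nextCode, Code.regs]) (by simp [nextCode, Code.arrs])
  have n2 := nextCode_spec h₂ (x := 32) (y := 36) (by decide) (by decide) (by decide)
  set t₃ := (nextCode 32 36).run t₂ with ht₃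
  have f₃ : (nextCode 32 36).Frame t₂ t₃ := Code.frame_run _ _
  have h₃ : Input I t₃ := h₂.of_frame f₃ (by simp [nextCode, Code.regs]) (by simp [nextCode, Code.arrs])
  have n3 := domainCode_spec h₃
  set t₄ := domainCode.run t₃ with ht₄
  have f₄ : domainCode.Frame t₃ t₄ := Code.frame_run _ _
  have h₄ : Input I t₄ := h₃.of_frame f₄ (by simp [domainCode, Code.regs])
    (by simp [domainCode, Code.arrs])
  have k31 : t₄.reg 31 = s.arr 0 i := by
    rw [f₄.1 31 (by simp [domainCode, Code.regs]), f₃.1 31 (by simp [nextCode, Code.regs]),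
      f₂.1 31 (by simp [nextCode, Code.regs]), x31]
  have k32 : t₄.reg 32 = s.arr 0 j := by
    rw [f₄.1 32 (by simp [domainCode, Code.regs]), f₃.1 32 (by simp [nextCode, Code.regs]),
      f₂.1 32 (by simp [nextCode, Code.regs]), x32]
  have k31' : t₃.reg 31 = s.arr 0 i := by rw [← k31, f₄.1 31 (by simp [domainCode, Code.regs])]
  have k32' : t₃.reg 32 = s.arr 0 j := by rw [← k32, f₄.1 32 (by simp [domainCode, Code.regs])]
  have k30 : t₄.reg 30 = p := by
    rw [f₄.1 30 (by simp [domainCode, Code.regs]), f₃.1 30 (by simp [nextCode, Code.regs]),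
      f₂.1 30 (by simp [nextCode, Code.regs]), f₁.1 30 (by simp [hP₁, Code.regs]), hp]
  have ka : t₄.arr = s.arr := by
    funext a
    rw [f₄.2 a (by simp [domainCode, Code.arrs]), f₃.2 a (by simp [nextCode, Code.arrs]),
      f₂.2 a (by simp [nextCode, Code.arrs]), f₁.2 a (by simp [hP₁, Code.arrs])]
  have n4 := duplicateCode_spec (s := t₄) h₄.size (by rw [k30]; exact hpN.2)
  set t₅ := duplicateCode.run t₄ with ht₅
  have f₅ : duplicateCode.Frame t₄ t₅ := Code.frame_run _ _
  have m31 : t₅.reg 31 = s.arr 0 i := (f₅.1 31 (by simp [duplicateCode, Code.regs])).trans k31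
  have m32 : t₅.reg 32 = s.arr 0 j := (f₅.1 32 (by simp [duplicateCode, Code.regs])).trans k32
  have m30 : t₅.reg 30 = p := (f₅.1 30 (by simp [duplicateCode, Code.regs])).trans k30
  have m35 : NextOf I.numbers (s.arr 0 i) (t₅.reg 35) := by
    rw [f₅.1 35 (by simp [duplicateCode, Code.regs]), f₄.1 35 (by simp [domainCode, Code.regs]),
      f₃.1 35 (by simp [nextCode, Code.regs]), ← x31]
    exact n1
  have m36 : NextOf I.numbers (s.arr 0 j) (t₅.reg 36) := by
    rw [f₅.1 36 (by simp [duplicateCode, Code.regs]), f₄.1 36 (by simp [domainCode, Code.regs]),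
      ← x32, ← f₂.1 32 (by simp [nextCode, Code.regs])]
    exact n2
  have ma : t₅.arr = s.arr := by
    funext a; rw [f₅.2 a (by simp [duplicateCode, Code.arrs]), ka]
  have m33 : t₅.reg 33 = 1 ↔ ((s.arr 0 i, s.arr 0 j) : Cell) ∈ I.domain.cells ∧
      ∀ q', 0 ≤ q' → q' < p → ¬ (s.arr 2 q' = s.arr 0 i ∧ s.arr 3 q' = s.arr 0 j) := by
    rw [k30, k31, k32, ka] at n4
    rw [k31', k32'] at n3
    rcases n4 with ⟨d1, q, d2, d3, d4⟩ | ⟨d1, d2⟩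
    · refine iff_of_false (by omega) fun hh => hh.2 q d2 d3 d4
    · rw [d1]
      rcases n3 with ⟨e1, e2⟩ | ⟨e1, e2⟩
      · exact iff_of_true e1 ⟨e2, d2⟩
      · exact iff_of_false (by omega) fun hh => e2 hh.1
  have erun : vertexCode.run s = (Code.store 2 (.reg 30) (.reg 31) ;; .store 3 (.reg 30) (.reg 32) ;;
      .store 4 (.reg 30) (.reg 35) ;; .store 5 (.reg 30) (.reg 36) ;;
      .store 6 (.reg 30) (.reg 33) ;; .assign 30 (.add (.reg 30) (.const 1))).run t₅ := rfl
  have a2 : (vertexCode.run s).arr 2 = Function.update (s.arr 2) p (s.arr 0 i) := by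
    rw [erun]; simp [Expr.eval, State.arr_setArr, m30, m31, ma]
  have a3 : (vertexCode.run s).arr 3 = Function.update (s.arr 3) p (s.arr 0 j) := by
    rw [erun]; simp [Expr.eval, State.arr_setArr, m30, m32, ma]
  have a4 : (vertexCode.run s).arr 4 = Function.update (s.arr 4) p (t₅.reg 35) := by
    rw [erun]; simp [Expr.eval, State.arr_setArr, m30, ma]
  have a5 : (vertexCode.run s).arr 5 = Function.update (s.arr 5) p (t₅.reg 36) := by
    rw [erun]; simp [Expr.eval, State.arr_setArr, m30, ma]
  have a6 : (vertexCode.run s).arr 6 = Function.update (s.arr 6) p (t₅.reg 33) := by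
    rw [erun]; simp [Expr.eval, State.arr_setArr, m30, ma]
  refine ⟨?_, by rw [erun]; simp [Expr.eval, m30], a2, a3⟩
  intro q q1 q2
  rw [a2, a3, a4, a5, a6]
  by_cases e : q = p
  · subst e
    simp only [Function.update_self]
    refine ⟨⟨(h.numbers _).2 ⟨i, hiL.1, hiL.2, rfl⟩, (h.numbers _).2 ⟨j, hjL.1, hjL.2, rfl⟩⟩,
      m35, m36, m33.trans ?_⟩
    refine and_congr_right fun _ => forall_congr' fun q' => forall_congr' fun _ =>
      forall_congr' fun hq' => ?_
    rw [Function.update_of_ne (by omega), Function.update_of_ne (by omega)]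
  · simp only [Function.update_of_ne e]
    obtain ⟨b1, b2, b3, b4⟩ := hb q q1 (by omega)
    refine ⟨b1, b2, b3, b4.trans ?_⟩
    refine and_congr_right fun _ => forall_congr' fun q' => forall_congr' fun _ =>
      forall_congr' fun hq' => ?_
    rw [Function.update_of_ne (by omega), Function.update_of_ne (by omega)]

/-- All pairs of input positions become vertices, so a point may occur repeatedly when numbers do.
Only its first occurrence in the domain is marked alive. -/
theorem buildCode_spec (h : Input I s) :
    Built I (I.encode.length * I.encode.length : ℕ) (buildCode.run s) ∧
    ∀ x ∈ I.numbers, ∀ y ∈ I.numbers, ∃ q : ℤ, 0 ≤ q ∧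
      q < (I.encode.length * I.encode.length : ℕ) ∧ (buildCode.run s).arr 2 q = x ∧
      (buildCode.run s).arr 3 q = y := by
  set L := I.encode.length with hL
  set s₁ := (Code.assign 30 (.const 0)).run s with hs₁
  have h₁ : Input I s₁ := h.congr (by simp [hs₁]) rfl
  have hregs : ∀ x ∈ [1, 2, 3, 4, 5, 6, 18], x ∉ (Code.loop 20 1 (.loop 21 1 vertexCode)).regs := by
    simp [Code.regs, vertexCode, nextCode, domainCode, duplicateCode]
  have harrs : 0 ∉ (Code.loop 20 1 (.loop 21 1 vertexCode)).arrs := by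
    simp [Code.arrs, vertexCode, nextCode, domainCode, duplicateCode]
  have hregs' : ∀ x ∈ [1, 2, 3, 4, 5, 6, 18, 20], x ∉ (Code.loop 21 1 vertexCode).regs := by
    simp [Code.regs, vertexCode, nextCode, domainCode, duplicateCode]
  -- The pairs are visited in lexicographic order: `k` full rows and `k'` entries of the next row
  -- are done. The end of a row is the state `(k + 1, 0)`.
  let Cov : ℕ → ℕ → State → Prop := fun k k' t => t.reg 30 = ((k * L + k' : ℕ) : ℤ) ∧
    Built I ((k * L + k' : ℕ) : ℤ) t ∧ ∀ i j : ℤ, 0 ≤ i → 0 ≤ j → j < L →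
      (i < k ∨ (i = k ∧ j < k')) → ∃ q : ℤ, 0 ≤ q ∧ q < ((k * L + k' : ℕ) : ℤ) ∧
        t.arr 2 q = s₁.arr 0 i ∧ t.arr 3 q = s₁.arr 0 j
  have hset : ∀ k k' t c v, c ≠ 30 → Cov k k' t → Cov k k' (t.setReg c v) := by
    rintro k k' t c v hc ⟨c1, c2, c3⟩
    exact ⟨by simpa [hc.symm] using c1, c2, c3⟩
  have key : Cov L 0 ((Code.loop 20 1 (.loop 21 1 vertexCode)).run s₁) := by
    refine Code.loop_inv (c := 20) (P := .loop 21 1 vertexCode) h₁.length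
      (fun k t => Cov k 0 t) ?_ ?_
    · refine hset _ _ _ _ _ (by decide) ⟨by simp [hs₁, Expr.eval], ?_, ?_⟩
      · intro q q1 q2; simp at q2; omega
      · intro i j i1 j1 j2 hij; simp at hij; omega
    · intro k hk t ht hfr ih
      have ht' : Input I t := h₁.of_frame hfr hregs harrs
      have e0 : t.arr 0 = s₁.arr 0 := hfr.2 0 harrs
      have inner : Cov k L ((Code.loop 21 1 vertexCode).run t) := by
        refine Code.loop_inv (c := 21) (P := vertexCode) ht'.length
          (fun k' t => Cov k k' t) (hset _ _ _ _ _ (by decide) ih) ?_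
        rintro k' hk' u hu hfr' ⟨c1, c2, c3⟩
        have hu' : Input I u := ht'.of_frame hfr' (fun x hx => hregs' x (by
          simp only [List.mem_cons, List.not_mem_nil, or_false] at hx ⊢; tauto)) harrs
        have u20 : u.reg 20 = k := (hfr'.1 20 (hregs' 20 (by simp))).trans ht
        have u0 : u.arr 0 = s₁.arr 0 := (hfr'.2 0 harrs).trans e0
        have hle : k * L + k' ≤ L * L := by
          have : (k + 1) * L ≤ L * L := Nat.mul_le_mul_right _ hk
          have : (k + 1) * L = k * L + L := by ring
          omega
        obtain ⟨d1, d2, d3, d4⟩ := vertexCode_spec hu' u20 hu c1 ⟨by omega, by omega⟩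
          ⟨by omega, by omega⟩ ⟨by omega, by exact_mod_cast hle⟩ c2
        rw [u0] at d3 d4
        have ecast : (((k * L + (k' + 1) : ℕ)) : ℤ) = ((k * L + k' : ℕ) : ℤ) + 1 := by push_cast; ring
        refine hset _ _ _ _ _ (by decide) ⟨by rw [d2, ecast], by rw [ecast]; exact d1, ?_⟩
        intro i j i1 j1 j2 hij
        rw [d3, d4, ecast]
        by_cases hnew : i = k ∧ j = k'
        · obtain ⟨rfl, rfl⟩ := hnew
          exact ⟨((k * L + k' : ℕ) : ℤ), by omega, by omega, by simp, by simp⟩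
        · obtain ⟨q, q1, q2, q3, q4⟩ := c3 i j i1 j1 j2 (by push_cast at hij; omega)
          refine ⟨q, q1, by omega, ?_, ?_⟩
          · rw [Function.update_of_ne (by omega), q3]
          · rw [Function.update_of_ne (by omega), q4]
      obtain ⟨c1, c2, c3⟩ := inner
      have ecast : k * L + L = (k + 1) * L + 0 := by ring
      refine hset _ _ _ _ _ (by decide) ⟨by rw [c1, ecast], by rw [← ecast]; exact c2, ?_⟩
      intro i j i1 j1 j2 hij
      rw [← ecast]
      exact c3 i j i1 j1 j2 (by push_cast at hij; omega)
  obtain ⟨c1, c2, c3⟩ := key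
  refine ⟨c2, fun x hx y hy => ?_⟩
  obtain ⟨i, i1, i2, rfl⟩ := (h₁.numbers x).1 hx
  obtain ⟨j, j1, j2, rfl⟩ := (h₁.numbers y).1 hy
  exact c3 i j i1 j1 j2 (Or.inl i2)

theorem Built.vertices {N : ℕ} (hb : Built I N s)
    (hc : ∀ x ∈ I.numbers, ∀ y ∈ I.numbers, ∃ q : ℤ, 0 ≤ q ∧ q < N ∧ s.arr 2 q = x ∧ s.arr 3 q = y) :
    Vertices N (fun q => (s.arr 2 q, s.arr 3 q)) (s.arr 6) (gridPoints I.numbers I.domain) := by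
  constructor
  · intro p q p1 p2 p3 q1 q2 q3 e
    rw [Prod.mk.injEq] at e
    have bp := (hb p p1 p2).2.2.2.1 p3
    have bq := (hb q q1 q2).2.2.2.1 q3
    rcases lt_trichotomy p q with hlt | rfl | hlt
    · exact absurd e (bq.2 p p1 hlt)
    · rfl
    · exact absurd ⟨e.1.symm, e.2.symm⟩ (bp.2 q q1 hlt)
  · rintro ⟨x, y⟩
    constructor
    · rintro ⟨hx, hy, hd⟩
      classical
      have hex : ∃ k : ℕ, k < N ∧ s.arr 2 k = x ∧ s.arr 3 k = y := by
        obtain ⟨q, q1, q2, q3⟩ := hc x hx y hy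
        lift q to ℕ using q1
        exact ⟨q, by omega, q3⟩
      obtain ⟨k1, k2, k3⟩ := Nat.find_spec hex
      -- The representative is the first occurrence; minimality is exactly the condition under which
      -- `Built` marks a vertex alive.
      refine ⟨(Nat.find hex : ℕ), by omega, by omega, ?_, by simp [k2, k3]⟩
      refine (hb _ (by omega) (by omega)).2.2.2.2 ⟨by rw [k2, k3]; exact hd, fun q' h1 h2 h3 => ?_⟩
      lift q' to ℕ using h1
      exact Nat.find_min hex (m := q') (by omega) ⟨by omega, h3.1.trans k2, h3.2.trans k3⟩
    · rintro ⟨q, q1, q2, q3, e⟩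
      rw [Prod.mk.injEq] at e
      obtain ⟨rfl, rfl⟩ := e
      obtain ⟨b1, _, _, b4⟩ := hb q q1 q2
      exact ⟨b1.1, b1.2, (b4.1 q3).1⟩

/-- Mark the vertices at the cells that are listed in the input from index `reg b` on. -/
def flagCode (b f : ℕ) : Code :=
  .assign 34 (.reg b) ;;
  .loop 20 2 (.loop 21 4 (.ite (.and (.eq (.get 2 (.reg 21)) (.get 0 (.reg 34)))
      (.eq (.get 3 (.reg 21)) (.get 0 (.add (.reg 34) (.const 1)))))
      (.store f (.reg 21) (.add (.reg 20) (.const 1))) .skip) ;;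
    .assign 34 (.add (.reg 34) (.const 2)))

theorem flagCode_spec {n N : ℕ} (hn : s.reg 2 = n) (hN : s.reg 4 = N) {b f : ℕ}
    (hf : f = 7 ∨ f = 8) {pos : Fin n → Cell}
    (hpos : ∀ i : Fin n, pos i = (s.arr 0 (s.reg b + 2 * (i : ℕ)), s.arr 0 (s.reg b + 2 * (i : ℕ) + 1)))
    (hz : ∀ q, s.arr f q = 0) (alive : ℤ → ℤ) :
    Flags N (fun q => (s.arr 2 q, s.arr 3 q)) alive (((flagCode b f).run s).arr f) Finset.univ pos := by
  have hf0 : 0 ≠ f := by omega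
  have hf2 : 2 ≠ f := by omega
  have hf3 : 3 ≠ f := by omega
  let Fl : ℕ → State → ℤ → Prop := fun k t q =>
    (t.arr f q = 0 ∧ ∀ i : Fin n, (i : ℕ) < k → pos i ≠ (s.arr 2 q, s.arr 3 q)) ∨
    ∃ i : Fin n, (i : ℕ) < k ∧ pos i = (s.arr 2 q, s.arr 3 q) ∧ t.arr f q = ((i : ℕ) : ℤ) + 1
  set s₁ := (Code.assign 34 (.reg b)).run s with hs₁
  set body : Code := .ite (.and (.eq (.get 2 (.reg 21)) (.get 0 (.reg 34)))
      (.eq (.get 3 (.reg 21)) (.get 0 (.add (.reg 34) (.const 1)))))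
      (.store f (.reg 21) (.add (.reg 20) (.const 1))) .skip with hbody
  have key := Code.loop_inv (s := s₁) (c := 20) (b := 2)
    (P := .loop 21 4 body ;; .assign 34 (.add (.reg 34) (.const 2))) (K := n)
    (by simpa [hs₁] using hn)
    (fun k t => t.reg 34 = s.reg b + 2 * k ∧ ∀ q : ℤ, 0 ≤ q → q < N → Fl k t q)
    ⟨by simp [hs₁, Expr.eval], fun q _ _ => Or.inl ⟨by simpa [hs₁] using hz q, by simp⟩⟩ ?_
  · intro q q1 q2 _
    rcases key.2 q q1 q2 with ⟨h1, h2⟩ | ⟨i, h1, h2, h3⟩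
    · exact Or.inl ⟨h1, fun i _ => h2 i i.2⟩
    · exact Or.inr ⟨i, Finset.mem_univ i, h2, h3⟩
  · rintro k hk t ht hfr ⟨i1, i2⟩
    have e0 : t.arr 0 = s.arr 0 := by rw [hfr.2 0 (by simp [Code.arrs, hbody, hf0])]; simp [hs₁]
    have e2 : t.arr 2 = s.arr 2 := by rw [hfr.2 2 (by simp [Code.arrs, hbody, hf2])]; simp [hs₁]
    have e3 : t.arr 3 = s.arr 3 := by rw [hfr.2 3 (by simp [Code.arrs, hbody, hf3])]; simp [hs₁]
    have t4 : t.reg 4 = N := by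
      rw [hfr.1 4 (by simp [Code.regs, hbody])]; simpa [hs₁] using hN
    have hposk := hpos ⟨k, hk⟩
    dsimp only at hposk
    -- During the pass for cell number `k`, vertices before the counter already account for it and
    -- those behind do not yet.
    have inner := Code.loop_inv (s := t) (c := 21) (b := 4) (P := body) t4
      (fun k' u => ∀ q : ℤ, 0 ≤ q → q < N → (q < k' → Fl (k + 1) u q) ∧ (k' ≤ q → Fl k u q))
      (fun q q1 q2 => ⟨fun h => by simp only [Nat.cast_zero] at h; omega, fun _ => i2 q q1 q2⟩) ?_
    · have r34 : ((Code.loop 21 4 body).run t).reg 34 = t.reg 34 :=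
        Code.run_reg _ (by simp [Code.regs, hbody])
      refine ⟨by simp [Expr.eval, r34, i1]; ring, fun q q1 q2 => ?_⟩
      exact (inner q q1 q2).1 q2
    · intro k' hk' u hu hfr' ih q q1 q2
      have u20 : u.reg 20 = k := (hfr'.1 20 (by simp [Code.regs, hbody])).trans ht
      have u34 : u.reg 34 = s.reg b + 2 * k := (hfr'.1 34 (by simp [Code.regs, hbody])).trans i1
      have u0 : u.arr 0 = s.arr 0 := (hfr'.2 0 (by simp [Code.arrs, hbody, hf0])).trans e0
      have u2 : u.arr 2 = s.arr 2 := (hfr'.2 2 (by simp [Code.arrs, hbody, hf2])).trans e2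
      have u3 : u.arr 3 = s.arr 3 := (hfr'.2 3 (by simp [Code.arrs, hbody, hf3])).trans e3
      obtain ⟨j1, j2⟩ := ih q q1 q2
      rw [hbody, Code.run_ite]
      by_cases hc : pos ⟨k, hk⟩ = (s.arr 2 k', s.arr 3 k')
      · have hc' := hc
        rw [hposk, Prod.mk.injEq] at hc'
        rw [if_pos (by simp [Expr.eval, u34, u0, u2, u3, hu, hc'.1, hc'.2])]
        have eu : (((Code.store f (.reg 21) (.add (.reg 20) (.const 1))).run u).setReg 21
            ((k' : ℤ) + 1)).arr f = Function.update (u.arr f) k' (k + 1) := by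
          simp [Expr.eval, hu, u20]
        by_cases e : q = k'
        · subst e
          refine ⟨fun _ => Or.inr ⟨⟨k, hk⟩, by simp, hc, ?_⟩, fun h => by push_cast at h; omega⟩
          rw [eu, Function.update_self]
        · have eq : (((Code.store f (.reg 21) (.add (.reg 20) (.const 1))).run u).setReg 21
            ((k' : ℤ) + 1)).arr f q = u.arr f q := by rw [eu, Function.update_of_ne e]
          refine ⟨fun h => ?_, fun h => ?_⟩
          · have := j1 (by push_cast at h; omega)
            simp only [Fl, eq]
            exact this
          · have := j2 (by push_cast at h; omega)
            simp only [Fl, eq]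
            exact this
      · have hc' := hc
        rw [hposk, Prod.mk.injEq] at hc'
        rw [if_neg (by
          simp only [Test.eval_and, Test.eval_eq, Expr.eval, u34, u0, u2, u3, hu]
          exact fun h => hc' ⟨h.1.symm, h.2.symm⟩)]
        refine ⟨fun h => ?_, fun h => j2 (by push_cast at h; omega)⟩
        by_cases e : q = k'
        · subst e
          rcases j2 le_rfl with ⟨l1, l2⟩ | ⟨i, l1, l2⟩
          · refine Or.inl ⟨l1, fun i hi => ?_⟩
            rcases Nat.lt_succ_iff_lt_or_eq.1 hi with hi | hi
            · exact l2 i hi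
            · have : i = ⟨k, hk⟩ := Fin.ext hi
              rw [this]; exact hc
          · exact Or.inr ⟨i, by omega, l2⟩
        · exact j1 (by push_cast at h; omega)

end

end SquareReconfig

namespace SquareReconfig

/-! ### The whole program -/

/-- Build the grid of all coordinates that occur in the input and eliminate its vertices. -/
def solveCode : Code :=
  buildCode ;; flagCode 5 7 ;; flagCode 6 8 ;; .loop 23 4 stepCode ;; lengthCode

/-- The program has separate phases because `Ok` forbids writing a loop bound within a phase:
register 4 is computed in the first phase and used in the second, register 19 is computed in the
second and used in the third. -/
def solver : Program :=
  .seq (.assign 1 (.reg 0))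
    (.seq parseCode.toProgram (.seq solveCode.toProgram (copyCode ;; headCode).toProgram))

/-- A bound on the running time in terms of the number of integers in the input. -/
noncomputable def solverCost : Polynomial ℕ :=
  1 + (parseCode.cost + (solveCode.cost.comp (Polynomial.X * Polynomial.X) +
    (copyCode ;; headCode).cost.comp
      (Polynomial.X * (2 + 2 * (Polynomial.X * Polynomial.X)))))

theorem parseCode_ok : parseCode.Ok [1] := by decide

theorem solveCode_ok : solveCode.Ok [1, 2, 3, 4] := by decide

theorem outputCode_ok : (copyCode ;; headCode).Ok [19] := by decide

theorem solveCode_spec {I : Instance} {s : State} (h : Input I s) (h0 : s.reg 0 = 2)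
    (hr : s.reg 8 = 0 ∧ s.reg 9 = 0 ∧ s.reg 10 = 0)
    (ha : ∀ q, s.arr 7 q = 0 ∧ s.arr 8 q = 0 ∧ s.arr 12 q = 0) :
    ((solveCode.run s).reg 19 ≤
      ((I.n * (2 + 2 * (I.encode.length * I.encode.length)) : ℕ) : ℤ)) ∧
    ∃ a, I.IsCorrectAnswer a ∧
      ((copyCode ;; headCode).run (solveCode.run s)).output = encodeAnswer a := by
  set N := I.encode.length * I.encode.length with hN
  set s₁ := buildCode.run s with hs₁
  set s₂ := (flagCode 5 7).run s₁ with hs₂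
  set s₃ := (flagCode 6 8).run s₂ with hs₃
  obtain ⟨hb, hc⟩ := buildCode_spec h
  have hf₁ : buildCode.Frame s s₁ := Code.frame_run _ _
  have hf₂ : (flagCode 5 7).Frame s₁ s₂ := Code.frame_run _ _
  have hf₃ : (flagCode 6 8).Frame s₂ s₃ := Code.frame_run _ _
  have r₁ : ∀ x ∈ [0, 1, 2, 3, 4, 5, 6, 8, 9, 10, 18], s₁.reg x = s.reg x := fun x hx =>
    hf₁.1 x ((by decide : ∀ x ∈ [0, 1, 2, 3, 4, 5, 6, 8, 9, 10, 18], x ∉ buildCode.regs) x hx)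
  have r₂ : ∀ x ∈ [0, 1, 2, 3, 4, 5, 6, 8, 9, 10, 18], s₂.reg x = s₁.reg x := fun x hx =>
    hf₂.1 x ((by decide : ∀ x ∈ [0, 1, 2, 3, 4, 5, 6, 8, 9, 10, 18], x ∉ (flagCode 5 7).regs) x hx)
  have r₃ : ∀ x ∈ [0, 1, 2, 3, 4, 5, 6, 8, 9, 10, 18], s₃.reg x = s₂.reg x := fun x hx =>
    hf₃.1 x ((by decide : ∀ x ∈ [0, 1, 2, 3, 4, 5, 6, 8, 9, 10, 18], x ∉ (flagCode 6 8).regs) x hx)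
  have a₁ : ∀ a ∈ [0, 7, 8, 12], s₁.arr a = s.arr a := fun a ha =>
    hf₁.2 a ((by decide : ∀ a ∈ [0, 7, 8, 12], a ∉ buildCode.arrs) a ha)
  have a₂ : ∀ a ∈ [0, 2, 3, 4, 5, 6, 8, 12], s₂.arr a = s₁.arr a := fun a ha =>
    hf₂.2 a ((by decide : ∀ a ∈ [0, 2, 3, 4, 5, 6, 8, 12], a ∉ (flagCode 5 7).arrs) a ha)
  have a₃ : ∀ a ∈ [0, 2, 3, 4, 5, 6, 7, 12], s₃.arr a = s₂.arr a := fun a ha =>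
    hf₃.2 a ((by decide : ∀ a ∈ [0, 2, 3, 4, 5, 6, 7, 12], a ∉ (flagCode 6 8).arrs) a ha)
  have h₁ : Input I s₁ := h.congr (fun x hx => r₁ x (by simp at hx ⊢; tauto)) (a₁ 0 (by simp))
  have h₂ : Input I s₂ := h₁.congr (fun x hx => r₂ x (by simp at hx ⊢; tauto)) (a₂ 0 (by simp))
  have hfl₁ := flagCode_spec (n := I.n) h₁.count h₁.size (b := 5) (f := 7) (Or.inl rfl) h₁.start
    (fun q => by rw [a₁ 7 (by simp)]; exact (ha q).1) (s₁.arr 6)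
  have hfl₂ := flagCode_spec (n := I.n) h₂.count h₂.size (b := 6) (f := 8) (Or.inr rfl) h₂.target
    (fun q => by rw [a₂ 8 (by simp), a₁ 8 (by simp)]; exact (ha q).2.1) (s₂.arr 6)
  rw [← hs₂] at hfl₁
  rw [← hs₃] at hfl₂
  have ev : (fun q => (s₃.arr 2 q, s₃.arr 3 q)) = fun q => (s₁.arr 2 q, s₁.arr 3 q) := by
    rw [a₃ 2 (by simp), a₃ 3 (by simp), a₂ 2 (by simp), a₂ 3 (by simp)]
  have hv := hb.vertices hc
  have hM : Memory I I.numbers N (fun q => (s₃.arr 2 q, s₃.arr 3 q))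
      (gridPoints I.numbers I.domain) Finset.univ Finset.univ [] [] s₃ := by
    refine ⟨⟨?_, fun q => rfl, ?_, ?_⟩, ?_, ?_, ?_, ?_, ?_, ?_, trivial, ?_, trivial, ?_, by simp⟩
    · rw [r₃ 4 (by simp)]; exact h₂.size
    · intro q q1 q2
      rw [congrFun ev q, a₃ 4 (by simp), a₂ 4 (by simp)]
      exact (hb q q1 q2).2.1
    · intro q q1 q2
      rw [congrFun ev q, a₃ 5 (by simp), a₂ 5 (by simp)]
      exact (hb q q1 q2).2.2.1
    · rw [ev, a₃ 6 (by simp), a₂ 6 (by simp)]; exact hv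
    · rw [ev, a₃ 6 (by simp), a₂ 6 (by simp), a₃ 7 (by simp)]; exact hfl₁
    · rw [a₃ 6 (by simp), a₃ 2 (by simp), a₃ 3 (by simp)]; exact hfl₂
    · rw [r₃ 8 (by simp), r₂ 8 (by simp), r₁ 8 (by simp)]; exact hr.1
    · rw [r₃ 9 (by simp), r₂ 9 (by simp), r₁ 9 (by simp)]; exact hr.2.1
    · rw [r₃ 0 (by simp), r₂ 0 (by simp), r₁ 0 (by simp)]; exact h0
    · rw [r₃ 10 (by simp), r₂ 10 (by simp), r₁ 10 (by simp)]; exact hr.2.2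
    · intro q
      rw [a₃ 12 (by simp), a₂ 12 (by simp), a₁ 12 (by simp)]; exact (ha q).2.2
  have hE := stepLoop_spec I.numbers_finite I.covers I.start_mem_gridPoints I.target_mem_gridPoints
    (Elimination.init I I.numbers I.start_mem_gridPoints I.target_mem_gridPoints) hM
  exact ⟨lengthCode_le hE, answerCode_spec hE⟩

theorem length_le_bitLength (l : List ℤ) : l.length ≤ bitLength l := by
  induction l with
  | nil => simp
  | cons a l ih => simp only [bitLength, List.map_cons, List.sum_cons, List.length_cons] at ih ⊢; omega

theorem Instance.n_le_length_encode (I : Instance) : I.n ≤ I.encode.length := by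
  simp only [Instance.encode, List.length_append, List.length_cons, length_encodeCells,
    List.length_ofFn]
  omega

/-- Coefficients are natural numbers. This passes from a time bound in the number of integers to one
in the bit length. -/
theorem eval_mono_nat (p : Polynomial ℕ) {a b : ℕ} (h : a ≤ b) : p.eval a ≤ p.eval b := by
  rw [Polynomial.eval_eq_sum, Polynomial.eval_eq_sum]
  exact Finset.sum_le_sum fun i _ => Nat.mul_le_mul_left _ (Nat.pow_le_pow_left h i)

theorem solver_spec (I : Instance) : ∃ (t : ℕ) (s : State),
    Exec solver (State.init I.encode) t s ∧ t ≤ solverCost.eval (bitLength I.encode) ∧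
    ∃ a : Option (List (GridMove I.n)), s.output = encodeAnswer a ∧ I.IsCorrectAnswer a := by
  set L := I.encode.length with hL
  set s₀ := State.init I.encode with hs₀
  set s₁ := s₀.setReg 1 L with hs₁
  set s₂ := parseCode.run s₁ with hs₂
  set s₃ := solveCode.run s₂ with hs₃
  obtain ⟨hI, h0⟩ := parseCode_spec I (s := s₁) (by simp [hs₁, hL]) (by simp [hs₁, hs₀, State.init])
    (by rw [hs₁, hs₀]; rfl)
  have hf : parseCode.Frame s₁ s₂ := Code.frame_run _ _
  have r : ∀ x ∈ [8, 9, 10], s₂.reg x = 0 := fun x hx => by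
    rw [hf.1 x ((by decide : ∀ x ∈ [8, 9, 10], x ∉ parseCode.regs) x hx)]
    simp at hx
    simp [hs₁, hs₀, State.init]; omega
  have ha : ∀ a ∈ [7, 8, 12], ∀ q, s₂.arr a q = 0 := fun a ha q => by
    rw [hf.2 a ((by decide : ∀ a ∈ [7, 8, 12], a ∉ parseCode.arrs) a ha)]
    simp at ha
    simp [hs₁, hs₀, State.init]; omega
  obtain ⟨h19, a, a1, a2⟩ := solveCode_spec hI h0 ⟨r 8 (by simp), r 9 (by simp), r 10 (by simp)⟩
    fun q => ⟨ha 7 (by simp) q, ha 8 (by simp) q, ha 12 (by simp) q⟩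
  have hn := I.n_le_length_encode
  obtain ⟨m, m1, m2⟩ := hI.cells
  have hpos : 1 ≤ L := by
    simp only [hL, Instance.encode, List.length_append, List.length_cons]; omega
  have hLL : L ≤ L * L := Nat.le_mul_of_pos_left L hpos
  -- The loop bounds of the three phases are at most `L`, `L * L` vertices, and the length of the
  -- encoded final moves, respectively.
  obtain ⟨t₁, e₁, l₁⟩ := Code.exec (s := s₁) (M := L) parseCode_ok (by simp [hs₁])
  obtain ⟨t₂, e₂, l₂⟩ := Code.exec (s := s₂) (M := L * L) solveCode_ok (by
    have c1 := hI.length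
    have c2 := hI.count
    have c4 := hI.size
    rw [← hL] at c1 c4 hn
    simp only [List.mem_cons, List.not_mem_nil, or_false, forall_eq_or_imp, forall_eq]
    rw [c1, c2, c4, m1]
    refine ⟨?_, ?_, ?_, le_rfl⟩ <;> exact_mod_cast by omega)
  obtain ⟨t₃, e₃, l₃⟩ := Code.exec (s := s₃) (M := L * (2 + 2 * (L * L))) outputCode_ok (by
    simp only [List.mem_cons, List.not_mem_nil, or_false, forall_eq]
    refine h19.trans ?_
    exact_mod_cast Nat.mul_le_mul_right _ hn)
  have e₀ : Exec (.assign 1 (.reg 0)) s₀ 1 s₁ := by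
    have := Exec.assign 1 (.reg 0) s₀
    rwa [show (Expr.reg 0).eval s₀ = L by simp [Expr.eval, hs₀, State.init, hL]] at this
  refine ⟨_, _, Exec.seq e₀ (Exec.seq e₁ (Exec.seq e₂ e₃)), ?_, a, a2, a1⟩
  refine le_trans ?_ (eval_mono_nat solverCost (length_le_bitLength I.encode))
  rw [← hL]
  simp only [solverCost, Polynomial.eval_add, Polynomial.eval_comp, Polynomial.eval_mul,
    Polynomial.eval_X, Polynomial.eval_one, Polynomial.eval_ofNat]
  omega

end SquareReconfig

namespace SquareReconfig
open Relation

/-! ### Weights on pairs of cells, paths and cycles -/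

/-- The number of times that the walk from `a` through `l` uses the step from `u` to `v`. -/
def stepCount (a : Cell) (l : List Cell) (u v : Cell) : ℕ := ((a :: l).zip l).count (u, v)

theorem stepCount_nil (a u v : Cell) : stepCount a [] u v = 0 := rfl

theorem stepCount_cons (a b : Cell) (l : List Cell) (u v : Cell) :
    stepCount a (b :: l) u v = stepCount b l u v + if a = u ∧ b = v then 1 else 0 := by
  rw [stepCount, List.zip_cons_cons, List.count_cons, stepCount]
  simp only [beq_iff_eq, Prod.mk.injEq]

/-- Walks are handled through the numbers of uses of their edges, which is the form in which weights
are reduced. -/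
theorem isChain_iff_stepCount {R : Cell → Cell → Prop} {a : Cell} {l : List Cell} :
    List.IsChain R (a :: l) ↔ ∀ u v, stepCount a l u v ≠ 0 → R u v := by
  induction l generalizing a with
  | nil => simp [stepCount_nil]
  | cons b l ih =>
    rw [List.isChain_cons_cons, ih]
    constructor
    · rintro ⟨h1, h2⟩ u v h
      rw [stepCount_cons] at h
      by_cases e : a = u ∧ b = v
      · rw [← e.1, ← e.2]; exact h1
      · exact h2 u v (by simpa [e] using h)
    · intro h
      refine ⟨h a b (by simp [stepCount_cons]), fun u v huv => h u v ?_⟩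
      rw [stepCount_cons]; omega

theorem stepCount_eq_zero {a : Cell} {l : List Cell} {u v : Cell} (h : u ∉ a :: l ∨ v ∉ l) :
    stepCount a l u v = 0 := by
  rw [stepCount, List.count_eq_zero]
  intro hm
  have := List.of_mem_zip hm
  tauto

theorem stepCount_le_one {a : Cell} {l : List Cell} (h : l.Nodup) (u v : Cell) :
    stepCount a l u v ≤ 1 := by
  induction l generalizing a with
  | nil => simp [stepCount_nil]
  | cons b l ih =>
    rw [List.nodup_cons] at h
    rw [stepCount_cons]
    split
    · rename_i e
      rw [stepCount_eq_zero (Or.inr (e.2 ▸ h.1))]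
    · exact ih h.2

/-- Conservation along a walk. -/
theorem stepCount_conservation {a : Cell} {l : List Cell}
    (h : List.IsChain (fun u v => v ∈ nbrs u) (a :: l)) (v : Cell) :
    (if a = v then 1 else 0) + ∑ u ∈ nbrs v, stepCount a l u v =
      (if l.getLastD a = v then 1 else 0) + ∑ u ∈ nbrs v, stepCount a l v u := by
  induction l generalizing a with
  | nil => simp [stepCount_nil]
  | cons b l ih =>
    rw [List.isChain_cons_cons] at h
    have := ih h.2
    simp only [stepCount_cons, Finset.sum_add_distrib, List.getLastD_cons]
    have e1 : ∑ u ∈ nbrs v, (if a = u ∧ b = v then 1 else 0) = if b = v then 1 else 0 := by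
      by_cases e : b = v
      · subst e
        simp [nbrs_comm.1 h.1]
      · simp [e]
    have e2 : ∑ u ∈ nbrs v, (if a = v ∧ b = u then 1 else 0) = if a = v then 1 else 0 := by
      by_cases e : a = v
      · subst e
        simp [h.1]
      · simp [e]
    rw [e1, e2]
    omega

/-- Zipping truncates to the shorter list. So the edges of a closed walk, given by rotation, are the
steps of the walk that returns to its first vertex. -/
theorem zip_append_singleton (a b : Cell) (l : List Cell) :
    (a :: l).zip (l ++ [b]) = (a :: (l ++ [b])).zip (l ++ [b]) := by
  induction l generalizing a with
  | nil => rfl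
  | cons c l ih => simp only [List.cons_append, List.zip_cons_cons, ih]

theorem count_cycleEdges (a : Cell) (l : List Cell) (u v : Cell) :
    (cycleEdges (a :: l)).count (u, v) = stepCount a (l ++ [a]) u v := by
  have : (a :: l).rotate 1 = l ++ [a] := by simp
  rw [cycleEdges, this, zip_append_singleton, stepCount]

theorem isPosCycle_cons {w : Cell → Cell → ℕ} {a : Cell} {l : List Cell} :
    IsPosCycle w (a :: l) ↔ (a :: l).Nodup ∧ List.IsChain (fun u v => 0 < w u v) (a :: (l ++ [a])) := by
  rw [isChain_iff_stepCount, IsPosCycle]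
  simp only [ne_eq, reduceCtorEq, not_false_eq_true, true_and]
  refine and_congr_right fun _ => ⟨fun h u v huv => ?_, fun h e he => ?_⟩
  · rw [← count_cycleEdges] at huv
    exact h _ (List.count_pos_iff.1 (Nat.pos_of_ne_zero huv))
  · refine h e.1 e.2 ?_
    rw [← count_cycleEdges]
    exact Nat.ne_of_gt (List.count_pos_iff.2 he)

/-- Conservation of weights, for supplies `s` and demands `d`. -/
def Conserves (s d : Cell → ℕ) (w : Cell → Cell → ℕ) : Prop :=
  ∀ v, s v + ∑ u ∈ nbrs v, w u v = d v + ∑ u ∈ nbrs v, w v u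

/-- Removing a walk changes supply at its first vertex and demand at its last one by 1. The bound
`hw` makes the truncated subtraction exact; a closed walk changes neither balance. -/
theorem Conserves.sub {s d s' d' : Cell → ℕ} {w : Cell → Cell → ℕ} (h : Conserves s d w)
    {a : Cell} {l : List Cell} (hl : List.IsChain (fun u v => v ∈ nbrs u) (a :: l))
    (hw : ∀ u v, stepCount a l u v ≤ w u v)
    (hsd : ∀ v, s v + d' v + (if l.getLastD a = v then 1 else 0) =
      s' v + d v + (if a = v then 1 else 0)) :
    Conserves s' d' (fun u v => w u v - stepCount a l u v) := by
  intro v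
  have h1 := h v
  have h2 := stepCount_conservation hl v
  have e1 : ∑ u ∈ nbrs v, (w u v - stepCount a l u v) + ∑ u ∈ nbrs v, stepCount a l u v =
      ∑ u ∈ nbrs v, w u v := by
    rw [← Finset.sum_add_distrib]
    exact Finset.sum_congr rfl fun u _ => Nat.sub_add_cancel (hw u v)
  have e2 : ∑ u ∈ nbrs v, (w v u - stepCount a l v u) + ∑ u ∈ nbrs v, stepCount a l v u =
      ∑ u ∈ nbrs v, w v u := by
    rw [← Finset.sum_add_distrib]
    exact Finset.sum_congr rfl fun u _ => Nat.sub_add_cancel (hw v u)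
  have h3 := hsd v
  dsimp only
  omega

/-- The edges of positive weight form a directed acyclic graph. -/
def Acyclic (w : Cell → Cell → ℕ) : Prop := ∀ l, ¬ IsPosCycle w l

theorem Acyclic.mono {w w' : Cell → Cell → ℕ} (h : Acyclic w) (hw : ∀ u v, w' u v ≤ w u v) :
    Acyclic w' := fun l hl =>
  h l ⟨hl.1, hl.2.1, fun e he => (hl.2.2 e he).trans_le (hw _ _)⟩

theorem Acyclic.notMem {w : Cell → Cell → ℕ} (h : Acyclic w) {u v : Cell} {l : List Cell}
    (hn : (v :: l).Nodup) (hl : List.IsChain (fun u v => 0 < w u v) (v :: l)) (huv : 0 < w u v) :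
    u ∉ v :: l := by
  intro hu
  obtain ⟨p, q, e⟩ := List.append_of_mem hu
  have hpu : (p ++ [u]) <+: (v :: l) := ⟨q, by rw [e]; simp⟩
  obtain ⟨p', hp'⟩ : ∃ p', p ++ [u] = v :: p' := by
    cases p with
    | nil => simp at e; exact ⟨[], by simp [e.1]⟩
    | cons x p => simp at e; exact ⟨p ++ [u], by simp [e.1]⟩
  -- The part of the path from `v` to `u`, closed by the edge from `u` to `v`, is a positive cycle.
  refine h (v :: p') (isPosCycle_cons.2 ⟨hp' ▸ hn.sublist hpu.sublist, ?_⟩)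
  rw [← List.cons_append, ← hp', List.isChain_append]
  refine ⟨hl.prefix hpu, List.isChain_singleton _, ?_⟩
  simpa using huv

theorem Acyclic.nodup {w : Cell → Cell → ℕ} (h : Acyclic w) {l : List Cell}
    (hl : List.IsChain (fun u v => 0 < w u v) l) : l.Nodup := by
  induction l with
  | nil => exact List.nodup_nil
  | cons u l ih =>
    have hn := ih hl.tail
    rw [List.nodup_cons]
    refine ⟨?_, hn⟩
    cases l with
    | nil => simp
    | cons v l =>
      rw [List.isChain_cons_cons] at hl
      exact h.notMem hn hl.2 hl.1

/-- Weights that are positive only between neighbouring cells of `A`. -/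
def Supported (A : Set Cell) (w : Cell → Cell → ℕ) : Prop :=
  ∀ u v, w u v ≠ 0 → u ∈ A ∧ v ∈ A ∧ v ∈ nbrs u

theorem Supported.mono {A : Set Cell} {w w' : Cell → Cell → ℕ} (h : Supported A w)
    (hw : ∀ u v, w' u v ≤ w u v) : Supported A w' := fun u v huv =>
  h u v (by have := hw u v; omega)

/-- Chains in an acyclic weight do not repeat vertices. At least two vertices are required, since a
single one is on no edge and need not belong to `A`. -/
theorem Acyclic.length_le {A : Set Cell} {w : Cell → Cell → ℕ} (h : Acyclic w)
    (hA : A.Finite) (hs : Supported A w) {a b : Cell} {l : List Cell}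
    (hl : List.IsChain (fun u v => 0 < w u v) (a :: b :: l)) : (a :: b :: l).length ≤ A.ncard := by
  have hsub : ∀ x ∈ a :: b :: l, x ∈ A := by
    have key : ∀ (l : List Cell) (b : Cell), b ∈ A →
        List.IsChain (fun u v => 0 < w u v) (b :: l) → ∀ x ∈ b :: l, x ∈ A := by
      intro l
      induction l with
      | nil => intro b hb _ x hx; rw [List.mem_singleton] at hx; exact hx ▸ hb
      | cons c l ih =>
        intro b hb hc x hx
        rw [List.isChain_cons_cons] at hc
        rcases List.mem_cons.1 hx with rfl | hx
        · exact hb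
        · exact ih c (hs b c hc.1.ne').2.1 hc.2 x hx
    exact key _ a (hs a b (List.isChain_cons_cons.1 hl).1.ne').1 hl
  classical
  rw [← List.toFinset_card_of_nodup (h.nodup hl), ← Set.ncard_coe_finset]
  exact Set.ncard_le_ncard (fun x hx => hsub x (by simpa using hx)) hA

theorem exists_isSink {A : Set Cell} {w : Cell → Cell → ℕ} (h : Acyclic w) (hA : A.Finite)
    (hs : Supported A w) {u v : Cell} (huv : 0 < w u v) : ∃ t, IsSink w t := by
  -- Extend a chain at its end for as long as possible. The number `k` counts the extensions left
  -- before the chain would have more vertices than `A`.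
  have key : ∀ (k : ℕ) (a b : Cell) (l : List Cell), l.length + 2 + k = A.ncard + 1 →
      List.IsChain (fun u v => 0 < w u v) (l ++ [a, b]) → ∃ t, IsSink w t := by
    intro k
    induction k with
    | zero =>
      intro a b l hk hc
      exfalso
      obtain ⟨x, y, l', e⟩ : ∃ x y l', l ++ [a, b] = x :: y :: l' := by
        cases l with
        | nil => exact ⟨a, b, [], rfl⟩
        | cons x l => cases l with
          | nil => exact ⟨x, a, [b], rfl⟩
          | cons y l => exact ⟨x, y, l ++ [a, b], rfl⟩
      have h1 := congrArg List.length e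
      rw [e] at hc
      have h2 := h.length_le hA hs hc
      simp only [List.length_append, List.length_cons, List.length_nil] at h1 h2
      omega
    | succ k ih =>
      intro a b l hk hc
      have hab : 0 < w a b := by
        rw [List.isChain_append] at hc
        exact (List.isChain_cons_cons.1 hc.2.1).1
      by_cases hb : ∀ x, w b x = 0
      · exact ⟨b, ⟨a, hab⟩, hb⟩
      · push Not at hb
        obtain ⟨x, hx⟩ := hb
        refine ih b x (l ++ [a]) (by simp; omega) ?_
        have e : l ++ [a] ++ [b, x] = (l ++ [a, b]) ++ [x] := by simp
        rw [e, List.isChain_append]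
        refine ⟨hc, List.isChain_singleton _, ?_⟩
        have : (l ++ [a, b]).getLast? = some b := by simp
        rw [this]
        simpa using Nat.pos_of_ne_zero hx
  have h2 := h.length_le hA hs (a := u) (b := v) (l := []) (by simpa using huv)
  exact key (A.ncard - 1) u v [] (by simp at h2 ⊢; omega) (by simpa using huv)

/-- Walk backwards from `t` and stop at the first vertex with `P`. Any other vertex reached has
outflow, so `hP` provides a way to continue, and acyclicity bounds the length. -/
theorem exists_path_to {A : Set Cell} {w : Cell → Cell → ℕ} (h : Acyclic w) (hA : A.Finite)
    (hs : Supported A w) (P : Cell → Prop) {t u : Cell} (ht : ¬ P t) (hut : 0 < w u t)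
    (hP : ∀ v x, ¬ P v → 0 < w v x → ∃ u, 0 < w u v) :
    ∃ (a : Cell) (l : List Cell), P a ∧ l.getLast? = some t ∧
      List.IsChain (fun u v => 0 < w u v) (a :: l) ∧ ∀ v ∈ l, ¬ P v := by
  have key : ∀ (k : ℕ) (a b : Cell) (l : List Cell), l.length + 2 + k = A.ncard + 1 →
      (b :: l).getLast? = some t → List.IsChain (fun u v => 0 < w u v) (a :: b :: l) →
      (∀ v ∈ b :: l, ¬ P v) →
      ∃ (a : Cell) (l : List Cell), P a ∧ l.getLast? = some t ∧
        List.IsChain (fun u v => 0 < w u v) (a :: l) ∧ ∀ v ∈ l, ¬ P v := by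
    intro k
    induction k with
    | zero =>
      intro a b l hk _ hc
      have h2 := h.length_le hA hs hc
      simp only [List.length_cons] at h2
      omega
    | succ k ih =>
      intro a b l hk hl hc hn
      by_cases ha : P a
      · exact ⟨a, b :: l, ha, hl, hc, hn⟩
      · obtain ⟨x, hx⟩ := hP a b ha (List.isChain_cons_cons.1 hc).1
        refine ih x a (b :: l) (by simp; omega) (by rw [List.getLast?_cons_cons]; exact hl)
          (List.isChain_cons_cons.2 ⟨hx, hc⟩) fun v hv => ?_
        rcases List.mem_cons.1 hv with rfl | hv
        · exact ha
        · exact hn v hv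
  have h2 := h.length_le hA hs (a := u) (b := t) (l := []) (by simpa using hut)
  exact key (A.ncard - 1) u t [] (by simp at h2 ⊢; omega) (by simp) (by simpa using hut)
    (by simpa using ht)

theorem sum_nbrs_left {A : Set Cell} {w : Cell → Cell → ℕ} (hs : Supported A w) {B : Finset Cell}
    (hB : ∀ z, z ∈ B ↔ z ∈ A) (v : Cell) : ∑ u ∈ nbrs v, w u v = ∑ u ∈ B, w u v := by
  classical
  rw [Finset.sum_subset (Finset.subset_union_left (s₂ := B)) fun u _ hu => ?_,
    ← Finset.sum_subset (Finset.subset_union_right (s₁ := nbrs v)) fun u _ hu => ?_]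
  · by_contra hne
    exact hu ((hB u).2 (hs u v hne).1)
  · by_contra hne
    exact hu (nbrs_comm.1 (hs u v hne).2.2)

theorem sum_nbrs_right {A : Set Cell} {w : Cell → Cell → ℕ} (hs : Supported A w) {B : Finset Cell}
    (hB : ∀ z, z ∈ B ↔ z ∈ A) (v : Cell) : ∑ u ∈ nbrs v, w v u = ∑ u ∈ B, w v u := by
  classical
  rw [Finset.sum_subset (Finset.subset_union_left (s₂ := B)) fun u _ hu => ?_,
    ← Finset.sum_subset (Finset.subset_union_right (s₁ := nbrs v)) fun u _ hu => ?_]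
  · by_contra hne
    exact hu ((hB u).2 (hs v u hne).2.1)
  · by_contra hne
    exact hu (hs v u hne).2.2

/-- Summed over all cells, every internal edge counts once as inflow and once as outflow, so total
supply equals total demand. -/
theorem Conserves.sum_eq {A : Set Cell} {s d : Cell → ℕ} {w : Cell → Cell → ℕ}
    (h : Conserves s d w) (hs : Supported A w) {B : Finset Cell} (hB : ∀ z, z ∈ B ↔ z ∈ A) :
    ∑ v ∈ B, s v = ∑ v ∈ B, d v := by
  have h1 : ∑ v ∈ B, (s v + ∑ u ∈ nbrs v, w u v) = ∑ v ∈ B, (d v + ∑ u ∈ nbrs v, w v u) :=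
    Finset.sum_congr rfl fun v _ => h v
  simp only [Finset.sum_add_distrib, sum_nbrs_left hs hB, sum_nbrs_right hs hB] at h1
  rw [Finset.sum_comm (f := fun v u => w u v)] at h1
  omega

end SquareReconfig

namespace SquareReconfig
open Relation

/-! ### The components of the grid graph -/

namespace Instance

variable {I : Instance}

theorem gridCells_of_some {rs : List Rect} (h : I.domain = some rs) :
    I.gridCells = I.domain.cells := by
  unfold gridCells
  split
  · rename_i rs' h'
    rw [h']; rfl
  · rename_i h'
    rw [h] at h'; cases h'

theorem mem_gridCells_of_none (h : I.domain = none) {z : Cell} :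
    z ∈ I.gridCells ↔
      ((∃ p, I.IsStartOrTarget p ∧ p.1 ≤ z.1) ∧ ∃ p, I.IsStartOrTarget p ∧ z.1 ≤ p.1) ∧
      (∃ p, I.IsStartOrTarget p ∧ p.2 ≤ z.2) ∧ ∃ p, I.IsStartOrTarget p ∧ z.2 ≤ p.2 := by
  unfold gridCells
  split
  · rename_i rs' h'
    rw [h] at h'; cases h'
  · simp only [Set.mem_ofPred_eq, and_assoc]

theorem gridCells_subset (I : Instance) : I.gridCells ⊆ I.domain.cells := by
  cases h : I.domain with
  | none => simp [cells_none]
  | some rs => rw [gridCells_of_some h, h]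

theorem IsStartOrTarget.mem_gridCells {p : Cell} (hp : I.IsStartOrTarget p) : p ∈ I.gridCells := by
  cases h : I.domain with
  | none =>
    rw [mem_gridCells_of_none h]
    exact ⟨⟨⟨p, hp, le_rfl⟩, p, hp, le_rfl⟩, ⟨p, hp, le_rfl⟩, p, hp, le_rfl⟩
  | some rs =>
    rw [gridCells_of_some h]
    rcases hp with ⟨i, rfl⟩ | ⟨i, rfl⟩
    · exact I.start_mem i
    · exact I.target_mem i

theorem start_mem_gridCells (I : Instance) (i : Fin I.n) : I.start i ∈ I.gridCells :=
  IsStartOrTarget.mem_gridCells (Or.inl ⟨i, rfl⟩)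

theorem target_mem_gridCells (I : Instance) (i : Fin I.n) : I.target i ∈ I.gridCells :=
  IsStartOrTarget.mem_gridCells (Or.inr ⟨i, rfl⟩)

theorem gridCells_finite (I : Instance) : I.gridCells.Finite := by
  cases h : I.domain with
  | none =>
    have hP : {p | I.IsStartOrTarget p}.Finite :=
      (Set.finite_range I.start).union (Set.finite_range I.target)
    have hx : (⋃ p ∈ {p | I.IsStartOrTarget p}, ⋃ q ∈ {p | I.IsStartOrTarget p},
        Set.Icc p.1 q.1).Finite :=
      hP.biUnion fun p _ => hP.biUnion fun q _ => Set.finite_Icc _ _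
    have hy : (⋃ p ∈ {p | I.IsStartOrTarget p}, ⋃ q ∈ {p | I.IsStartOrTarget p},
        Set.Icc p.2 q.2).Finite :=
      hP.biUnion fun p _ => hP.biUnion fun q _ => Set.finite_Icc _ _
    refine (hx.prod hy).subset fun z hz => ?_
    obtain ⟨⟨⟨p, hp, h1⟩, q, hq, h2⟩, ⟨r, hr, h3⟩, s, hs, h4⟩ := (mem_gridCells_of_none h).1 hz
    refine ⟨?_, ?_⟩
    · simp only [Set.mem_iUnion]
      exact ⟨p, hp, q, hq, h1, h2⟩
    · simp only [Set.mem_iUnion]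
      exact ⟨r, hr, s, hs, h3, h4⟩
  | some rs =>
    rw [gridCells_of_some h, h]
    have : (⋃ r ∈ {r | r ∈ rs}, Set.Icc r.left r.right ×ˢ Set.Icc r.bottom r.top).Finite :=
      (List.finite_toSet rs).biUnion fun r _ => (Set.finite_Icc _ _).prod (Set.finite_Icc _ _)
    refine this.subset fun z hz => ?_
    obtain ⟨r, hr, h1, h2, h3, h4⟩ := mem_cells_some.1 hz
    simp only [Set.mem_iUnion]
    exact ⟨r, hr, ⟨h1, h2.le⟩, h3, h4.le⟩

theorem Component.cells_subset (K : I.Component) : K.cells ⊆ I.gridCells := by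
  rintro _ ⟨z, _, rfl⟩
  exact z.2

theorem Component.cells_finite (K : I.Component) : K.cells.Finite :=
  I.gridCells_finite.subset K.cells_subset

theorem mem_cells_iff {K : I.Component} {z : Cell} (hz : z ∈ I.gridCells) :
    z ∈ K.cells ↔ I.gridGraph.connectedComponentMk ⟨z, hz⟩ = K := by
  constructor
  · rintro ⟨z', h, rfl⟩
    exact h
  · intro h
    exact ⟨⟨z, hz⟩, h, rfl⟩

theorem Component.eq_of_mem {K K' : I.Component} {z : Cell} (h : z ∈ K.cells) (h' : z ∈ K'.cells) :
    K = K' :=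
  ((mem_cells_iff (K.cells_subset h)).1 h).symm.trans ((mem_cells_iff (K.cells_subset h)).1 h')

theorem reachable_iff_conn {u v : Cell} (hu : u ∈ I.gridCells) (hv : v ∈ I.gridCells) :
    I.gridGraph.Reachable ⟨u, hu⟩ ⟨v, hv⟩ ↔ Conn I.gridCells u v := by
  constructor
  · rintro ⟨p⟩
    have key : ∀ (x y : I.gridCells), I.gridGraph.Walk x y → Conn I.gridCells x y := by
      intro x y p
      induction p with
      | nil => exact ReflTransGen.refl
      | cons h _ ih => exact ReflTransGen.head ⟨Subtype.prop _, Subtype.prop _, h⟩ ih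
    exact key _ _ p
  · intro h
    have key : ∀ w, Conn I.gridCells u w → ∀ hw : w ∈ I.gridCells,
        I.gridGraph.Reachable ⟨u, hu⟩ ⟨w, hw⟩ := by
      intro w h
      induction h with
      | refl => exact fun _ => SimpleGraph.Reachable.refl _
      | tail _ h ih =>
        intro hw
        have hadj : I.gridGraph.Adj ⟨_, h.1⟩ ⟨_, hw⟩ := h.2.2
        exact (ih h.1).trans hadj.reachable
    exact key v h hv

theorem Component.mem_cells_iff_conn {K : I.Component} {z w : Cell} (hz : z ∈ K.cells) :
    w ∈ K.cells ↔ Conn I.gridCells z w := by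
  have hz' := K.cells_subset hz
  constructor
  · intro hw
    have hw' := K.cells_subset hw
    refine (reachable_iff_conn hz' hw').1 (SimpleGraph.ConnectedComponent.exact ?_)
    rw [(mem_cells_iff hz').1 hz, (mem_cells_iff hw').1 hw]
  · intro h
    have hw' : w ∈ I.gridCells := by
      rcases ReflTransGen.cases_tail h with e | ⟨_, _, e⟩
      · rw [e]; exact hz'
      · exact e.2.1
    rw [mem_cells_iff hw', ← (mem_cells_iff hz').1 hz]
    exact (SimpleGraph.ConnectedComponent.sound ((reachable_iff_conn hz' hw').2 h)).symm

theorem Component.nonempty (K : I.Component) : ∃ z, z ∈ K.cells := by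
  obtain ⟨z, hz⟩ := K.nonempty_supp
  exact ⟨z, z, hz, rfl⟩

/-- The bounding box contains, with two cells, the L-shaped path that changes first one coordinate
and then the other. -/
theorem conn_box (h : I.domain = none) {u v : Cell} (hu : u ∈ I.gridCells) (hv : v ∈ I.gridCells) :
    Conn I.gridCells u v := by
  have hrow : ∀ (x x' y : ℤ), x ≤ x' → (x, y) ∈ I.gridCells → (x', y) ∈ I.gridCells →
      Conn I.gridCells (x, y) (x', y) := by
    intro x x' y hx h1 h2
    obtain ⟨k, rfl⟩ := Int.le.dest hx
    refine conn_row k fun j hj => ?_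
    rw [mem_gridCells_of_none h] at h1 h2 ⊢
    obtain ⟨⟨⟨p, hp, p1⟩, -⟩, h1⟩ := h1
    obtain ⟨⟨-, q, hq, q1⟩, -⟩ := h2
    exact ⟨⟨⟨p, hp, by dsimp at p1 ⊢; omega⟩, q, hq, by dsimp at q1 ⊢; omega⟩, h1⟩
  have hcol : ∀ (x y y' : ℤ), y ≤ y' → (x, y) ∈ I.gridCells → (x, y') ∈ I.gridCells →
      Conn I.gridCells (x, y) (x, y') := by
    intro x y y' hy h1 h2
    obtain ⟨k, rfl⟩ := Int.le.dest hy
    refine conn_col k fun j hj => ?_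
    rw [mem_gridCells_of_none h] at h1 h2 ⊢
    obtain ⟨h1, ⟨p, hp, p1⟩, -⟩ := h1
    obtain ⟨-, -, q, hq, q1⟩ := h2
    exact ⟨h1, ⟨p, hp, by dsimp at p1 ⊢; omega⟩, q, hq, by dsimp at q1 ⊢; omega⟩
  have hm : (v.1, u.2) ∈ I.gridCells :=
    (mem_gridCells_of_none h).2 ⟨((mem_gridCells_of_none h).1 hv).1, ((mem_gridCells_of_none h).1 hu).2⟩
  refine Conn.trans (v := (v.1, u.2)) ?_ ?_
  · rcases le_total u.1 v.1 with hl | hl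
    · exact hrow _ _ _ hl hu hm
    · exact (hrow _ _ _ hl hm hu).symm
  · rcases le_total u.2 v.2 with hl | hl
    · exact hcol _ _ _ hl hm hv
    · exact (hcol _ _ _ hl hv hm).symm

/-- This links the motion invariant to the grid graph. In the unbounded scenario motions may leave
the bounding box, but both the box and the plane are connected, so nothing changes. -/
theorem Component.mem_cells_iff_conn_domain {K : I.Component} {z w : Cell} (hz : z ∈ K.cells)
    (hw : w ∈ I.gridCells) : w ∈ K.cells ↔ Conn I.domain.cells z w := by
  rw [Component.mem_cells_iff_conn hz]
  cases h : I.domain with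
  | some rs => rw [gridCells_of_some h, h]
  | none =>
    refine iff_of_true (conn_box h (K.cells_subset hz) hw) ?_
    have key : ∀ w, Conn I.gridCells z w → Conn (Domain.cells none) z w := by
      intro w hw
      induction hw with
      | refl => exact ReflTransGen.refl
      | tail _ e ih => exact ih.tail ⟨by simp [cells_none], by simp [cells_none], e.2.2⟩
    exact key w (conn_box h (K.cells_subset hz) hw)

theorem Solvable.balanced (h : I.Solvable) (K : I.Component) : I.Balanced K := by
  obtain ⟨z, hz⟩ := K.nonempty
  have e := h.card_eq z
  have e1 : ∀ i, I.start i ∈ K.cells ↔ Conn I.domain.cells z (I.start i) := fun i =>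
    Component.mem_cells_iff_conn_domain hz (I.start_mem_gridCells i)
  have e2 : ∀ i, I.target i ∈ K.cells ↔ Conn I.domain.cells z (I.target i) := fun i =>
    Component.mem_cells_iff_conn_domain hz (I.target_mem_gridCells i)
  unfold Balanced
  simp only [e1, e2]
  exact e

/-- Simplicity of the path ensures that one square uses an edge at most once, as the capacities
require. -/
theorem Component.exists_path {K : I.Component} {u v : Cell} (hu : u ∈ K.cells) (hv : v ∈ K.cells) :
    ∃ l : List Cell, (u :: l).Nodup ∧ l.getLastD u = v ∧
      List.IsChain (fun x y => x ∈ K.cells ∧ y ∈ K.cells ∧ y ∈ nbrs x) (u :: l) := by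
  have hu' := K.cells_subset hu
  have hv' := K.cells_subset hv
  have hr := (reachable_iff_conn hu' hv').2 ((Component.mem_cells_iff_conn hu).1 hv)
  obtain ⟨p, hp⟩ := hr.exists_isPath
  have key : ∀ (x y : I.gridCells) (p : I.gridGraph.Walk x y), x.1 ∈ K.cells →
      (p.support.tail.map Subtype.val).getLastD x.1 = y.1 ∧
      List.IsChain (fun x y => x ∈ K.cells ∧ y ∈ K.cells ∧ y ∈ nbrs x) (p.support.map Subtype.val) := by
    intro x y p
    induction p with
    | nil => exact fun _ => ⟨rfl, by simp⟩
    | @cons x y z h p ih =>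
      intro hx
      have hy : y.1 ∈ K.cells := (Component.mem_cells_iff_conn hx).2
        (ReflTransGen.single ⟨x.2, y.2, h⟩)
      obtain ⟨i1, i2⟩ := ih hy
      rw [SimpleGraph.Walk.support_cons]
      rw [← p.cons_tail_support] at i1 i2 ⊢
      simp only [List.tail_cons, List.map_cons, List.getLastD_cons, List.isChain_cons_cons] at i1 i2 ⊢
      exact ⟨i1, ⟨hx, hy, h⟩, i2⟩
  obtain ⟨k1, k2⟩ := key _ _ p hu
  have e : u :: p.support.tail.map Subtype.val = p.support.map Subtype.val := by
    conv_rhs => rw [← p.cons_tail_support]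
    rfl
  refine ⟨p.support.tail.map Subtype.val, ?_, k1, ?_⟩
  · rw [e]; exact hp.support_nodup.map Subtype.val_injective
  · rw [e]; exact k2

end Instance

end SquareReconfig

namespace SquareReconfig
open Relation

/-! ### Maximum flows and the cancellation of cycles -/

namespace Instance

namespace Flow

variable {I : Instance} {K : I.Component}

theorem supported (F : I.Flow K) : Supported K.cells F.edge := F.edge_mem

theorem conserves (F : I.Flow K) :
    Conserves (fun v => ∑ i with I.start i = v, F.source i)
      (fun v => ∑ i with I.target i = v, F.sink i) F.edge := F.conservation

theorem value_le (F : I.Flow K) : F.value ≤ I.n := by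
  refine (Finset.sum_le_sum fun i _ => F.source_le i).trans ?_
  simp

theorem exists_isMax (K : I.Component) : ∃ F : I.Flow K, F.IsMax := by
  let Z : I.Flow K :=
    { source := fun _ => 0, sink := fun _ => 0, edge := fun _ _ => 0
      source_le := fun _ => Nat.zero_le _, sink_le := fun _ => Nat.zero_le _
      source_mem := fun _ h => absurd rfl h, sink_mem := fun _ h => absurd rfl h
      edge_le := fun _ _ => Nat.zero_le _, edge_mem := fun _ _ h => absurd rfl h
      conservation := fun v => by simp }
  have hb : BddAbove (Set.range fun F : I.Flow K => F.value) :=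
    ⟨I.n, by rintro _ ⟨F, rfl⟩; exact F.value_le⟩
  obtain ⟨F, hF⟩ := Nat.sSup_mem (Set.range_nonempty_iff_nonempty.2 ⟨Z⟩) hb
  exact ⟨F, fun G => by
    dsimp only at hF
    rw [hF]; exact le_csSup hb ⟨G, rfl⟩⟩

/-- A closed walk changes no balance and positive edges have weight at least 1, so reducing along a
positive cycle gives a flow again. -/
theorem isAcyclic_or_exists_cancelsTo (F : I.Flow K) :
    F.IsAcyclic ∨ ∃ G : I.Flow K, F.CancelsTo G := by
  by_cases h : F.IsAcyclic
  · exact Or.inl h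
  · simp only [IsAcyclic, not_forall, not_not] at h
    obtain ⟨l, hl⟩ := h
    refine Or.inr ?_
    cases l with
    | nil => exact absurd rfl hl.1
    | cons a l =>
      obtain ⟨h1, h2⟩ := isPosCycle_cons.1 hl
      have hn : (l ++ [a]).Nodup := (List.perm_append_singleton a l).nodup_iff.2 h1
      -- A simple cycle uses each of its edges once, so the indicator function of its edges equals
      -- its step count.
      have hc : ∀ u v, (if (u, v) ∈ cycleEdges (a :: l) then 1 else 0) =
          stepCount a (l ++ [a]) u v := by
        intro u v
        have := stepCount_le_one (a := a) hn u v
        rw [← count_cycleEdges] at this ⊢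
        split
        · rename_i hm
          have := List.count_pos_iff.2 hm
          omega
        · rename_i hm
          rw [List.count_eq_zero.2 hm]
      have hw : ∀ u v, stepCount a (l ++ [a]) u v ≤ F.edge u v := fun u v => by
        by_cases h0 : stepCount a (l ++ [a]) u v = 0
        · omega
        · have e1 := isChain_iff_stepCount.1 h2 u v h0
          have e2 := stepCount_le_one (a := a) hn u v
          omega
      have hcons := F.conserves.sub (a := a) (l := l ++ [a])
        (s' := fun v => ∑ i with I.start i = v, F.source i)
        (d' := fun v => ∑ i with I.target i = v, F.sink i)
        (h2.imp fun u v h => (F.edge_mem u v h.ne').2.2) hw fun v => by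
          simp only [List.getLastD_eq_getLast?, List.getLast?_concat, Option.getD_some]
      refine ⟨{ source := F.source, sink := F.sink,
                edge := fun u v => F.edge u v - if (u, v) ∈ cycleEdges (a :: l) then 1 else 0
                source_le := F.source_le, sink_le := F.sink_le, source_mem := F.source_mem,
                sink_mem := F.sink_mem
                edge_le := fun u v => (Nat.sub_le _ _).trans (F.edge_le u v)
                edge_mem := fun u v h => F.edge_mem u v fun e => h (by simp [e])
                conservation := fun v => by simp only [hc]; exact hcons v },
        rfl, rfl, a :: l, hl, fun u v => rfl⟩

/-- The total weight of the edges strictly decreases. -/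
theorem cancelsTo_wf : WellFounded (fun G F : I.Flow K => F.CancelsTo G) := by
  set B := K.cells_finite.toFinset with hB
  refine Subrelation.wf (r := InvImage (· < ·) fun F : I.Flow K => ∑ u ∈ B, ∑ v ∈ B, F.edge u v)
    ?_ (InvImage.wf _ Nat.lt_wfRel.wf)
  rintro G F ⟨-, -, l, hl, hG⟩
  have hle : ∀ u v, G.edge u v ≤ F.edge u v := fun u v => (hG u v).trans_le (Nat.sub_le _ _)
  obtain ⟨⟨u, v⟩, he⟩ : ∃ e, e ∈ cycleEdges l := by
    refine List.exists_mem_of_length_pos ?_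
    rw [cycleEdges, List.length_zip, List.length_rotate, min_self]
    exact List.length_pos_of_ne_nil hl.1
  have hpos := hl.2.2 _ he
  have hlt : G.edge u v < F.edge u v := by
    rw [hG, if_pos he]; dsimp only at hpos; omega
  obtain ⟨hu, hv, -⟩ := F.edge_mem u v hpos.ne'
  refine Finset.sum_lt_sum (fun x _ => Finset.sum_le_sum fun y _ => hle x y)
    ⟨u, by simpa [hB] using hu, ?_⟩
  exact Finset.sum_lt_sum (fun y _ => hle u y) ⟨v, by simpa [hB] using hv, hlt⟩

-- Balance provides a bijection from starts to targets; the flow is the sum of unit flows along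
-- simple paths between matched cells. Each edge then carries at most one unit per square, within
-- its capacity.
open Classical in
theorem exists_value_eq (h : I.Balanced K) :
    ∃ F : I.Flow K, F.value = Nat.card {i // I.start i ∈ K.cells} := by
  obtain ⟨σ⟩ := Finite.card_eq.1 h
  have hp : ∀ i : {i // I.start i ∈ K.cells}, ∃ l : List Cell, (I.start i :: l).Nodup ∧
      l.getLastD (I.start i) = I.target (σ i) ∧
      List.IsChain (fun x y => x ∈ K.cells ∧ y ∈ K.cells ∧ y ∈ nbrs x) (I.start i :: l) :=
    fun i => Component.exists_path i.2 (σ i).2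
  choose p hn hl hc using hp
  have hs : ∀ (f : Fin I.n → ℕ) (P : Fin I.n → Prop),
      ∑ i, (if P i then f i else 0) = ∑ i : {i // P i}, f i := fun f P => by
    rw [← Finset.sum_filter]
    exact Finset.sum_subtype _ (by simp) f
  refine ⟨{ source := fun i => if I.start i ∈ K.cells then 1 else 0
            sink := fun i => if I.target i ∈ K.cells then 1 else 0
            edge := fun u v => ∑ i : {i // I.start i ∈ K.cells}, stepCount (I.start i) (p i) u v
            source_le := fun i => by split <;> simp
            sink_le := fun i => by split <;> simp
            source_mem := fun i h => by simpa using h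
            sink_mem := fun i h => by simpa using h
            edge_le := fun u v => ?_
            edge_mem := fun u v h => ?_
            conservation := fun v => ?_ }, ?_⟩
  · refine (Finset.sum_le_sum fun i _ => stepCount_le_one (List.nodup_cons.1 (hn i)).2 u v).trans ?_
    simp
  · obtain ⟨i, -, hi⟩ := Finset.exists_ne_zero_of_sum_ne_zero h
    exact isChain_iff_stepCount.1 (hc i) u v hi
  · have e1 : ∑ i with I.start i = v, (if I.start i ∈ K.cells then 1 else 0) =
        ∑ i : {i // I.start i ∈ K.cells}, if I.start i = v then 1 else 0 := by
      rw [Finset.sum_filter, ← hs (fun i => if I.start i = v then 1 else 0)]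
      exact Finset.sum_congr rfl fun i _ => by split_ifs <;> rfl
    have e2 : ∑ i with I.target i = v, (if I.target i ∈ K.cells then 1 else 0) =
        ∑ i : {i // I.start i ∈ K.cells}, if I.target (σ i) = v then 1 else 0 := by
      rw [Equiv.sum_comp σ (fun j => if I.target j = v then 1 else 0), Finset.sum_filter,
        ← hs (fun i => if I.target i = v then 1 else 0)]
      exact Finset.sum_congr rfl fun i _ => by split_ifs <;> rfl
    rw [e1, e2, Finset.sum_comm, Finset.sum_comm (s := nbrs v), ← Finset.sum_add_distrib,
      ← Finset.sum_add_distrib]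
    refine Finset.sum_congr rfl fun i _ => ?_
    have := stepCount_conservation ((hc i).imp fun u v h => h.2.2) v
    rwa [hl i] at this
  · simp only [value]
    rw [hs (fun _ => 1)]
    simp

/-- In a balanced component, a maximum flow saturates the edges at the source and at the sink. -/
theorem IsMax.saturated {F : I.Flow K} (hF : F.IsMax) (h : I.Balanced K) :
    (∀ i, I.start i ∈ K.cells → F.source i = 1) ∧ ∀ i, I.target i ∈ K.cells → F.sink i = 1 := by
  classical
  have key : ∀ (f : Fin I.n → ℕ) (P : Fin I.n → Prop), (∀ i, f i ≤ 1) → (∀ i, f i ≠ 0 → P i) →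
      Nat.card {i // P i} ≤ ∑ i, f i → ∀ i, P i → f i = 1 := by
    intro f P h1 h2 h3 i hi
    have hle : ∀ j ∈ Finset.univ, f j ≤ if P j then 1 else 0 := fun j _ => by
      split
      · exact h1 j
      · rename_i hj
        exact (not_not.1 (mt (h2 j) hj)).le
    have hsum : ∑ j, f j = ∑ j, if P j then 1 else 0 := by
      refine le_antisymm (Finset.sum_le_sum hle) (le_trans (le_of_eq ?_) h3)
      rw [Finset.sum_boole, Nat.card_eq_fintype_card, Fintype.card_subtype]; simp
    have := (Finset.sum_eq_sum_iff_of_le hle).1 hsum i (Finset.mem_univ i)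
    rwa [if_pos hi] at this
  obtain ⟨G, hG⟩ := exists_value_eq h
  have hv : Nat.card {i // I.start i ∈ K.cells} ≤ ∑ i, F.source i := hG ▸ hF G
  refine ⟨key _ _ F.source_le F.source_mem hv, key _ _ F.sink_le F.sink_mem ?_⟩
  -- Global conservation transfers the value from the source to the sink; balance then says that the
  -- targets are saturated as well.
  have hsum := F.conserves.sum_eq F.supported (B := K.cells_finite.toFinset) (by simp)
  have e : ∀ (f : Fin I.n → ℕ) (pos : Fin I.n → Cell), (∀ i, f i ≠ 0 → pos i ∈ K.cells) →
      ∑ v ∈ K.cells_finite.toFinset, ∑ i with pos i = v, f i = ∑ i, f i := by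
    intro f pos hf
    simp only [Finset.sum_filter]
    rw [Finset.sum_comm]
    refine Finset.sum_congr rfl fun i _ => ?_
    rw [Finset.sum_ite_eq]
    split
    · rfl
    · rename_i hi
      by_contra hne
      exact hi (by simpa using hf i (Ne.symm hne))
  rw [e _ _ F.source_mem, e _ _ F.sink_mem] at hsum
  rw [← hsum, ← h]
  exact hv

theorem cancelsTo_star {F G : I.Flow K} (h : ReflTransGen CancelsTo G F) :
    F.source = G.source ∧ F.sink = G.sink := by
  induction h with
  | refl => exact ⟨rfl, rfl⟩
  | tail _ h ih => exact ⟨h.1.trans ih.1, h.2.1.trans ih.2⟩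

end Flow

theorem exists_isReducedMaxFlow {I : Instance} (K : I.Component) :
    ∃ F : I.Flow K, I.IsReducedMaxFlow K F := by
  obtain ⟨G, hG⟩ := Flow.exists_isMax K
  have key : ∀ F : I.Flow K, ∃ F' : I.Flow K, F'.IsAcyclic ∧ ReflTransGen Flow.CancelsTo F F' := by
    intro F
    induction F using Flow.cancelsTo_wf.induction with
    | _ F ih =>
      rcases F.isAcyclic_or_exists_cancelsTo with h | ⟨F₁, h⟩
      · exact ⟨F, h, ReflTransGen.refl⟩
      · obtain ⟨F', h1, h2⟩ := ih F₁ h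
        exact ⟨F', h1, ReflTransGen.head h h2⟩
  obtain ⟨F, h1, h2⟩ := key G
  exact ⟨F, h1, G, hG, h2⟩

end Instance

end SquareReconfig

namespace SquareReconfig
open Relation

/-! ### Extraction of a schedule from an acyclic flow -/

namespace Instance

variable {I : Instance} {A : Set Cell} {S T R Q : Finset (Fin I.n)} {w w' : Cell → Cell → ℕ}
  {c : Fin I.n → Cell} {m : GridMove I.n} {t : Cell} {K : I.Component}

/-- The state of the extraction for the squares `S` and the targets `T`: the squares in `R` have not
moved, the targets in `Q` have not been reached, `w` are the remaining weights and `c` is the current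
configuration. -/
structure Extraction (I : Instance) (A : Set Cell) (S T : Finset (Fin I.n)) (w : Cell → Cell → ℕ)
    (R Q : Finset (Fin I.n)) (c : Fin I.n → Cell) : Prop where
  supported : Supported A w
  acyclic : Acyclic w
  conserves : Conserves (fun v => {i ∈ R | I.start i = v}.card)
    (fun v => {j ∈ Q | I.target j = v}.card) w
  subset_start : R ⊆ S
  subset_target : Q ⊆ T
  unmoved : ∀ i ∈ R, c i = I.start i
  free : ∀ i ∉ R, ∀ v, w (c i) v = 0 ∧ w v (c i) = 0
  image : c '' {i | i ∈ S ∧ i ∉ R} = I.target '' {j | j ∈ T ∧ j ∉ Q}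

theorem card_start_eq_zero {v : Cell} :
    {i ∈ R | I.start i = v}.card = 0 ↔ ∀ i ∈ R, I.start i ≠ v := by
  rw [Finset.card_eq_zero, Finset.filter_eq_empty_iff]

theorem card_target_le_one (v : Cell) : {j ∈ Q | I.target j = v}.card ≤ 1 := by
  refine Finset.card_le_one.2 fun i hi j hj => ?_
  rw [Finset.mem_filter] at hi hj
  exact I.target_injective (hi.2.trans hj.2.symm)

/-- At a sink, supply plus inflow equals demand. Demand is at most 1 and inflow is positive, so
demand and inflow are both 1 and supply is 0. -/
theorem Extraction.exists_target (h : Extraction I A S T w R Q c) (ht : IsSink w t) :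
    (∃ j ∈ Q, I.target j = t) ∧ (∀ i ∈ R, I.start i ≠ t) ∧ ∑ u ∈ nbrs t, w u t = 1 := by
  have hc := h.conserves t
  dsimp only at hc
  have h1 := card_target_le_one (Q := Q) t
  have h2 : ∑ u ∈ nbrs t, w t u = 0 := Finset.sum_eq_zero fun u _ => ht.2 u
  obtain ⟨u, hu⟩ := ht.1
  have hu' : u ∈ nbrs t := nbrs_comm.1 (h.supported u t hu.ne').2.2
  have h3 := Finset.single_le_sum (f := fun u => w u t) (fun _ _ => Nat.zero_le _) hu'
  refine ⟨?_, card_start_eq_zero.1 (by omega), by omega⟩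
  obtain ⟨j, hj⟩ := Finset.card_pos.1 (show 0 < {j ∈ Q | I.target j = t}.card by omega)
  exact ⟨j, (Finset.mem_filter.1 hj).1, (Finset.mem_filter.1 hj).2⟩

/-- A cell that is no start of a square in `R` has no supply, so outflow forces inflow there; this
is what the backward walk of `exists_path_to` needs. -/
theorem Extraction.exists_step (h : Extraction I A S T w R Q c) (hA : A.Finite)
    (ht : IsSink w t) : ∃ m w', I.ExtractStep w R m t w' := by
  obtain ⟨-, hnR, -⟩ := h.exists_target ht
  obtain ⟨u, hu⟩ := ht.1
  obtain ⟨a, l, ⟨i, hi, rfl⟩, h2, h3, h4⟩ := exists_path_to h.acyclic hA h.supported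
    (fun v => ∃ i ∈ R, I.start i = v) (by rintro ⟨i, hi, e⟩; exact hnR i hi e) hu (by
      intro v x hv hvx
      have hc := h.conserves v
      dsimp only at hc
      have h0 : {i ∈ R | I.start i = v}.card = 0 :=
        card_start_eq_zero.2 fun i hi e => hv ⟨i, hi, e⟩
      have hx := Finset.single_le_sum (f := fun u => w v u) (fun _ _ => Nat.zero_le _)
        (h.supported v x hvx.ne').2.2
      obtain ⟨u, -, hu⟩ := Finset.exists_ne_zero_of_sum_ne_zero
        (show ∑ u ∈ nbrs v, w u v ≠ 0 by omega)
      exact ⟨u, Nat.pos_of_ne_zero hu⟩)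
  exact ⟨⟨i, l⟩, _, hi, ht, h2, h3, fun v hv j hj e => h4 v hv ⟨j, hj, e⟩, fun u v => rfl⟩

theorem Extraction.step (h : Extraction I A S T w R Q c) (hA : A ⊆ I.domain.cells)
    (hs : I.ExtractStep w R m t w') :
    m.IsClear I.domain c ∧
      ∃ Q', Extraction I A S T w' (R.erase m.robot) Q' (cellApply c m) := by
  obtain ⟨⟨j, hj, hjt⟩, hnR, hin⟩ := h.exists_target hs.sink
  have hcm : c m.robot = I.start m.robot := h.unmoved _ hs.mem
  have hlast : ∀ a, m.waypoints.getLastD a = t := fun a => by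
    rw [List.getLastD_eq_getLast?, hs.ends]; rfl
  have htmem : t ∈ m.waypoints := List.mem_of_getLast? hs.ends
  have hnd := h.acyclic.nodup hs.path
  have hpos := isChain_iff_stepCount.1 hs.path
  have hw : ∀ u v, stepCount (I.start m.robot) m.waypoints u v ≤ w u v := fun u v => by
    by_cases h0 : stepCount (I.start m.robot) m.waypoints u v = 0
    · omega
    · have h1 := hpos u v h0
      have h2 := stepCount_le_one (a := I.start m.robot) (List.nodup_cons.1 hnd).2 u v
      omega
  have hw' : w' = fun u v => w u v - stepCount (I.start m.robot) m.waypoints u v :=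
    funext fun u => funext fun v => hs.weight u v
  have hle : ∀ u v, w' u v ≤ w u v := fun u v => by rw [hw']; exact Nat.sub_le _ _
  have hout : ∀ u ∈ I.start m.robot :: m.waypoints, u = t ∨ ∃ v, 0 < w u v := by
    have key : ∀ (l : List Cell) (a : Cell), List.IsChain (fun u v => 0 < w u v) (a :: l) →
        l.getLastD a = t → ∀ u ∈ a :: l, u = t ∨ ∃ v, 0 < w u v := by
      intro l
      induction l with
      | nil => intro a _ ha u hu; rw [List.mem_singleton] at hu; exact Or.inl (hu.trans ha)
      | cons b l ih =>
        intro a hc ha u hu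
        rw [List.isChain_cons_cons] at hc
        rcases List.mem_cons.1 hu with rfl | hu
        · exact Or.inr ⟨b, hc.1⟩
        · exact ih b hc.2 (by rwa [List.getLastD_cons] at ha) u hu
    exact key _ _ hs.path (hlast _)
  -- Squares in `R` are avoided by the choice of the path. Every cell of the path carries flow, and
  -- the cells of all other squares carry none.
  have hfree : ∀ u ∈ I.start m.robot :: m.waypoints, u ∉ others c m.robot := by
    rintro u hu ⟨i, hi, rfl⟩
    by_cases hiR : i ∈ R
    · rw [h.unmoved i hiR] at hu
      rcases List.mem_cons.1 hu with e | hu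
      · exact hi (I.start_injective e)
      · exact hs.avoids _ hu i hiR rfl
    · rcases hout _ hu with e | ⟨v, hv⟩
      · obtain ⟨u, hu⟩ := hs.sink.1
        rw [← e, (h.free i hiR u).2] at hu
        exact lt_irrefl _ hu
      · rw [(h.free i hiR v).1] at hv
        exact lt_irrefl _ hv
  have hdom : ∀ u v, 0 < w u v → u ∈ I.domain.cells ∧ v ∈ I.domain.cells ∧ v ∈ nbrs u :=
    fun u v huv => by
      obtain ⟨h1, h2, h3⟩ := h.supported u v huv.ne'
      exact ⟨hA h1, hA h2, h3⟩
  have happ : cellApply c m = Function.update c m.robot t := by rw [cellApply, hlast]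
  -- The path uses up the single unit of inflow at `t`, so the cell where the square settles is free
  -- of flow, which maintains the field `free`.
  have ht' : ∀ v, w' t v = 0 ∧ w' v t = 0 := by
    have hcons := stepCount_conservation (hs.path.imp fun u v h => (hdom u v h).2.2) t
    have e1 : I.start m.robot ≠ t := hnR _ hs.mem
    rw [hlast, if_neg e1, if_pos rfl] at hcons
    have e0 : ∀ u, stepCount (I.start m.robot) m.waypoints t u = 0 := fun u => by
      have := hw t u
      rw [hs.sink.2 u] at this
      omega
    simp only [e0, Finset.sum_const_zero] at hcons
    refine fun v => ⟨by have := hle t v; rw [hs.sink.2 v] at this; omega, ?_⟩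
    have hsum : ∑ u ∈ nbrs t, w' u t = 0 := by
      have : ∑ u ∈ nbrs t, w' u t + ∑ u ∈ nbrs t, stepCount (I.start m.robot) m.waypoints u t =
          ∑ u ∈ nbrs t, w u t := by
        rw [← Finset.sum_add_distrib, hw']
        exact Finset.sum_congr rfl fun u _ => Nat.sub_add_cancel (hw u t)
      omega
    by_contra hne
    have hv : v ∈ nbrs t :=
      nbrs_comm.1 (h.supported v t (fun e => hne (by have := hle v t; omega))).2.2
    exact hne (Finset.sum_eq_zero_iff.1 hsum v hv)
  refine ⟨⟨?_, ?_, ?_⟩, Q.erase j, ?_⟩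
  · rw [hcm]; exact I.start_mem _
  · rw [hcm]; exact hfree _ (by simp)
  · rw [hcm, isChain_iff_stepCount]
    intro u v huv
    obtain ⟨h1, h2, h3⟩ := hdom u v (hpos u v huv)
    have hmem : u ∈ I.start m.robot :: m.waypoints ∧ v ∈ m.waypoints := by
      by_contra hn
      exact huv (stepCount_eq_zero (by tauto))
    exact ClearSegment.of_mem_nbrs h3 h1 h2 (hfree u hmem.1) (hfree v (List.mem_cons_of_mem _ hmem.2))
  · refine ⟨h.supported.mono hle, h.acyclic.mono hle, ?_, (Finset.erase_subset _ _).trans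
      h.subset_start, (Finset.erase_subset _ _).trans h.subset_target, ?_, ?_, ?_⟩
    · rw [hw']
      refine h.conserves.sub (hs.path.imp fun u v h => (hdom u v h).2.2) hw fun v => ?_
      have e1 : {i ∈ R | I.start i = v}.card =
          {i ∈ R.erase m.robot | I.start i = v}.card + if I.start m.robot = v then 1 else 0 := by
        rw [Finset.filter_erase]
        split
        · rename_i e
          rw [Finset.card_erase_add_one (Finset.mem_filter.2 ⟨hs.mem, e⟩)]
        · rename_i e
          rw [Finset.erase_eq_of_notMem (by simp [e]), add_zero]
      have e2 : {i ∈ Q | I.target i = v}.card =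
          {i ∈ Q.erase j | I.target i = v}.card + if t = v then 1 else 0 := by
        rw [Finset.filter_erase, ← hjt]
        split
        · rename_i e
          rw [Finset.card_erase_add_one (Finset.mem_filter.2 ⟨hj, e⟩)]
        · rename_i e
          rw [Finset.erase_eq_of_notMem (by simp [e]), add_zero]
      rw [hlast]
      omega
    · intro i hi
      obtain ⟨h1, h2⟩ := Finset.mem_erase.1 hi
      rw [happ, Function.update_of_ne h1]
      exact h.unmoved i h2
    · intro i hi v
      rw [happ]
      by_cases e : i = m.robot
      · rw [e, Function.update_self]
        exact ht' v
      · rw [Function.update_of_ne e]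
        have hiR : i ∉ R := fun hR => hi (Finset.mem_erase.2 ⟨e, hR⟩)
        have h1 := hle (c i) v
        have h2 := hle v (c i)
        rw [(h.free i hiR v).1] at h1
        rw [(h.free i hiR v).2] at h2
        exact ⟨by omega, by omega⟩
    · have e1 : {i | i ∈ S ∧ i ∉ R.erase m.robot} = insert m.robot {i | i ∈ S ∧ i ∉ R} := by
        ext i
        simp only [Set.mem_ofPred_eq, Finset.mem_erase, Set.mem_insert_iff]
        by_cases e : i = m.robot
        · simp [e, h.subset_start hs.mem]
        · simp [e]
      have e2 : {i | i ∈ T ∧ i ∉ Q.erase j} = insert j {i | i ∈ T ∧ i ∉ Q} := by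
        ext i
        simp only [Set.mem_ofPred_eq, Finset.mem_erase, Set.mem_insert_iff]
        by_cases e : i = j
        · simp [e, h.subset_target hj]
        · simp [e]
      rw [e1, e2, Set.image_insert_eq, Set.image_insert_eq, hjt, happ, Function.update_self,
        ← h.image]
      congr 1
      refine Set.image_congr fun i hi => ?_
      rw [Function.update_of_ne]
      rintro rfl
      exact hi.2 hs.mem

/-- A square leaves `R` when it moves, so no square moves twice and squares outside `R` never move.
-/
theorem Extraction.run {ms : List (GridMove I.n)} {R' : Finset (Fin I.n)}
    (hA : A ⊆ I.domain.cells) (hr : I.ExtractRun w R ms w' R') :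
    ∀ {Q c}, Extraction I A S T w R Q c →
      ClearSchedule I.domain c ms ∧ (ms.map GridMove.robot).Nodup ∧ (∀ m ∈ ms, m.robot ∈ R) ∧
      (∀ i ∉ R, cellFinal c ms i = c i) ∧
      ∃ Q', Extraction I A S T w' R' Q' (cellFinal c ms) := by
  induction hr with
  | nil w R => exact fun h => ⟨trivial, List.nodup_nil, by simp, fun _ _ => rfl, _, h⟩
  | @cons w w' w'' R R' m ms t hs _ ih =>
    intro Q c h
    obtain ⟨h1, Q', h2⟩ := h.step hA hs
    obtain ⟨i1, i2, i3, i4, Q'', i5⟩ := ih h2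
    refine ⟨⟨h1, i1⟩, ?_, ?_, fun i hi => ?_, Q'', i5⟩
    · rw [List.map_cons, List.nodup_cons]
      refine ⟨fun hm => ?_, i2⟩
      obtain ⟨m', hm', e⟩ := List.mem_map.1 hm
      exact (Finset.mem_erase.1 (i3 m' hm')).1 e
    · intro m' hm'
      rcases List.mem_cons.1 hm' with rfl | hm'
      · exact hs.mem
      · exact (Finset.mem_erase.1 (i3 m' hm')).2
    · have e : cellFinal c (m :: ms) i = cellFinal (cellApply c m) ms i := rfl
      rw [e, i4 i fun h => hi (Finset.mem_erase.1 h).2, cellApply, Function.update_of_ne]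
      rintro rfl
      exact hi hs.mem

/-- Without sinks an acyclic weight vanishes. Conservation then identifies the remaining starts with
the remaining targets: these squares stay where they are. -/
theorem Extraction.image_eq (h : Extraction I A S T w R Q c) (hA : A.Finite)
    (hn : ∀ t, ¬ IsSink w t) : c '' {i | i ∈ S} = I.target '' {j | j ∈ T} := by
  have h0 : ∀ u v, w u v = 0 := fun u v => by
    by_contra hne
    obtain ⟨t, ht⟩ := exists_isSink h.acyclic hA h.supported (Nat.pos_of_ne_zero hne)
    exact hn t ht
  have hRQ : c '' {i | i ∈ R} = I.target '' {j | j ∈ Q} := by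
    ext v
    have hc := h.conserves v
    simp only [h0, Finset.sum_const_zero, add_zero] at hc
    have e1 : v ∈ c '' {i | i ∈ R} ↔ {i ∈ R | I.start i = v}.card ≠ 0 := by
      rw [Ne, card_start_eq_zero]
      push Not
      constructor
      · rintro ⟨i, hi, rfl⟩; exact ⟨i, hi, (h.unmoved i hi).symm⟩
      · rintro ⟨i, hi, e⟩; exact ⟨i, hi, (h.unmoved i hi).trans e⟩
    have e2 : v ∈ I.target '' {j | j ∈ Q} ↔ {j ∈ Q | I.target j = v}.card ≠ 0 := by
      rw [Ne, Finset.card_eq_zero, Finset.filter_eq_empty_iff]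
      push Not
      rfl
    rw [e1, e2, hc]
  have e1 : {i | i ∈ S} = {i | i ∈ S ∧ i ∉ R} ∪ {i | i ∈ R} := by
    ext i
    have := @h.subset_start i
    simp only [Set.mem_ofPred_eq, Set.mem_union]
    tauto
  have e2 : {i | i ∈ T} = {i | i ∈ T ∧ i ∉ Q} ∪ {i | i ∈ Q} := by
    ext i
    have := @h.subset_target i
    simp only [Set.mem_ofPred_eq, Set.mem_union]
    tauto
  rw [e1, e2, Set.image_union, Set.image_union, h.image, hRQ]

theorem mem_squaresIn {i : Fin I.n} : i ∈ I.squaresIn K ↔ I.start i ∈ K.cells := by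
  simp [squaresIn]

open Classical in
/-- The targets in the component. -/
noncomputable def targetsIn (I : Instance) (K : I.Component) : Finset (Fin I.n) :=
  Finset.univ.filter (fun i => I.target i ∈ K.cells)

theorem mem_targetsIn {i : Fin I.n} : i ∈ I.targetsIn K ↔ I.target i ∈ K.cells := by
  simp [targetsIn]

/-- Cancelling cycles leaves the source and sink edges saturated, so initially supplies are all
starts and demands all targets of `K`. Squares outside `K` stand off its cells and thus off the
flow. -/
theorem IsReducedMaxFlow.extraction {F : I.Flow K} (hF : I.IsReducedMaxFlow K F)
    (hK : I.Balanced K) (hc : ∀ i ∈ I.squaresIn K, c i = I.start i)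
    (hc' : ∀ i ∉ I.squaresIn K, c i ∉ K.cells) :
    Extraction I K.cells (I.squaresIn K) (I.targetsIn K) F.edge (I.squaresIn K) (I.targetsIn K) c := by
  obtain ⟨hac, G, hG, hGF⟩ := hF
  obtain ⟨e1, e2⟩ := Flow.cancelsTo_star hGF
  obtain ⟨s1, s2⟩ := hG.saturated hK
  have key : ∀ (f : Fin I.n → ℕ) (pos : Fin I.n → Cell) (U : Finset (Fin I.n)) (v : Cell),
      (∀ i ∈ U, f i = 1) → (∀ i ∉ U, f i = 0) →
      ∑ i with pos i = v, f i = {i ∈ U | pos i = v}.card := by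
    intro f pos U v h1 h2
    rw [Finset.card_filter, Finset.sum_filter, ← Finset.sum_subset (Finset.subset_univ U)]
    · exact Finset.sum_congr rfl fun i hi => by rw [h1 i hi]
    · intro i _ hi
      rw [h2 i hi, ite_self]
  refine ⟨F.supported, hac, fun v => ?_, subset_rfl, subset_rfl, hc, fun i hi v => ⟨?_, ?_⟩, ?_⟩
  · have := F.conserves v
    dsimp only at this ⊢
    rw [key F.source I.start (I.squaresIn K) v, key F.sink I.target (I.targetsIn K) v] at this
    · exact this
    · intro i hi; rw [e2]; exact s2 i (mem_targetsIn.1 hi)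
    · intro i hi; by_contra h; exact hi (mem_targetsIn.2 (F.sink_mem i h))
    · intro i hi; rw [e1]; exact s1 i (mem_squaresIn.1 hi)
    · intro i hi; by_contra h; exact hi (mem_squaresIn.2 (F.source_mem i h))
  · by_contra h; exact hc' i hi (F.supported _ _ h).1
  · by_contra h; exact hc' i hi (F.supported _ _ h).2.1
  · simp

theorem IsReducedMaxFlow.exists_step {F : I.Flow K} (hF : I.IsReducedMaxFlow K F)
    (hK : I.Balanced K) {ms : List (GridMove I.n)} (hr : I.ExtractRun F.edge (I.squaresIn K) ms w R)
    (ht : IsSink w t) : ∃ m w', I.ExtractStep w R m t w' := by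
  have h := hF.extraction hK (c := I.start) (fun _ _ => rfl) fun i hi h => hi (mem_squaresIn.2 h)
  obtain ⟨-, -, -, -, Q', h'⟩ := h.run (K.cells_subset.trans I.gridCells_subset) hr
  exact h'.exists_step K.cells_finite ht

theorem Extraction.exists_run (hA : A.Finite) (hA' : A ⊆ I.domain.cells) (k : ℕ) :
    ∀ {w R Q c}, Extraction I A S T w R Q c → R.card ≤ k →
      ∃ ms w' R', I.ExtractRun w R ms w' R' ∧ ∀ t, ¬ IsSink w' t := by
  induction k with
  | zero =>
    intro w R Q c h hk
    refine ⟨[], w, R, .nil w R, fun t ht => ?_⟩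
    -- A sink always yields a square in `R` to move, so once `R` is empty there is none.
    obtain ⟨m, w', hs⟩ := h.exists_step hA ht
    have := Finset.card_pos.2 ⟨_, hs.mem⟩
    omega
  | succ k ih =>
    intro w R Q c h hk
    by_cases hn : ∀ t, ¬ IsSink w t
    · exact ⟨[], w, R, .nil w R, hn⟩
    · push Not at hn
      obtain ⟨t, ht⟩ := hn
      obtain ⟨m, w', hs⟩ := h.exists_step hA ht
      obtain ⟨-, Q', h'⟩ := h.step hA' hs
      obtain ⟨ms, w'', R'', h1, h2⟩ := ih h' (by rw [Finset.card_erase_of_mem hs.mem]; omega)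
      exact ⟨m :: ms, w'', R'', .cons hs h1, h2⟩

theorem exists_isFlowSchedule (hK : I.Balanced K) : ∃ ms, I.IsFlowSchedule K ms := by
  obtain ⟨F, hF⟩ := exists_isReducedMaxFlow K
  have h := hF.extraction hK (c := I.start) (fun _ _ => rfl) fun i hi h => hi (mem_squaresIn.2 h)
  obtain ⟨ms, w, R, h1, h2⟩ := h.exists_run K.cells_finite
    (K.cells_subset.trans I.gridCells_subset) _ le_rfl
  exact ⟨ms, F, hF, w, R, h1, h2⟩

theorem IsFlowSchedule.clear {ms : List (GridMove I.n)} (h : I.IsFlowSchedule K ms)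
    (hK : I.Balanced K) (hc : ∀ i ∈ I.squaresIn K, c i = I.start i)
    (hc' : ∀ i ∉ I.squaresIn K, c i ∉ K.cells) :
    ClearSchedule I.domain c ms ∧ (ms.map GridMove.robot).Nodup ∧
      (∀ m ∈ ms, m.robot ∈ I.squaresIn K) ∧ (∀ i ∉ I.squaresIn K, cellFinal c ms i = c i) ∧
      cellFinal c ms '' {i | i ∈ I.squaresIn K} = I.target '' {j | j ∈ I.targetsIn K} := by
  obtain ⟨F, hF, w, R, hr, hn⟩ := h
  obtain ⟨h1, h2, h3, h4, Q', h5⟩ :=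
    (hF.extraction hK hc hc').run (K.cells_subset.trans I.gridCells_subset) hr
  exact ⟨h1, h2, h3, h4, h5.image_eq K.cells_finite hn⟩

/-- Induction over the remaining components. The configuration is generalized to one in which every
square is still inside its own component; this keeps the cells of `K` free of foreign squares when
`K` is processed. -/
theorem clear_flatMap {ms : I.Component → List (GridMove I.n)}
    (hms : ∀ K, I.IsFlowSchedule K (ms K)) (hB : ∀ K, I.Balanced K) (Ks : List I.Component) :
    ∀ {c : Fin I.n → Cell}, Ks.Nodup → (∀ K ∈ Ks, ∀ i ∈ I.squaresIn K, c i = I.start i) →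
      (∀ K, ∀ i ∈ I.squaresIn K, c i ∈ K.cells) →
      ClearSchedule I.domain c (Ks.flatMap ms) ∧
      ((Ks.flatMap ms).map GridMove.robot).Nodup ∧
      (∀ m ∈ Ks.flatMap ms, ∃ K ∈ Ks, m.robot ∈ I.squaresIn K) ∧
      (∀ K ∉ Ks, ∀ i ∈ I.squaresIn K, cellFinal c (Ks.flatMap ms) i = c i) ∧
      ∀ K ∈ Ks, cellFinal c (Ks.flatMap ms) '' {i | i ∈ I.squaresIn K} =
        I.target '' {j | j ∈ I.targetsIn K} := by
  have huniq : ∀ {K K' : I.Component} {i}, i ∈ I.squaresIn K → i ∈ I.squaresIn K' → K = K' :=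
    fun h h' => Component.eq_of_mem (mem_squaresIn.1 h) (mem_squaresIn.1 h')
  have hex : ∀ i : Fin I.n, ∃ K : I.Component, i ∈ I.squaresIn K := fun i =>
    ⟨_, mem_squaresIn.2 ((mem_cells_iff (I.start_mem_gridCells i)).2 rfl)⟩
  induction Ks with
  | nil => exact fun _ _ _ => ⟨trivial, List.nodup_nil, by simp, fun _ _ _ _ => rfl, by simp⟩
  | cons K Ks ih =>
    intro c hnd hc hmem
    rw [List.nodup_cons] at hnd
    obtain ⟨a1, a2, a3, a4, a5⟩ := (hms K).clear (hB K) (c := c) (hc K (by simp)) (by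
      intro i hi h
      obtain ⟨K', hK'⟩ := hex i
      exact hi (Component.eq_of_mem h (hmem K' i hK') ▸ hK'))
    have hne : ∀ {K'}, K' ≠ K → ∀ i ∈ I.squaresIn K', cellFinal c (ms K) i = c i :=
      fun hK' i hi => a4 i fun h => hK' (huniq hi h)
    obtain ⟨b1, b2, b3, b4, b5⟩ := ih (c := cellFinal c (ms K)) hnd.2
      (fun K' hK' i hi => by
        rw [hne (fun e => hnd.1 (e ▸ hK')) i hi]
        exact hc K' (List.mem_cons_of_mem _ hK') i hi)
      (fun K' i hi => by
        by_cases e : K' = K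
        · subst e
          have : cellFinal c (ms K') i ∈ I.target '' {j | j ∈ I.targetsIn K'} := by
            rw [← a5]; exact ⟨i, hi, rfl⟩
          obtain ⟨j, hj, e⟩ := this
          rw [← e]; exact mem_targetsIn.1 hj
        · rw [hne e i hi]; exact hmem K' i hi)
    rw [List.flatMap_cons]
    refine ⟨(clearSchedule_append _ _ _).2 ⟨a1, b1⟩, ?_, ?_, ?_, ?_⟩
    · rw [List.map_append, List.nodup_append]
      refine ⟨a2, b2, fun x hx y hy e => ?_⟩
      obtain ⟨m, hm, rfl⟩ := List.mem_map.1 hx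
      obtain ⟨m', hm', rfl⟩ := List.mem_map.1 hy
      obtain ⟨K', hK', h'⟩ := b3 m' hm'
      exact hnd.1 (huniq (a3 m hm) (e ▸ h') ▸ hK')
    · intro m hm
      rcases List.mem_append.1 hm with hm | hm
      · exact ⟨K, by simp, a3 m hm⟩
      · obtain ⟨K', hK', h'⟩ := b3 m hm
        exact ⟨K', List.mem_cons_of_mem _ hK', h'⟩
    · intro K' hK' i hi
      rw [List.mem_cons, not_or] at hK'
      rw [cellFinal_append, b4 K' hK'.2 i hi, hne hK'.1 i hi]
    · intro K' hK'
      rw [cellFinal_append]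
      by_cases e : K' = K
      · subst e
        rw [← a5]
        exact Set.image_congr fun i hi => b4 K' hnd.1 i hi
      · exact b5 K' ((List.mem_cons.1 hK').resolve_left e)

theorem isMonotoneSolution_flatMap (hB : ∀ K, I.Balanced K) {Ks : List I.Component}
    (hnd : Ks.Nodup) (hall : ∀ K, K ∈ Ks) {ms : I.Component → List (GridMove I.n)}
    (hms : ∀ K, I.IsFlowSchedule K (ms K)) : I.IsMonotoneSolution (Ks.flatMap ms) := by
  obtain ⟨h1, h2, -, -, h3⟩ := clear_flatMap hms hB Ks (c := I.start) hnd (fun _ _ _ _ => rfl)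
    fun K i hi => mem_squaresIn.1 hi
  refine isMonotoneSolution_of_clear h1 ?_ h2
  apply Set.Subset.antisymm
  · rintro _ ⟨i, rfl⟩
    have hi := mem_squaresIn.2 ((mem_cells_iff (I.start_mem_gridCells i)).2 rfl)
    obtain ⟨j, -, e⟩ := (h3 _ (hall _)).subset ⟨i, hi, rfl⟩
    exact ⟨j, e⟩
  · rintro _ ⟨j, rfl⟩
    have hj := mem_targetsIn.2 ((mem_cells_iff (I.target_mem_gridCells j)).2 rfl)
    obtain ⟨i, -, e⟩ := (h3 _ (hall _)).superset ⟨j, hj, rfl⟩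
    exact ⟨i, e⟩

theorem exists_isMonotoneSolution (hB : ∀ K, I.Balanced K) : ∃ ms, I.IsMonotoneSolution ms := by
  have : Finite I.gridCells := I.gridCells_finite
  have : Finite I.Component := Finite.of_surjective _ Quot.mk_surjective
  have := Fintype.ofFinite I.Component
  choose ms hms using fun K => exists_isFlowSchedule (hB K)
  exact ⟨_, isMonotoneSolution_flatMap hB Finset.univ.nodup_toList (fun K => by simp) hms⟩

theorem solvable_iff_balanced (I : Instance) : I.Solvable ↔ ∀ K : I.Component, I.Balanced K :=
  ⟨fun h K => h.balanced K, fun h => by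
    obtain ⟨ms, h1, -⟩ := exists_isMonotoneSolution h
    exact ⟨_, h1⟩⟩

theorem solvableWithin_iff (I : Instance) {k : ℕ} (hk : 1 ≤ k) : I.SolvableWithin k ↔ I.Solvable := by
  refine ⟨fun ⟨ms, h, _⟩ => ⟨ms, h⟩, fun h => ?_⟩
  obtain ⟨ms, h1, h2⟩ := exists_isMonotoneSolution (I.solvable_iff_balanced.1 h)
  exact ⟨_, h1, fun i => (h2 i).trans hk⟩

end Instance

end SquareReconfig

/-! ### The main theorem. -/

open SquareReconfig in
theorem mainTheorem2 :
    -- one polynomial-time program decides all instances and outputs monotone solutions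
    (∃ (P : Program) (p : Polynomial ℕ), ∀ I : Instance, ∃ (t : ℕ) (s : State),
      Exec P (State.init I.encode) t s ∧ t ≤ p.eval (bitLength I.encode) ∧
      ∃ a : Option (List (GridMove I.n)), s.output = encodeAnswer a ∧ I.IsCorrectAnswer a) ∧
    -- solvability does not depend on the number of moves allowed per square
    (∀ (I : Instance) (k : ℕ), 1 ≤ k → (I.SolvableWithin k ↔ I.Solvable)) ∧
    -- solvability is decided component by component
    (∀ I : Instance, I.Solvable ↔ ∀ K : I.Component, I.Balanced K) ∧
    -- on every balanced component the flow procedure can be carried out, whatever choices are made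
    (∀ (I : Instance) (K : I.Component), I.Balanced K →
      (∃ F : I.Flow K, F.IsMax) ∧
      (∀ F : I.Flow K, F.IsAcyclic ∨ ∃ G : I.Flow K, F.CancelsTo G) ∧
      WellFounded (fun G F : I.Flow K => F.CancelsTo G) ∧
      (∀ F : I.Flow K, I.IsReducedMaxFlow K F →
        ∀ ms w R, I.ExtractRun F.edge (I.squaresIn K) ms w R →
          ∀ t, IsSink w t → ∃ m w', I.ExtractStep w R m t w')) ∧
    -- and the resulting schedules together form a monotone solution
    (∀ I : Instance, I.Solvable →
      ∀ Ks : List I.Component, Ks.Nodup → (∀ K, K ∈ Ks) →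
      ∀ ms : I.Component → List (GridMove I.n), (∀ K, I.IsFlowSchedule K (ms K)) →
        I.IsMonotoneSolution (Ks.flatMap ms)) := by
  refine ⟨⟨solver, solverCost, solver_spec⟩, fun I k hk => I.solvableWithin_iff hk,
    Instance.solvable_iff_balanced, fun I K hK => ⟨Instance.Flow.exists_isMax K,
      Instance.Flow.isAcyclic_or_exists_cancelsTo, Instance.Flow.cancelsTo_wf,
      fun F hF ms w R hr t ht => hF.exists_step hK hr ht⟩,
    fun I hI Ks hnd hall ms hms =>
      Instance.isMonotoneSolution_flatMap hI.balanced hnd hall hms⟩
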